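/- Setting. Let $N\ge 2$, $0\le\eta_m<\tau_M$, and let $A,A_1\in\mathbb R^{n\times n}$, $B_i\in\mathbb R^{n\times n_i}$, $C_i\in\mathbb R^{n_i\times n}$ $(i=1,\dots,N)$, $D\in\mathbb R^{n\times q}$ (for static output feedback $u=\sum_i K_i\hat y_i$ of $\dot x=Ax+Bu+D\omega$ one has $A_1=\sum_i BK_iC_i$, $B_i=BK_i$). Sampling instants $0=s_0<s_1<\cdots$, $s_k\to\infty$, delays $\eta_k\ge\eta_m$ and updating instants $t_k=s_k+\eta_k\le t_{k+1}$ satisfy $t_{k+1}-t_k+\eta_k\le\tau_M$. The disturbance $\omega$ is measurable with $|\omega(t)|\le\Delta$ for almost all $t\ge0$, for some $\Delta>0$. With active nodes $i_k^*\in\{1,\dots,N\}$, the hybrid system is $$\dot x(t)=Ax(t)+A_1x(t_k-\eta_k)+\sum_{i\ne i_k^*}B_ie_i(t)+D\omega(t),\qquad \dot e(t)=0,\qquad t\in[t_k,t_{k+1}),$$ $$x(t_{k+1})=x(t_{k+1}^-),\qquad e_i(t_{k+1})=\begin{cases}C_i[x(s_k)-x(s_{k+1})],& i=i_k^*,\\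 e_i(t_k)+C_i[x(s_k)-x(s_{k+1})],& i\neq i_k^*,\end{cases}$$ with $e_i(t)\in\mathbb R^{n_i}$, initial data $x_{t_0}\in W[-\tau_M,0]$ (absolutely continuous with square integrable derivative, $\|\phi\|_W=\max|\phi|+(\int_{-\tau_M}^0|\dot\phi|^2)^{1/2}$; $x_t(\theta)=x(t+\theta)$) and arbitrary $e(t_0)$. Round-Robin (RR) protocol: $i_{k+N}^*=i_k^*$ for all $k$ and $i_0^*,\dots,i_{N-1}^*$ are distinct. TOD protocol with weights $Q_i>0$: $e_i(t_k)^TQ_ie_i(t_k)\le e_{i_k^*}(t_k)^TQ_{i_k^*}e_{i_k^*}(t_k)$ for all $k,i$. LMIs. For $\alpha\ge0$, a scalar $b>0$, $n\times n$ matrices $P,S_0,R_0,S_1,R_1>0$ and $S_{12}$, and $n_i\times n_i$ matrices $Q_i>0$, put $U_i=Q_i/(N-1)$, $G_i=(N-1)Q_ie^{2\alpha[\tau_M+(N-2)(\tau_M-\eta_m)]}$, $\psi_j=-\frac1{\tau_M-\eta_m}U_j+2\alpha Q_j$, $H=\eta_m^2R_0+(\tau_M-\eta_m)^2R_1+(\tau_M-\eta_m)\sum_lC_l^TG_lC_l$.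 With respect to the blocks $\mathrm{col}\{x(t),x(t-\eta_m),x(t-\tau(t)),x(t-\tau_M),(e_j)_{j\ne i},\omega\}$ let $F_1^i=[I\ 0\ 0\ 0\ 0\ 0]$, $F_2^i=[I\ {-I}\ 0\ 0\ 0\ 0]$, $F^i=\begin{bmatrix}0&I&-I&0&0&0\\0&0&I&-I&0&0\end{bmatrix}$, $\Xi_i=[A\ 0\ A_1\ 0\ (B_j)_{j\ne i}\ D]$, $\Upsilon_i=\mathrm{diag}\{S_0+2\alpha P,-(S_0-S_1)e^{-2\alpha\eta_m},0,-S_1e^{-2\alpha\tau_M},(\psi_j)_{j\ne i},-bI\}$, $\Sigma_i=(F_1^i)^TP\Xi_i+\Xi_i^TPF_1^i+\Upsilon_i-(F_2^i)^TR_0F_2^ie^{-2\alpha\eta_m}$. The LMIs (with parameter $\alpha$) are $$\Phi=\begin{bmatrix}R_1&S_{12}\\S_{12}^T&R_1\end{bmatrix}\ge0,\qquad \begin{bmatrix}\Sigma_i-(F^i)^T\Phi F^ie^{-2\alpha\tau_M}&\Xi_i^TH\\ H\Xi_i&-H\end{bmatrix}<0,\quad i=1,\dots,N.$$ Functionals.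 Let $$\begin{aligned}\tilde V(t)={}&x^T(t)Px(t)+\int_{t-\eta_m}^te^{2\alpha(s-t)}x^T(s)S_0x(s)\,ds+\int_{t-\tau_M}^{t-\eta_m}e^{2\alpha(s-t)}x^T(s)S_1x(s)\,ds\\&+\eta_m\int_{-\eta_m}^0\int_{t+\theta}^te^{2\alpha(s-t)}\dot x^T(s)R_0\dot x(s)\,ds\,d\theta+(\tau_M-\eta_m)\int_{-\tau_M}^{-\eta_m}\int_{t+\theta}^te^{2\alpha(s-t)}\dot x^T(s)R_1\dot x(s)\,ds\,d\theta,\end{aligned}$$ $$V(t)=\tilde V(t)+\sum_{i=1}^N(\tau_M-\eta_m)\int_{a_k}^te^{2\alpha(s-t)}(C_i\dot x(s))^TG_iC_i\dot x(s)\,ds,\quad t\in[t_k,t_{k+1}),$$ where $a_k=s_k$ if $N=2$, while for $N>2$ (and $k\ge N-1$) $a_{N-1}=s_0$ and $a_k=s_k$ for $k\ge N$. Theorem. Let $\alpha>0$ and suppose that $b,P,S_0,R_0,S_1,R_1,S_{12},Q_1,\dots,Q_N$ as above satisfy the LMIs with parameter $\alpha$. (i) If $N>2$, every solution under the RR protocol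 satisfies, for all $t\ge t_{N-1}$, $$V(t)\le e^{-2\alpha(t-t_{N-1})}\Big[V(t_{N-1})+\sum_{i=1}^Ne_i^T(t_{N-1})Q_ie_i(t_{N-1})\Big]+\frac b{2\alpha}\Delta^2,$$ and the system is $x$-ISS for $t\ge t_{N-1}$: there are constants $\bar b,\delta,c>0$, independent of the solution, the disturbance, the active nodes and the sampling data, such that for all $t\ge t_{N-1}$ $$|x(t)|^2\le\bar be^{-\delta(t-t_0)}\big[\|x_{t_0}\|_W^2+|e(t_0)|^2\big]+c\,\|\omega[t_0,t]\|_\infty^2 .$$ (ii) If $N=2$, then under the TOD protocol with weights $Q_1,Q_2$, and likewise under the RR protocol, every solution satisfies, for all $t\ge t_0$, $$V(t)\le e^{-2\alpha(t-t_0)}\Big[V(t_0)+\sum_{i=1}^2e_i^T(t_0)Q_ie_i(t_0)\Big]+\frac b{2\alpha}\Delta^2,$$ and the system is $x$-ISS, i.e. the ISS estimate of (i) holds for all $t\ge t_0$. (iii) If the LMIs are satisfied with $\alpha=0$, then there is $\bar\alpha>0$ such that for every $\alpha_0\in(0,\bar\alpha]$ the conclusions (i) and (ii) hold with $\alpha$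 replaced by $\alpha_0$ (also in $V$ and $G_i$), with the same $b,P,\dots,Q_N$. -/

import Mathlib

open MeasureTheory Set Filter Matrix

noncomputable section

namespace RoundRobin

/-- Euclidean norm `|v|` of a vector `v ∈ ℝⁿ`. -/
def eNorm {n : ℕ} (v : Fin n → ℝ) : ℝ := ‖WithLp.toLp 2 v‖

/-- The quadratic form `vᵀ M v`; for `M > 0` this is `|√M v|²`. -/
def quad {n : ℕ} (M : Matrix (Fin n) (Fin n) ℝ) (v : Fin n → ℝ) : ℝ := v ⬝ᵥ (M *ᵥ v)

/-- The matrices of the hybrid model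
`ẋ(t) = A x(t) + A₁ x(t_k - η_k) + ∑_{i ≠ i_k^*} B_i e_i(t) + D ω(t)` with outputs `y_i = C_i x`.
Static output feedback `u = ∑ K_i ŷ_i` for the plant `ẋ = A x + B u + D ω` is the case
`A₁ = ∑ B K_i C_i`, `B_i = B K_i`; dynamic output feedback yields the same form for the
augmented state. -/
structure HybridSystem (n q N : ℕ) (p : Fin N → ℕ) where
  A : Matrix (Fin n) (Fin n) ℝ
  A₁ : Matrix (Fin n) (Fin n) ℝ
  B : ∀ i : Fin N, Matrix (Fin n) (Fin (p i)) ℝ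
  C : ∀ i : Fin N, Matrix (Fin (p i)) (Fin n) ℝ
  D : Matrix (Fin n) (Fin q) ℝ

/-- Sampling instants `s_k` and network delays `η_k`, with updating instants
`t_k = s_k + η_k`. A sample never overtakes a later one (`t` is monotone). -/
structure Sampling (ηm τM : ℝ) where
  s : ℕ → ℝ
  η : ℕ → ℝ
  s_zero : s 0 = 0
  s_strictMono : StrictMono s
  s_tendsto : Tendsto s atTop atTop
  t_mono : Monotone fun k => s k + η k
  le_delay : ∀ k, ηm ≤ η k
  span_le : ∀ k, (s (k + 1) + η (k + 1)) - (s k + η k) + η k ≤ τM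

/-- The updating instants `t_k = s_k + η_k`. -/
def Sampling.t {ηm τM : ℝ} (S : Sampling ηm τM) (k : ℕ) : ℝ := S.s k + S.η k

/-- `φ ∈ W[-τ_M, 0]`: absolutely continuous with square integrable derivative. -/
def MemW {n : ℕ} (τM : ℝ) (φ : ℝ → Fin n → ℝ) : Prop :=
  AbsolutelyContinuousOnInterval φ (-τM) 0 ∧
    IntegrableOn (fun θ => eNorm (deriv φ θ) ^ 2) (Icc (-τM) 0)

/-- `‖φ‖_W = max_{[-τ_M, 0]} |φ| + (∫_{-τ_M}^0 |φ'|²)^{1/2}`. -/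
def normW {n : ℕ} (τM : ℝ) (φ : ℝ → Fin n → ℝ) : ℝ :=
  sSup ((fun θ => eNorm (φ θ)) '' Icc (-τM) 0) +
    Real.sqrt (∫ θ in (-τM)..0, eNorm (deriv φ θ) ^ 2)

/-- The segment `x_t(θ) = x(t + θ)`. -/
def segment {n : ℕ} (x : ℝ → Fin n → ℝ) (t : ℝ) : ℝ → Fin n → ℝ := fun θ => x (t + θ)

/-- `ω` is a measurable disturbance on `[0, ∞)`, essentially bounded by `Δ > 0`. -/
def IsDisturbance {q : ℕ} (ω : ℝ → Fin q → ℝ) (Δ : ℝ) : Prop :=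
  0 < Δ ∧ AEStronglyMeasurable ω (volume.restrict (Ici 0)) ∧
    ∀ᵐ t : ℝ, 0 ≤ t → eNorm (ω t) ≤ Δ

/-- `‖ω[a, b]‖_∞`, the essential supremum of `|ω|` over `[a, b]`. -/
def essSupNorm {q : ℕ} (ω : ℝ → Fin q → ℝ) (a b : ℝ) : ℝ :=
  (eLpNorm (fun t => eNorm (ω t)) ⊤ (volume.restrict (Icc a b))).toReal

section Model

variable {n q N : ℕ} {p : Fin N → ℕ}

/-- `(x, e)` solves the hybrid system for the sampling data `S`, the active nodes `i_k^*` and the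
disturbance `ω`, with `x_{t_0} ∈ W[-τ_M, 0]` and arbitrary `e(t_0)`. Since `ė = 0` on
`[t_k, t_{k+1})`, the error is recorded by its values `e k = e(t_k)`. The state is absolutely
continuous (so `x(t_{k+1}) = x(t_{k+1}⁻)`) and satisfies the differential equation a.e. -/
structure IsSolution (sys : HybridSystem n q N p) {ηm τM : ℝ} (S : Sampling ηm τM)
    (istar : ℕ → Fin N) (ω : ℝ → Fin q → ℝ) (x : ℝ → Fin n → ℝ)
    (e : ℕ → ∀ i : Fin N, Fin (p i) → ℝ) : Prop where
  initial : MemW τM (segment x (S.t 0))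
  absCont : ∀ T, S.t 0 ≤ T → AbsolutelyContinuousOnInterval x (S.t 0) T
  flow : ∀ k, ∀ᵐ t : ℝ, t ∈ Ico (S.t k) (S.t (k + 1)) →
    HasDerivAt x
      (sys.A *ᵥ x t + sys.A₁ *ᵥ x (S.t k - S.η k)
        + (∑ i ∈ Finset.univ.erase (istar k), sys.B i *ᵥ e k i) + sys.D *ᵥ ω t) t
  reset_active : ∀ k, e (k + 1) (istar k) =
    sys.C (istar k) *ᵥ (x (S.t k - S.η k) - x (S.t (k + 1) - S.η (k + 1)))
  reset_inactive : ∀ k i, i ≠ istar k → e (k + 1) i =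
    e k i + sys.C i *ᵥ (x (S.t k - S.η k) - x (S.t (k + 1) - S.η (k + 1)))

/-- A protocol: which sequences of active nodes are allowed for a given error sequence. -/
abbrev Protocol (p : Fin N → ℕ) : Type :=
  (ℕ → Fin N) → (ℕ → ∀ i : Fin N, Fin (p i) → ℝ) → Prop

/-- Round-Robin protocol: `i_k^* = i_{k+N}^*`, and `i_0^*, …, i_{N-1}^*` are distinct. -/
def RR (p : Fin N → ℕ) : Protocol p := fun istar _ =>
  (∀ k, istar k = istar (k + N)) ∧ ∀ j l, j < l → l ≤ N - 1 → istar j ≠ istar l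

/-- Try-Once-Discard protocol with weights `Q_i`: the active node has the largest weighted
error `|√Q_i e_i(t)|²`, `t ∈ [t_k, t_{k+1})`. -/
def TOD (Q : ∀ i : Fin N, Matrix (Fin (p i)) (Fin (p i)) ℝ) : Protocol p := fun istar e =>
  ∀ k i, quad (Q i) (e k i) ≤ quad (Q (istar k)) (e k (istar k))

/-- `x`-ISS of the hybrid system under a protocol, with the bound required for `t ≥ t_{k₀}`.
The constants are uniform in the sampling data, active nodes, disturbance and solution. -/
def IsXISSFrom (sys : HybridSystem n q N p) (ηm τM : ℝ) (prot : Protocol p) (k₀ : ℕ) : Prop :=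
  ∃ b > 0, ∃ δ > 0, ∃ c > 0,
    ∀ (S : Sampling ηm τM) (istar : ℕ → Fin N) (ω : ℝ → Fin q → ℝ) (Δ : ℝ)
      (x : ℝ → Fin n → ℝ) (e : ℕ → ∀ i : Fin N, Fin (p i) → ℝ),
      IsDisturbance ω Δ → IsSolution sys S istar ω x e → prot istar e →
      ∀ t, S.t k₀ ≤ t →
        eNorm (x t) ^ 2 ≤
          b * Real.exp (-δ * (t - S.t 0)) *
              (normW τM (segment x (S.t 0)) ^ 2 + ∑ i, eNorm (e 0 i) ^ 2)
            + c * essSupNorm ω (S.t 0) t ^ 2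

/-- The decision variables. -/
structure Decision (n : ℕ) (p : Fin N → ℕ) where
  b : ℝ
  P : Matrix (Fin n) (Fin n) ℝ
  S₀ : Matrix (Fin n) (Fin n) ℝ
  R₀ : Matrix (Fin n) (Fin n) ℝ
  S₁ : Matrix (Fin n) (Fin n) ℝ
  R₁ : Matrix (Fin n) (Fin n) ℝ
  S₁₂ : Matrix (Fin n) (Fin n) ℝ
  Q : ∀ i : Fin N, Matrix (Fin (p i)) (Fin (p i)) ℝ

/-- `U_i = Q_i / (N - 1)`. -/
def Decision.U (d : Decision n p) (i : Fin N) : Matrix (Fin (p i)) (Fin (p i)) ℝ :=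
  (1 / ((N : ℝ) - 1)) • d.Q i

/-- `G_i = (N - 1) Q_i e^{2α[τ_M + (N-2)(τ_M - η_m)]}`. -/
def Decision.G (d : Decision n p) (ηm τM α : ℝ) (i : Fin N) :
    Matrix (Fin (p i)) (Fin (p i)) ℝ :=
  (((N : ℝ) - 1) * Real.exp (2 * α * (τM + ((N : ℝ) - 2) * (τM - ηm)))) • d.Q i

/-- Index type of the components `e_j`, `j ≠ i`. -/
abbrev ErrIdx (p : Fin N → ℕ) (i : Fin N) : Type := Σ j : {j : Fin N // j ≠ i}, Fin (p j)

/-- Index type of `ξ_i = col{x(t), x(t-η_m), x(t-τ(t)), x(t-τ_M), (e_j)_{j ≠ i}, ω}`. -/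
abbrev XiIdx (n q : ℕ) (p : Fin N → ℕ) (i : Fin N) : Type :=
  Fin n ⊕ (Fin n ⊕ (Fin n ⊕ (Fin n ⊕ (ErrIdx p i ⊕ Fin q))))

/-- `F_1^i = [I 0 0 0 0]`. -/
def F1 (n q : ℕ) (p : Fin N → ℕ) (i : Fin N) : Matrix (Fin n) (XiIdx n q p i) ℝ :=
  fromCols 1 0

/-- `F_2^i = [I -I 0 0 0]`. -/
def F2 (n q : ℕ) (p : Fin N → ℕ) (i : Fin N) : Matrix (Fin n) (XiIdx n q p i) ℝ :=
  fromCols 1 (fromCols (-1) 0)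

/-- `F^i = [0 I -I 0 0; 0 0 I -I 0]`. -/
def F (n q : ℕ) (p : Fin N → ℕ) (i : Fin N) : Matrix (Fin n ⊕ Fin n) (XiIdx n q p i) ℝ :=
  fromRows
    (fromCols 0 (fromCols 1 (fromCols (-1) 0)))
    (fromCols 0 (fromCols 0 (fromCols 1 (fromCols (-1) 0))))

/-- `Ξ_i = [A 0 A₁ 0 (B_j)_{j ≠ i} D]`. -/
def Xi (sys : HybridSystem n q N p) (i : Fin N) : Matrix (Fin n) (XiIdx n q p i) ℝ :=
  fromCols sys.A (fromCols 0 (fromCols sys.A₁ (fromCols 0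
    (fromCols (Matrix.of fun a (jb : ErrIdx p i) => sys.B jb.1 a jb.2) sys.D))))

/-- Block diagonal matrix `diag{X, Y}`. -/
def diag2 {l m : Type} (X : Matrix l l ℝ) (Y : Matrix m m ℝ) : Matrix (l ⊕ m) (l ⊕ m) ℝ :=
  fromBlocks X 0 0 Y

/-- `ψ_j = -U_j / (τ_M - η_m) + 2 α Q_j`. -/
def psi (d : Decision n p) (ηm τM α : ℝ) (j : Fin N) : Matrix (Fin (p j)) (Fin (p j)) ℝ :=
  (-(1 / (τM - ηm))) • d.U j + (2 * α) • d.Q j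

/-- `Υ_i = diag{S₀ + 2αP, -(S₀ - S₁)e^{-2αη_m}, 0, -S₁e^{-2ατ_M}, (ψ_j)_{j ≠ i}, -b I}`. -/
def Upsilon (d : Decision n p) (q : ℕ) (ηm τM α : ℝ) (i : Fin N) :
    Matrix (XiIdx n q p i) (XiIdx n q p i) ℝ :=
  diag2 (d.S₀ + (2 * α) • d.P)
    (diag2 (-(Real.exp (-2 * α * ηm) • (d.S₀ - d.S₁)))
      (diag2 (0 : Matrix (Fin n) (Fin n) ℝ)
        (diag2 (-(Real.exp (-2 * α * τM) • d.S₁))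
          (diag2
            (blockDiagonal' fun j : {j : Fin N // j ≠ i} => psi d ηm τM α j)
            (-(d.b • (1 : Matrix (Fin q) (Fin q) ℝ)))))))

/-- `Σ_i = F_1ᵀ P Ξ + Ξᵀ P F_1 + Υ - F_2ᵀ R₀ F_2 e^{-2αη_m}`. -/
def SigmaMat (sys : HybridSystem n q N p) (d : Decision n p) (ηm τM α : ℝ) (i : Fin N) :
    Matrix (XiIdx n q p i) (XiIdx n q p i) ℝ :=
  (F1 n q p i)ᵀ * d.P * Xi sys i + (Xi sys i)ᵀ * d.P * F1 n q p i + Upsilon d q ηm τM α i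
    - Real.exp (-2 * α * ηm) • ((F2 n q p i)ᵀ * d.R₀ * F2 n q p i)

/-- `H = η_m² R₀ + (τ_M - η_m)² R₁ + (τ_M - η_m) ∑ C_lᵀ G_l C_l`. -/
def HMat (sys : HybridSystem n q N p) (d : Decision n p) (ηm τM α : ℝ) :
    Matrix (Fin n) (Fin n) ℝ :=
  ηm ^ 2 • d.R₀ + (τM - ηm) ^ 2 • d.R₁
    + (τM - ηm) • ∑ l, (sys.C l)ᵀ * d.G ηm τM α l * sys.C l

/-- `Φ = [R₁ S₁₂; * R₁]`. -/
def PhiMat (d : Decision n p) : Matrix (Fin n ⊕ Fin n) (Fin n ⊕ Fin n) ℝ :=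
  fromBlocks d.R₁ d.S₁₂ d.S₁₂ᵀ d.R₁

/-- `[Σ_i - (F^i)ᵀ Φ F^i e^{-2ατ_M}, Ξ_iᵀ H; *, -H]`. -/
def LMIMat (sys : HybridSystem n q N p) (d : Decision n p) (ηm τM α : ℝ) (i : Fin N) :
    Matrix (XiIdx n q p i ⊕ Fin n) (XiIdx n q p i ⊕ Fin n) ℝ :=
  fromBlocks
    (SigmaMat sys d ηm τM α i
      - Real.exp (-2 * α * τM) • ((F n q p i)ᵀ * PhiMat d * F n q p i))
    ((Xi sys i)ᵀ * HMat sys d ηm τM α)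
    ((Xi sys i)ᵀ * HMat sys d ηm τM α)ᵀ
    (-HMat sys d ηm τM α)

/-- The decision variables `d` satisfy the LMIs with tuning parameter `α`
(for a matrix, `M < 0` means that `-M` is positive definite). -/
structure SatisfiesLMIs (sys : HybridSystem n q N p) (d : Decision n p) (ηm τM α : ℝ) :
    Prop where
  b_pos : 0 < d.b
  P_pos : d.P.PosDef
  S₀_pos : d.S₀.PosDef
  R₀_pos : d.R₀.PosDef
  S₁_pos : d.S₁.PosDef
  R₁_pos : d.R₁.PosDef
  Q_pos : ∀ i, (d.Q i).PosDef
  phi_nonneg : (PhiMat d).PosSemidef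
  lmi_neg : ∀ i, (-LMIMat sys d ηm τM α i).PosDef

/-- The functional `Ṽ(t, x_t, ẋ_t)`. -/
def Vtilde (d : Decision n p) (ηm τM α : ℝ) (x : ℝ → Fin n → ℝ) (t : ℝ) : ℝ :=
  quad d.P (x t)
    + (∫ s in (t - ηm)..t, Real.exp (2 * α * (s - t)) * quad d.S₀ (x s))
    + (∫ s in (t - τM)..(t - ηm), Real.exp (2 * α * (s - t)) * quad d.S₁ (x s))
    + ηm * (∫ θ in (-ηm)..0, ∫ s in (t + θ)..t,
        Real.exp (2 * α * (s - t)) * quad d.R₀ (deriv x s))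
    + (τM - ηm) * (∫ θ in (-τM)..(-ηm), ∫ s in (t + θ)..t,
        Real.exp (2 * α * (s - t)) * quad d.R₁ (deriv x s))

/-- `V_G = ∑_i (τ_M - η_m) ∫_a^t e^{2α(s-t)} |√G_i C_i ẋ(s)|² ds` with starting time `a`. -/
def VG (sys : HybridSystem n q N p) (d : Decision n p) (ηm τM α : ℝ) (x : ℝ → Fin n → ℝ)
    (a t : ℝ) : ℝ :=
  ∑ i, (τM - ηm) * ∫ s in a..t,
    Real.exp (2 * α * (s - t)) * quad (d.G ηm τM α i) (sys.C i *ᵥ deriv x s)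

/-- `V(t, x_t, ẋ_t)` for `t ∈ [t_k, t_{k+1})` in the case `N = 2`: here `V_G` starts at `s_k`. -/
def V (sys : HybridSystem n q N p) (d : Decision n p) {ηm τM : ℝ} (S : Sampling ηm τM) (α : ℝ)
    (x : ℝ → Fin n → ℝ) (k : ℕ) (t : ℝ) : ℝ :=
  Vtilde d ηm τM α x t + VG sys d ηm τM α x (S.s k) t

/-- `V(t, x_t, ẋ_t)` for `t ∈ [t_k, t_{k+1})`, `k ≥ N - 1`, in the Round-Robin case: `V_G` starts
at `s_k` if `k ≥ N` and at `s_0` if `k = N - 1`. -/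
def VRR (sys : HybridSystem n q N p) (d : Decision n p) {ηm τM : ℝ} (S : Sampling ηm τM) (α : ℝ)
    (x : ℝ → Fin n → ℝ) (k : ℕ) (t : ℝ) : ℝ :=
  Vtilde d ηm τM α x t + VG sys d ηm τM α x (if N ≤ k then S.s k else S.s 0) t

/-- For every solution under the Round-Robin protocol, for all `t ≥ t_{N-1}`,
`V ≤ e^{-2α(t - t_{N-1})} V_e(t_{N-1}) + (b / 2α) Δ²`, where
`V_e(t_{N-1}) = V(t_{N-1}) + ∑ |√Q_i e_i(t_{N-1})|²`. -/
def BoundRR (sys : HybridSystem n q N p) (d : Decision n p) (ηm τM α : ℝ) : Prop :=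
  ∀ (S : Sampling ηm τM) (istar : ℕ → Fin N) (ω : ℝ → Fin q → ℝ) (Δ : ℝ)
    (x : ℝ → Fin n → ℝ) (e : ℕ → ∀ i : Fin N, Fin (p i) → ℝ),
    IsDisturbance ω Δ → IsSolution sys S istar ω x e → RR p istar e →
    ∀ k, N - 1 ≤ k → ∀ t ∈ Ico (S.t k) (S.t (k + 1)),
      VRR sys d S α x k t ≤
        Real.exp (-2 * α * (t - S.t (N - 1))) *
            (VRR sys d S α x (N - 1) (S.t (N - 1)) + ∑ i, quad (d.Q i) (e (N - 1) i))
          + d.b / (2 * α) * Δ ^ 2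

/-- For every solution under the protocol `prot`, for all `t ≥ t_0`,
`V ≤ e^{-2α(t - t_0)} V_e(t_0) + (b / 2α) Δ²`, where `V_e(t_0) = V(t_0) + ∑ |√Q_i e_i(t_0)|²`. -/
def BoundFromStart (sys : HybridSystem n q N p) (d : Decision n p) (ηm τM α : ℝ)
    (prot : Protocol p) : Prop :=
  ∀ (S : Sampling ηm τM) (istar : ℕ → Fin N) (ω : ℝ → Fin q → ℝ) (Δ : ℝ)
    (x : ℝ → Fin n → ℝ) (e : ℕ → ∀ i : Fin N, Fin (p i) → ℝ),
    IsDisturbance ω Δ → IsSolution sys S istar ω x e → prot istar e →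
    ∀ k, ∀ t ∈ Ico (S.t k) (S.t (k + 1)),
      V sys d S α x k t ≤
        Real.exp (-2 * α * (t - S.t 0)) *
            (V sys d S α x 0 (S.t 0) + ∑ i, quad (d.Q i) (e 0 i))
          + d.b / (2 * α) * Δ ^ 2

/-- The solution bounds and `x`-ISS with decay rate `α`: for `N > 2` under Round-Robin from
`t_{N-1}` on, for `N = 2` under both protocols from `t_0` on. -/
def Conclusion (sys : HybridSystem n q N p) (d : Decision n p) (ηm τM α : ℝ) : Prop :=
  (2 < N → BoundRR sys d ηm τM α ∧ IsXISSFrom sys ηm τM (RR p) (N - 1)) ∧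
  (N = 2 →
    (BoundFromStart sys d ηm τM α (TOD d.Q) ∧ IsXISSFrom sys ηm τM (TOD d.Q) 0) ∧
    (BoundFromStart sys d ηm τM α (RR p) ∧ IsXISSFrom sys ηm τM (RR p) 0))

end Model

end RoundRobin

end

noncomputable section

namespace RoundRobin

/-! Write `h = τM - ηm`, `β = b Δ² / (2α)`, and let `E_k` be the sum of the weighted squared errors
`quad (Q j) (e k j)` over the inactive nodes `j ≠ istar k`.

Flow. On `[t_k, t_{k+1})` the sampled state is `x(s_k)`, with `s_k` between `t - τM` and `t - ηm`.
Jensen's inequality and the reciprocally convex combination turn the integral terms of `V'` into the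
quadratic terms of the LMI. Testing the LMI on `(ξ, Ξ ξ)` then gives `V' + 2αV ≤ b|ω|² + (1 /
(h(N-1)) - 2α) E_k` almost everywhere (`weightedDeriv_le`). Since the interval has length at most
`h`, integration yields `V(t) - β ≤ e^{-2α(t - t_k)} (V(t_k) - β + E_k / (N-1))`
(`functional_step`).

Jumps. The surplus `E_k / (N-1)` is paid for by `V_G`. When its starting time moves from `s_k` to
`s_{k+1}`, the integral over `[s_k, s_{k+1}]` is released, and by Jensen it dominates a multiple of
the output gap `∑ |√Q_i C_i (x(s_k) - x(s_{k+1}))|²` (`functional_jump`). For `N = 2` the error of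
the inactive node is at most that of the node just reset, so a single gap suffices. Under
Round-Robin an inactive error is a sum of at most `N - 1` recent output differences, and
Cauchy-Schwarz bounds `E_k / (N-1)` by the last `N - 1` gaps (`IsSolution.sum_quad_error_le`).
Adding these gaps to `V` with weights that decrease with their age makes the sum minus `β` decay at
rate `2α` (`functional_le_of_roundRobin`).

ISS follows because `V` dominates `|x|²`, the initial value of `V` is bounded by `‖x_{t_0}‖_W²`, and
before `t_{N-1}` the functional and the errors grow by at most a fixed factor per interval
(`functional_growth`). The case `α = 0` reduces to small positive `α`, since positive definiteness
is an open condition and the LMI matrix is continuous in `α`. -/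

theorem dotProduct_mulVec_symm {ι : Type*} [Fintype ι] {M : Matrix ι ι ℝ} (hM : Mᵀ = M)
    (u v : ι → ℝ) : u ⬝ᵥ (M *ᵥ v) = v ⬝ᵥ (M *ᵥ u) := by
  rw [dotProduct_mulVec, ← mulVec_transpose, hM, dotProduct_comm]

theorem quad_nonneg {n : ℕ} {M : Matrix (Fin n) (Fin n) ℝ} (hM : M.PosSemidef)
    (v : Fin n → ℝ) : 0 ≤ quad M v := by
  simpa [quad] using hM.dotProduct_mulVec_nonneg v

theorem quad_smul_left {n : ℕ} (c : ℝ) (M : Matrix (Fin n) (Fin n) ℝ) (v : Fin n → ℝ) :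
    quad (c • M) v = c * quad M v := by
  simp [quad, smul_mulVec, dotProduct_smul]

theorem quad_smul_right {n : ℕ} (c : ℝ) (M : Matrix (Fin n) (Fin n) ℝ) (v : Fin n → ℝ) :
    quad M (c • v) = c ^ 2 * quad M v := by
  simp [quad, mulVec_smul, dotProduct_smul, smul_dotProduct]; ring

theorem quad_zero {n : ℕ} (M : Matrix (Fin n) (Fin n) ℝ) : quad M 0 = 0 := by
  simp [quad]

theorem quad_neg {n : ℕ} (M : Matrix (Fin n) (Fin n) ℝ) (v : Fin n → ℝ) :
    quad M (-v) = quad M v := by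
  simp [quad, mulVec_neg]

theorem quad_add_left {n : ℕ} (M M' : Matrix (Fin n) (Fin n) ℝ) (v : Fin n → ℝ) :
    quad (M + M') v = quad M v + quad M' v := by
  simp [quad, add_mulVec]

theorem transpose_of_posDef {ι : Type*} {M : Matrix ι ι ℝ} (hM : M.PosDef) : Mᵀ = M := by
  have := hM.1
  rwa [Matrix.IsHermitian, conjTranspose_eq_transpose_of_trivial] at this

/-! ### The LMI as a scalar inequality, and the reciprocally convex combination -/

section
variable {n q N : ℕ} {p : Fin N → ℕ}

/-- The vector `col{x(t), x(t-η_m), x(t-τ(t)), x(t-τ_M), (e_j)_{j ≠ i}, ω}`. -/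
def xiVec (i : Fin N) (x x₁ x₂ x₃ : Fin n → ℝ) (e : ∀ j : Fin N, Fin (p j) → ℝ)
    (w : Fin q → ℝ) : XiIdx n q p i → ℝ :=
  Sum.elim x (Sum.elim x₁ (Sum.elim x₂ (Sum.elim x₃ (Sum.elim (fun jb => e jb.1 jb.2) w))))

theorem F1_mulVec (i : Fin N) (x x₁ x₂ x₃ : Fin n → ℝ) (e : ∀ j : Fin N, Fin (p j) → ℝ)
    (w : Fin q → ℝ) : F1 n q p i *ᵥ xiVec i x x₁ x₂ x₃ e w = x := by
  simp [F1, xiVec, fromCols_mulVec]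

theorem F2_mulVec (i : Fin N) (x x₁ x₂ x₃ : Fin n → ℝ) (e : ∀ j : Fin N, Fin (p j) → ℝ)
    (w : Fin q → ℝ) : F2 n q p i *ᵥ xiVec i x x₁ x₂ x₃ e w = x - x₁ := by
  simp [F2, xiVec, fromCols_mulVec, neg_mulVec, sub_eq_add_neg]

theorem F_mulVec (i : Fin N) (x x₁ x₂ x₃ : Fin n → ℝ) (e : ∀ j : Fin N, Fin (p j) → ℝ)
    (w : Fin q → ℝ) :
    F n q p i *ᵥ xiVec i x x₁ x₂ x₃ e w = Sum.elim (x₁ - x₂) (x₂ - x₃) := by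
  rw [F, fromRows_mulVec]
  simp [xiVec, fromCols_mulVec, neg_mulVec, sub_eq_add_neg]

theorem sum_subtype_ne_eq_erase (i : Fin N) (f : Fin N → ℝ) :
    ∑ j : {j : Fin N // j ≠ i}, f j = ∑ j ∈ Finset.univ.erase i, f j := by
  rw [← Finset.sum_subtype (Finset.univ.erase i) (by simp)]

theorem Xi_mulVec (sys : HybridSystem n q N p) (i : Fin N) (x x₁ x₂ x₃ : Fin n → ℝ)
    (e : ∀ j : Fin N, Fin (p j) → ℝ) (w : Fin q → ℝ) :
    Xi sys i *ᵥ xiVec i x x₁ x₂ x₃ e w = sys.A *ᵥ x + sys.A₁ *ᵥ x₂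
      + (∑ j ∈ Finset.univ.erase i, sys.B j *ᵥ e j) + sys.D *ᵥ w := by
  have : (Matrix.of fun a (jb : ErrIdx p i) => sys.B jb.1 a jb.2) *ᵥ (fun jb => e jb.1 jb.2)
      = ∑ j ∈ Finset.univ.erase i, sys.B j *ᵥ e j := by
    ext a
    rw [Finset.sum_apply, ← sum_subtype_ne_eq_erase i (fun j => (sys.B j *ᵥ e j) a)]
    simp only [mulVec, dotProduct, Matrix.of_apply, Fintype.sum_sigma]
  simp [Xi, xiVec, fromCols_mulVec, this, add_assoc]

theorem diag2_dotProduct {l m : Type} [Fintype l] [Fintype m] (X : Matrix l l ℝ)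
    (Y : Matrix m m ℝ) (u : l → ℝ) (v : m → ℝ) :
    Sum.elim u v ⬝ᵥ (diag2 X Y *ᵥ Sum.elim u v) = u ⬝ᵥ (X *ᵥ u) + v ⬝ᵥ (Y *ᵥ v) := by
  simp [diag2, fromBlocks_mulVec]

theorem Upsilon_dotProduct (d : Decision n p) (ηm τM α : ℝ) (i : Fin N) (x x₁ x₂ x₃ : Fin n → ℝ)
    (e : ∀ j : Fin N, Fin (p j) → ℝ) (w : Fin q → ℝ) :
    xiVec i x x₁ x₂ x₃ e w ⬝ᵥ (Upsilon d q ηm τM α i *ᵥ xiVec i x x₁ x₂ x₃ e w) =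
      quad d.S₀ x + 2 * α * quad d.P x
        - Real.exp (-2 * α * ηm) * (quad d.S₀ x₁ - quad d.S₁ x₁)
        - Real.exp (-2 * α * τM) * quad d.S₁ x₃
        + (∑ j ∈ Finset.univ.erase i, quad (psi d ηm τM α j) (e j)) - d.b * (w ⬝ᵥ w) := by
  have h : (fun jb : ErrIdx p i => e jb.1 jb.2) ⬝ᵥ
      ((blockDiagonal' fun j : {j : Fin N // j ≠ i} => psi d ηm τM α j) *ᵥ
        fun jb : ErrIdx p i => e jb.1 jb.2)
      = ∑ j ∈ Finset.univ.erase i, quad (psi d ηm τM α j) (e j) := by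
    rw [← sum_subtype_ne_eq_erase i (fun j => quad (psi d ηm τM α j) (e j))]
    simp only [quad, dotProduct, Fintype.sum_sigma, mulVec]
    refine Finset.sum_congr rfl fun j _ => Finset.sum_congr rfl fun a _ => ?_
    congr 1
    rw [Finset.sum_eq_single j]
    · simp [blockDiagonal'_apply_eq]
    · intro j' _ hj'
      refine Finset.sum_eq_zero fun b _ => ?_
      rw [blockDiagonal'_apply_ne _ _ _ hj'.symm, zero_mul]
    · simp
  simp only [Upsilon, xiVec, diag2_dotProduct, h]
  simp only [quad, add_mulVec, sub_mulVec, neg_mulVec, smul_mulVec, dotProduct_add, dotProduct_sub,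
    dotProduct_neg, dotProduct_smul, smul_eq_mul, zero_mulVec, dotProduct_zero, one_mulVec]
  ring

theorem dotProduct_transpose_mul_mul {ι κ κ' : Type*} [Fintype ι] [Fintype κ] [Fintype κ']
    (X : Matrix κ ι ℝ) (M : Matrix κ κ' ℝ) (Y : Matrix κ' ι ℝ) (v : ι → ℝ) :
    v ⬝ᵥ ((Xᵀ * M * Y) *ᵥ v) = (X *ᵥ v) ⬝ᵥ (M *ᵥ (Y *ᵥ v)) := by
  rw [← mulVec_mulVec, ← mulVec_mulVec, dotProduct_mulVec, vecMul_transpose]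

theorem dotProduct_HMat (sys : HybridSystem n q N p) (d : Decision n p) (ηm τM α : ℝ)
    (y : Fin n → ℝ) : y ⬝ᵥ (HMat sys d ηm τM α *ᵥ y) =
      ηm ^ 2 * quad d.R₀ y + (τM - ηm) ^ 2 * quad d.R₁ y
        + (τM - ηm) * ∑ l, quad (d.G ηm τM α l) (sys.C l *ᵥ y) := by
  have h : y ⬝ᵥ ((∑ l, (sys.C l)ᵀ * d.G ηm τM α l * sys.C l) *ᵥ y)
      = ∑ l, quad (d.G ηm τM α l) (sys.C l *ᵥ y) := by
    rw [sum_mulVec, dotProduct_sum]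
    exact Finset.sum_congr rfl fun l _ => dotProduct_transpose_mul_mul _ _ _ _
  simp only [HMat, add_mulVec, smul_mulVec, dotProduct_add, dotProduct_smul, smul_eq_mul, h]
  rfl

theorem PhiMat_dotProduct (d : Decision n p) (y₁ y₂ : Fin n → ℝ) :
    Sum.elim y₁ y₂ ⬝ᵥ (PhiMat d *ᵥ Sum.elim y₁ y₂) =
      quad d.R₁ y₁ + 2 * (y₁ ⬝ᵥ (d.S₁₂ *ᵥ y₂)) + quad d.R₁ y₂ := by
  have h : y₂ ⬝ᵥ (d.S₁₂ᵀ *ᵥ y₁) = y₁ ⬝ᵥ (d.S₁₂ *ᵥ y₂) := by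
    rw [mulVec_transpose, dotProduct_comm, ← dotProduct_mulVec]
  simp only [PhiMat, fromBlocks_mulVec, sumElim_dotProduct_sumElim, dotProduct_add, h, quad,
    Sum.elim_comp_inl, Sum.elim_comp_inr]
  ring

/-- The scalar inequality contained in the `i`-th LMI, obtained by testing it on `(ξ, Ξ_i ξ)`. -/
theorem lmi_scalar {sys : HybridSystem n q N p} {d : Decision n p} {ηm τM α : ℝ}
    (hd : SatisfiesLMIs sys d ηm τM α) (i : Fin N) (x x₁ x₂ x₃ : Fin n → ℝ)
    (e : ∀ j : Fin N, Fin (p j) → ℝ) (w : Fin q → ℝ) {y : Fin n → ℝ}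
    (hy : y = sys.A *ᵥ x + sys.A₁ *ᵥ x₂
      + (∑ j ∈ Finset.univ.erase i, sys.B j *ᵥ e j) + sys.D *ᵥ w) :
    2 * (x ⬝ᵥ (d.P *ᵥ y)) + (quad d.S₀ x + 2 * α * quad d.P x
        - Real.exp (-2 * α * ηm) * (quad d.S₀ x₁ - quad d.S₁ x₁)
        - Real.exp (-2 * α * τM) * quad d.S₁ x₃
        + (∑ j ∈ Finset.univ.erase i, quad (psi d ηm τM α j) (e j)) - d.b * (w ⬝ᵥ w))
      - Real.exp (-2 * α * ηm) * quad d.R₀ (x - x₁)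
      - Real.exp (-2 * α * τM) * (quad d.R₁ (x₁ - x₂)
          + 2 * ((x₁ - x₂) ⬝ᵥ (d.S₁₂ *ᵥ (x₂ - x₃))) + quad d.R₁ (x₂ - x₃))
      + (ηm ^ 2 * quad d.R₀ y + (τM - ηm) ^ 2 * quad d.R₁ y
        + (τM - ηm) * ∑ l, quad (d.G ηm τM α l) (sys.C l *ᵥ y)) ≤ 0 := by
  set ξ := xiVec (p := p) i x x₁ x₂ x₃ e w with hξ
  have hΞ : Xi sys i *ᵥ ξ = y := by rw [hξ, Xi_mulVec, hy]
  have hP := transpose_of_posDef hd.P_pos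
  -- No Schur complement is needed: at `y = Ξ ξ` the off-diagonal blocks contribute `2 yᵀHy` and the
  -- corner `-yᵀHy`, which leaves `+yᵀHy`.
  have key := (hd.lmi_neg i).posSemidef.dotProduct_mulVec_nonneg (Sum.elim ξ y)
  have h1 : ξ ⬝ᵥ (((Xi sys i)ᵀ * HMat sys d ηm τM α) *ᵥ y) = y ⬝ᵥ (HMat sys d ηm τM α *ᵥ y) := by
    rw [← mulVec_mulVec, dotProduct_mulVec, vecMul_transpose, hΞ]
  have h2 : y ⬝ᵥ (((Xi sys i)ᵀ * HMat sys d ηm τM α)ᵀ *ᵥ ξ) = y ⬝ᵥ (HMat sys d ηm τM α *ᵥ y) := by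
    rw [mulVec_transpose, dotProduct_comm, ← dotProduct_mulVec, h1]
  have h3 : ξ ⬝ᵥ (SigmaMat sys d ηm τM α i *ᵥ ξ) = 2 * (x ⬝ᵥ (d.P *ᵥ y))
      + ξ ⬝ᵥ (Upsilon d q ηm τM α i *ᵥ ξ) - Real.exp (-2 * α * ηm) * quad d.R₀ (x - x₁) := by
    simp only [SigmaMat, add_mulVec, sub_mulVec, smul_mulVec, dotProduct_add, dotProduct_sub,
      dotProduct_smul, dotProduct_transpose_mul_mul, hΞ, smul_eq_mul]
    rw [hξ, F1_mulVec, F2_mulVec, dotProduct_mulVec_symm hP y x, quad]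
    ring
  have h4 : ξ ⬝ᵥ (((F n q p i)ᵀ * PhiMat d * F n q p i) *ᵥ ξ) = quad d.R₁ (x₁ - x₂)
      + 2 * ((x₁ - x₂) ⬝ᵥ (d.S₁₂ *ᵥ (x₂ - x₃))) + quad d.R₁ (x₂ - x₃) := by
    rw [dotProduct_transpose_mul_mul, hξ, F_mulVec, PhiMat_dotProduct]
  rw [star_trivial, neg_mulVec, dotProduct_neg] at key
  simp only [LMIMat, fromBlocks_mulVec, sumElim_dotProduct_sumElim, dotProduct_add,
    Sum.elim_comp_inl, Sum.elim_comp_inr, h1, h2, neg_mulVec, dotProduct_neg] at key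
  rw [sub_mulVec, dotProduct_sub, smul_mulVec, dotProduct_smul, smul_eq_mul, h3, h4, hξ,
    Upsilon_dotProduct, dotProduct_HMat] at key
  linarith

/-- Testing `Φ ≥ 0` on `(r y₁, y₂)` gives a quadratic polynomial in `r` that is never negative, so
its discriminant is at most zero. -/
theorem cross_sq_le {d : Decision n p} (hΦ : (PhiMat d).PosSemidef) (y₁ y₂ : Fin n → ℝ) :
    (y₁ ⬝ᵥ (d.S₁₂ *ᵥ y₂)) ^ 2 ≤ quad d.R₁ y₁ * quad d.R₁ y₂ := by
  have h : ∀ r : ℝ, 0 ≤ quad d.R₁ y₁ * (r * r) + 2 * (y₁ ⬝ᵥ (d.S₁₂ *ᵥ y₂)) * r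
      + quad d.R₁ y₂ := by
    intro r
    have := hΦ.dotProduct_mulVec_nonneg (Sum.elim (r • y₁) y₂)
    rw [star_trivial, PhiMat_dotProduct, quad_smul_right, smul_dotProduct, smul_eq_mul] at this
    linarith
  have := discrim_le_zero h
  rw [discrim] at this
  linarith

/-- Reciprocally convex combination: with `I₁`, `I₂` the Jensen integrals over adjacent intervals
of lengths `a`, `c`. -/
theorem reciprocally_convex {d : Decision n p} (hΦ : (PhiMat d).PosSemidef) {y₁ y₂ : Fin n → ℝ}
    {a c I₁ I₂ : ℝ} (ha : 0 ≤ a) (hc : 0 ≤ c) (hI₁ : 0 ≤ I₁) (hI₂ : 0 ≤ I₂)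
    (hR : ∀ v, 0 ≤ quad d.R₁ v) (h₁ : quad d.R₁ y₁ ≤ a * I₁) (h₂ : quad d.R₁ y₂ ≤ c * I₂) :
    quad d.R₁ y₁ + 2 * (y₁ ⬝ᵥ (d.S₁₂ *ᵥ y₂)) + quad d.R₁ y₂ ≤ (a + c) * (I₁ + I₂) := by
  have h := cross_sq_le hΦ y₁ y₂
  -- Regrouping the product as `(c I₁)(a I₂)` makes the arithmetic-geometric mean inequality produce
  -- exactly the mixed terms of `(a + c)(I₁ + I₂)`. Nothing is divided by `a` or `c`, so either
  -- interval may be degenerate.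
  have h' : (y₁ ⬝ᵥ (d.S₁₂ *ᵥ y₂)) ^ 2 ≤ (c * I₁) * (a * I₂) := by
    calc _ ≤ _ := h
      _ ≤ (a * I₁) * (c * I₂) := mul_le_mul h₁ h₂ (hR _) (by positivity)
      _ = _ := by ring
  have h'' : 2 * (y₁ ⬝ᵥ (d.S₁₂ *ᵥ y₂)) ≤ c * I₁ + a * I₂ := by
    apply le_of_sq_le_sq _ (by positivity)
    nlinarith [sq_nonneg (c * I₁ - a * I₂)]
  linarith

end

/-! ### Coercivity and openness of positive definiteness -/

section Forms
variable {ι : Type*} [Fintype ι]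

theorem abs_dotProduct_mulVec_le (M : Matrix ι ι ℝ) (v : ι → ℝ) :
    |v ⬝ᵥ (M *ᵥ v)| ≤ (∑ i, ∑ j, |M i j|) * ‖v‖ ^ 2 := by
  simp only [dotProduct, mulVec, Finset.mul_sum, Finset.sum_mul]
  refine (Finset.abs_sum_le_sum_abs _ _).trans (Finset.sum_le_sum fun i _ => ?_)
  refine (Finset.abs_sum_le_sum_abs _ _).trans (Finset.sum_le_sum fun j _ => ?_)
  have hi : |v i| ≤ ‖v‖ := norm_le_pi_norm v i
  have hj : |v j| ≤ ‖v‖ := norm_le_pi_norm v j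
  rw [abs_mul, abs_mul]
  calc |v i| * (|M i j| * |v j|) = |M i j| * (|v i| * |v j|) := by ring
    _ ≤ |M i j| * (‖v‖ * ‖v‖) := by gcongr
    _ = _ := by ring

/-- The constant is the minimum of the form on the compact unit sphere of the sup norm; homogeneity
extends the bound to all vectors. -/
theorem exists_pos_le_dotProduct_mulVec {M : Matrix ι ι ℝ} (hM : M.PosDef) :
    ∃ c > 0, ∀ v, c * ‖v‖ ^ 2 ≤ v ⬝ᵥ (M *ᵥ v) := by
  rcases isEmpty_or_nonempty ι with h | h
  · exact ⟨1, one_pos, fun v => by simp [Subsingleton.elim v 0]⟩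
  have hcont : Continuous fun v : ι → ℝ => v ⬝ᵥ (M *ᵥ v) := by fun_prop
  have hne : (Metric.sphere (0 : ι → ℝ) 1).Nonempty :=
    NormedSpace.sphere_nonempty.2 zero_le_one
  obtain ⟨u, hu, hmin⟩ := (isCompact_sphere (0 : ι → ℝ) 1).exists_isMinOn hne hcont.continuousOn
  have hu1 : ‖u‖ = 1 := by simpa using hu
  have hu0 : u ≠ 0 := by rintro rfl; simp at hu1
  refine ⟨u ⬝ᵥ (M *ᵥ u), by simpa using hM.dotProduct_mulVec_pos hu0, fun v => ?_⟩
  rcases eq_or_ne v 0 with rfl | hv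
  · simp
  have hv' : ‖v‖ ≠ 0 := norm_ne_zero_iff.2 hv
  have := hmin (show ‖v‖⁻¹ • v ∈ Metric.sphere (0 : ι → ℝ) 1 by
    simp [norm_smul, inv_mul_cancel₀ hv'])
  simp only [mem_ofPred_eq, mulVec_smul, dotProduct_smul, smul_dotProduct, smul_eq_mul] at this
  calc _ ≤ ‖v‖⁻¹ * (‖v‖⁻¹ * v ⬝ᵥ M *ᵥ v) * ‖v‖ ^ 2 := by gcongr
    _ = _ := by field_simp

/-- Positive definiteness is an open condition along continuous families of symmetric matrices. -/
theorem eventually_posDef {M : ℝ → Matrix ι ι ℝ} (hM : Continuous M)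
    (hherm : ∀ t, (M t).IsHermitian) {t₀ : ℝ} (h₀ : (M t₀).PosDef) :
    ∀ᶠ t in nhds t₀, (M t).PosDef := by
  obtain ⟨c, hc, hcoer⟩ := exists_pos_le_dotProduct_mulVec h₀
  have hcont : Continuous fun t => ∑ i, ∑ j, |(M t - M t₀) i j| := by fun_prop
  have hlim : ∀ᶠ t in nhds t₀, ∑ i, ∑ j, |(M t - M t₀) i j| < c :=
    hcont.continuousAt.eventually_lt continuousAt_const (by simpa using hc)
  filter_upwards [hlim] with t ht
  refine PosDef.of_dotProduct_mulVec_pos (hherm t) fun v hv => ?_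
  have h1 := abs_dotProduct_mulVec_le (M t - M t₀) v
  have h2 := hcoer v
  have h3 : 0 < ‖v‖ ^ 2 := by positivity
  rw [sub_mulVec, dotProduct_sub] at h1
  have h4 := (abs_le.1 h1).1
  have h5 := mul_lt_mul_of_pos_right ht h3
  rw [star_trivial]
  linarith

end Forms

/-! ### Euclidean norm against sup norm and quadratic forms -/

section
variable {n : ℕ}

theorem eNorm_sq (v : Fin n → ℝ) : eNorm v ^ 2 = v ⬝ᵥ v := by
  rw [eNorm, EuclideanSpace.norm_sq_eq]
  simp [dotProduct, sq]

theorem eNorm_nonneg (v : Fin n → ℝ) : 0 ≤ eNorm v := norm_nonneg _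

theorem norm_sq_le_eNorm_sq (v : Fin n → ℝ) : ‖v‖ ^ 2 ≤ eNorm v ^ 2 := by
  have : ‖v‖ ≤ eNorm v := by
    refine (pi_norm_le_iff_of_nonneg (eNorm_nonneg v)).2 fun i => ?_
    exact PiLp.norm_apply_le (WithLp.toLp 2 v) i
  gcongr

theorem eNorm_sq_le_norm_sq (v : Fin n → ℝ) : eNorm v ^ 2 ≤ n * ‖v‖ ^ 2 := by
  rw [eNorm_sq, dotProduct]
  calc ∑ i, v i * v i ≤ ∑ _i : Fin n, ‖v‖ ^ 2 := by
        refine Finset.sum_le_sum fun i _ => ?_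
        rw [← sq, ← sq_abs]
        gcongr
        exact norm_le_pi_norm v i
    _ = _ := by simp

theorem continuous_eNorm : Continuous (eNorm : (Fin n → ℝ) → ℝ) :=
  (PiLp.continuous_toLp 2 _).norm

theorem continuous_quad (M : Matrix (Fin n) (Fin n) ℝ) : Continuous (quad M) := by
  unfold quad
  fun_prop

theorem exists_quad_le (M : Matrix (Fin n) (Fin n) ℝ) :
    ∃ c > 0, ∀ v, |quad M v| ≤ c * eNorm v ^ 2 := by
  refine ⟨(∑ i, ∑ j, |M i j|) + 1, by positivity, fun v => (abs_dotProduct_mulVec_le M v).trans ?_⟩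
  have h := norm_sq_le_eNorm_sq v
  gcongr
  linarith

theorem exists_le_quad {M : Matrix (Fin n) (Fin n) ℝ} (hM : M.PosDef) :
    ∃ c > 0, ∀ v, c * eNorm v ^ 2 ≤ quad M v := by
  obtain ⟨c, hc, h⟩ := exists_pos_le_dotProduct_mulVec hM
  refine ⟨c / (n + 1), by positivity, fun v => le_trans ?_ (h v)⟩
  have h1 := eNorm_sq_le_norm_sq v
  have h2 : eNorm v ^ 2 ≤ (n + 1) * ‖v‖ ^ 2 := by nlinarith [sq_nonneg ‖v‖]
  calc c / (n + 1) * eNorm v ^ 2 ≤ c / (n + 1) * ((n + 1) * ‖v‖ ^ 2) := by gcongr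
    _ = _ := by field_simp

end

/-! ### Continuity of the LMIs in the decay rate -/

section
variable {n q N : ℕ} {p : Fin N → ℕ}

theorem diag2_transpose {l m : Type} (X : Matrix l l ℝ) (Y : Matrix m m ℝ) :
    (diag2 X Y)ᵀ = diag2 Xᵀ Yᵀ := by
  simp [diag2, fromBlocks_transpose]

theorem continuous_diag2 {l m : Type} {X : ℝ → Matrix l l ℝ} {Y : ℝ → Matrix m m ℝ}
    (hX : Continuous X) (hY : Continuous Y) : Continuous fun t => diag2 (X t) (Y t) :=
  hX.matrix_fromBlocks continuous_const continuous_const hY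

/-- `PosDef` includes symmetry, so at values of `α` near `0` symmetry has to be known independently
before the openness argument applies. -/
theorem LMIMat_isHermitian {sys : HybridSystem n q N p} {d : Decision n p} {ηm τM : ℝ}
    (hP : d.Pᵀ = d.P) (hS₀ : d.S₀ᵀ = d.S₀) (hS₁ : d.S₁ᵀ = d.S₁) (hR₀ : d.R₀ᵀ = d.R₀)
    (hR₁ : d.R₁ᵀ = d.R₁) (hQ : ∀ i, (d.Q i)ᵀ = d.Q i) (α : ℝ) (i : Fin N) :
    (LMIMat sys d ηm τM α i).IsHermitian := by
  have hH : (HMat sys d ηm τM α)ᵀ = HMat sys d ηm τM α := by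
    simp [HMat, Decision.G, transpose_sum, hR₀, hR₁, hQ, Matrix.mul_assoc]
  have hΥ : (Upsilon d q ηm τM α i)ᵀ = Upsilon d q ηm τM α i := by
    simp [Upsilon, diag2_transpose, hS₀, hS₁, hP, blockDiagonal'_transpose, psi, Decision.U, hQ]
  have hΦ : (PhiMat d)ᵀ = PhiMat d := by
    simp [PhiMat, fromBlocks_transpose, hR₁]
  have hS : (SigmaMat sys d ηm τM α i)ᵀ = SigmaMat sys d ηm τM α i := by
    simp only [SigmaMat, transpose_sub, transpose_add, transpose_mul, transpose_smul,
      transpose_transpose, hP, hR₀, hΥ, Matrix.mul_assoc]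
    rw [add_comm ((Xi sys i)ᵀ * _)]
  rw [Matrix.IsHermitian, conjTranspose_eq_transpose_of_trivial, LMIMat, fromBlocks_transpose]
  simp [hS, hΦ, hH, Matrix.mul_assoc]

theorem continuous_LMIMat (sys : HybridSystem n q N p) (d : Decision n p) (ηm τM : ℝ)
    (i : Fin N) : Continuous fun α => LMIMat sys d ηm τM α i := by
  have hH : Continuous fun α => HMat sys d ηm τM α := by
    unfold HMat Decision.G
    fun_prop
  have hΥ : Continuous fun α => Upsilon d q ηm τM α i := by
    unfold Upsilon psi
    refine continuous_diag2 (by fun_prop) (continuous_diag2 (by fun_prop)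
      (continuous_diag2 (by fun_prop) (continuous_diag2 (by fun_prop)
        (continuous_diag2 ?_ (by fun_prop)))))
    refine Continuous.matrix_blockDiagonal' ?_
    fun_prop
  have hS : Continuous fun α => SigmaMat sys d ηm τM α i := by
    unfold SigmaMat
    fun_prop
  unfold LMIMat
  refine Continuous.matrix_fromBlocks ?_ ?_ ?_ ?_ <;> fun_prop

/-- Feasibility of the LMIs at `α = 0` persists for all small `α`. -/
theorem SatisfiesLMIs.exists_pos {sys : HybridSystem n q N p} {d : Decision n p} {ηm τM : ℝ}
    (hd : SatisfiesLMIs sys d ηm τM 0) :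
    ∃ αbar : ℝ, 0 < αbar ∧ ∀ α, 0 < α → α ≤ αbar → SatisfiesLMIs sys d ηm τM α := by
  have h : ∀ᶠ α in nhds (0 : ℝ), ∀ i, (-LMIMat sys d ηm τM α i).PosDef := by
    refine eventually_all.2 fun i => eventually_posDef (continuous_LMIMat sys d ηm τM i).neg
      (fun α => (LMIMat_isHermitian (transpose_of_posDef hd.P_pos) (transpose_of_posDef hd.S₀_pos)
        (transpose_of_posDef hd.S₁_pos) (transpose_of_posDef hd.R₀_pos)
        (transpose_of_posDef hd.R₁_pos) (fun j => transpose_of_posDef (hd.Q_pos j)) α i).neg)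
      (hd.lmi_neg i)
  obtain ⟨ε, hε, hball⟩ := Metric.eventually_nhds_iff.1 h
  refine ⟨ε / 2, by positivity, fun α hα hα' => ⟨hd.b_pos, hd.P_pos, hd.S₀_pos, hd.R₀_pos,
    hd.S₁_pos, hd.R₁_pos, hd.Q_pos, hd.phi_nonneg, hball ?_⟩⟩
  rw [Real.dist_eq, sub_zero, abs_of_pos hα]
  linarith

end

/-! ### Absolutely continuous functions and their almost everywhere derivatives -/

section Calculus

/-- `f` is absolutely continuous on `[a, b]` with almost everywhere derivative `f'`. -/
structure ACDeriv (f f' : ℝ → ℝ) (a b : ℝ) : Prop where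
  ac : AbsolutelyContinuousOnInterval f a b
  hasDerivAt : ∀ᵐ t : ℝ, t ∈ Icc a b → HasDerivAt f (f' t) t

variable {f g f' g' : ℝ → ℝ} {a b : ℝ}

theorem ACDeriv.add (hf : ACDeriv f f' a b) (hg : ACDeriv g g' a b) :
    ACDeriv (fun t => f t + g t) (fun t => f' t + g' t) a b :=
  ⟨hf.ac.add hg.ac, by
    filter_upwards [hf.hasDerivAt, hg.hasDerivAt] with t h1 h2 ht
    exact (h1 ht).add (h2 ht)⟩

theorem ACDeriv.sub (hf : ACDeriv f f' a b) (hg : ACDeriv g g' a b) :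
    ACDeriv (fun t => f t - g t) (fun t => f' t - g' t) a b :=
  ⟨hf.ac.sub hg.ac, by
    filter_upwards [hf.hasDerivAt, hg.hasDerivAt] with t h1 h2 ht
    exact (h1 ht).sub (h2 ht)⟩

theorem ACDeriv.mul (hf : ACDeriv f f' a b) (hg : ACDeriv g g' a b) :
    ACDeriv (fun t => f t * g t) (fun t => f' t * g t + f t * g' t) a b :=
  ⟨hf.ac.mul hg.ac, by
    filter_upwards [hf.hasDerivAt, hg.hasDerivAt] with t h1 h2 ht
    exact (h1 ht).mul (h2 ht)⟩

theorem ACDeriv.const_mul (c : ℝ) (hf : ACDeriv f f' a b) :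
    ACDeriv (fun t => c * f t) (fun t => c * f' t) a b :=
  ⟨hf.ac.const_mul c, by
    filter_upwards [hf.hasDerivAt] with t h1 ht
    exact (h1 ht).const_mul c⟩

theorem ACDeriv.of_contDiff (hf : ContDiff ℝ 1 f) (hf' : ∀ t, HasDerivAt f (f' t) t) :
    ACDeriv f f' a b :=
  ⟨hf.contDiffOn.absolutelyContinuousOnInterval, by
    filter_upwards with t _ using hf' t⟩

theorem ACDeriv.const (c : ℝ) : ACDeriv (fun _ => c) (fun _ => 0) a b :=
  ACDeriv.of_contDiff contDiff_const fun t => hasDerivAt_const t c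

theorem ACDeriv.exp (c : ℝ) : ACDeriv (fun t => Real.exp (c * t))
    (fun t => c * Real.exp (c * t)) a b :=
  ACDeriv.of_contDiff (by fun_prop) fun t => by
    have := ((hasDerivAt_id t).const_mul c).exp
    simp only [id, mul_one] at this
    rwa [mul_comm c]

theorem ACDeriv.sum {ι : Type*} (s : Finset ι) {f f' : ι → ℝ → ℝ}
    (hf : ∀ i ∈ s, ACDeriv (f i) (f' i) a b) :
    ACDeriv (fun t => ∑ i ∈ s, f i t) (fun t => ∑ i ∈ s, f' i t) a b := by
  classical
  induction s using Finset.induction_on with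
  | empty => simpa using ACDeriv.const 0
  | insert i s hi ih =>
    simp only [Finset.sum_insert hi]
    exact (hf i (Finset.mem_insert_self i s)).add
      (ih fun j hj => hf j (Finset.mem_insert_of_mem hj))

/-- Differentiates every delayed term of the functional: a translation turns the upper limit `t - c`
into `t`, and the rest is Lebesgue differentiation. -/
theorem ACDeriv.integral {L T c : ℝ} (hg : IntervalIntegrable g volume L T)
    (hL : L ≤ a - c) (hab : a ≤ b) (hT : b - c ≤ T) :
    ACDeriv (fun t => ∫ s in L..(t - c), g s) (fun t => g (t - c)) a b := by
  have h1 : IntervalIntegrable (fun s => g (s - c)) volume (L + c) (T + c) := hg.comp_sub_right c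
  have h2 : (fun t => ∫ s in L..(t - c), g s) = fun t => ∫ s in (L + c)..t, g (s - c) := by
    ext t
    rw [intervalIntegral.integral_comp_sub_right, add_sub_cancel_right]
  rw [h2]
  have hmem : L + c ∈ uIcc (L + c) (T + c) := left_mem_uIcc
  have hsub : Icc a b ⊆ uIcc (L + c) (T + c) := by
    rw [uIcc_of_le (by linarith)]
    exact Icc_subset_Icc (by linarith) (by linarith)
  refine ⟨(h1.absolutelyContinuousOnInterval_intervalIntegral hmem).mono
    (by rwa [uIcc_of_le hab]), ?_⟩
  filter_upwards [h1.ae_hasDerivAt_integral] with t ht htab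
  exact ht (hsub htab) _ hmem

/-- A sign of the derivative almost everywhere is enough because an absolutely continuous function
is the integral of its derivative. -/
theorem ACDeriv.le_of_nonpos (hf : ACDeriv f f' a b) (hab : a ≤ b)
    (h : ∀ᵐ t : ℝ, t ∈ Icc a b → f' t ≤ 0) : f b ≤ f a := by
  have h1 := hf.ac.integral_deriv_eq_sub
  have h2 : ∫ t in a..b, deriv f t ≤ 0 := by
    rw [intervalIntegral.integral_of_le hab]
    refine integral_nonpos_of_ae ?_
    rw [EventuallyLE, ae_restrict_iff' measurableSet_Ioc]
    filter_upwards [hf.hasDerivAt, h] with t h3 h4 ht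
    rw [(h3 (Ioc_subset_Icc_self ht)).deriv]
    exact h4 (Ioc_subset_Icc_self ht)
  linarith

theorem AbsolutelyContinuousOnInterval.congr {X : Type*} [PseudoMetricSpace X] {f g : ℝ → X}
    (hf : AbsolutelyContinuousOnInterval f a b) (h : EqOn f g (uIcc a b)) :
    AbsolutelyContinuousOnInterval g a b := by
  rw [absolutelyContinuousOnInterval_iff] at hf ⊢
  intro ε hε
  obtain ⟨δ, hδ, H⟩ := hf ε hε
  refine ⟨δ, hδ, fun E hE hlt => ?_⟩
  have := H E hE hlt
  rwa [Finset.sum_congr rfl fun i hi => ?_]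
  rw [h (hE.1 i hi).1, h (hE.1 i hi).2]

/-- On `[a, c]` the function equals `f a` plus the integral of `deriv f`, which is integrable on
both pieces; such an indefinite integral is absolutely continuous. -/
theorem AbsolutelyContinuousOnInterval.trans {c : ℝ} (hab : a ≤ b) (hbc : b ≤ c)
    (h₁ : AbsolutelyContinuousOnInterval f a b) (h₂ : AbsolutelyContinuousOnInterval f b c) :
    AbsolutelyContinuousOnInterval f a c := by
  have hint := h₁.intervalIntegrable_deriv.trans h₂.intervalIntegrable_deriv
  have hF := hint.absolutelyContinuousOnInterval_intervalIntegral (c := a) left_mem_uIcc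
  have hc : AbsolutelyContinuousOnInterval (fun _ : ℝ => f a) a c :=
    (ACDeriv.const (f a)).ac
  refine AbsolutelyContinuousOnInterval.congr (hc.add hF) fun t ht => ?_
  rw [uIcc_of_le (hab.trans hbc)] at ht
  simp only [Pi.add_apply]
  rcases le_total t b with h | h
  · have : uIcc a t ⊆ uIcc a b := by
      rw [uIcc_of_le ht.1, uIcc_of_le hab]; exact Icc_subset_Icc_right h
    rw [(h₁.mono this).integral_deriv_eq_sub]; ring
  · have : uIcc b t ⊆ uIcc b c := by
      rw [uIcc_of_le h, uIcc_of_le hbc]; exact Icc_subset_Icc_right ht.2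
    rw [← intervalIntegral.integral_add_adjacent_intervals h₁.intervalIntegrable_deriv
      (h₂.mono this).intervalIntegrable_deriv, h₁.integral_deriv_eq_sub,
      (h₂.mono this).integral_deriv_eq_sub]
    ring

theorem AbsolutelyContinuousOnInterval.apply {ι : Type*} [Fintype ι] {x : ℝ → ι → ℝ}
    (hx : AbsolutelyContinuousOnInterval x a b) (i : ι) :
    AbsolutelyContinuousOnInterval (fun t => x t i) a b := by
  rw [absolutelyContinuousOnInterval_iff] at hx ⊢
  intro ε hε
  obtain ⟨δ, hδ, H⟩ := hx ε hε
  refine ⟨δ, hδ, fun E hE hlt => lt_of_le_of_lt (Finset.sum_le_sum fun j _ => ?_) (H E hE hlt)⟩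
  exact dist_le_pi_dist _ _ i

theorem AbsolutelyContinuousOnInterval.ae_hasDerivAt_pi {ι : Type*} [Fintype ι] {x : ℝ → ι → ℝ}
    (hab : a ≤ b)
    (hx : ∀ i, AbsolutelyContinuousOnInterval (fun t => x t i) a b) :
    ∀ᵐ t : ℝ, t ∈ Icc a b → HasDerivAt x (deriv x t) t := by
  have h : ∀ᵐ t : ℝ, ∀ i, t ∈ uIcc a b → DifferentiableAt ℝ (fun t => x t i) t :=
    ae_all_iff.2 fun i => (hx i).ae_differentiableAt
  filter_upwards [h] with t ht htab
  rw [← uIcc_of_le hab] at htab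
  exact (differentiableAt_pi.2 fun i => ht i htab).hasDerivAt

end Calculus

/-! ### Regular trajectories and Jensen's inequality -/

/-- The regularity of the trajectories used below. -/
structure IsRegularOn {n : ℕ} (x : ℝ → Fin n → ℝ) (L T : ℝ) : Prop where
  ac : ∀ i, AbsolutelyContinuousOnInterval (fun t => x t i) L T
  hasDerivAt : ∀ᵐ t : ℝ, t ∈ Icc L T → HasDerivAt x (deriv x t) t
  sq_integrable : IntegrableOn (fun t => eNorm (deriv x t) ^ 2) (Icc L T)

namespace IsRegularOn
variable {n : ℕ} {x : ℝ → Fin n → ℝ} {L T a b : ℝ}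

theorem mono (hx : IsRegularOn x L T) (hL : L ≤ a) (hab : a ≤ b) (hT : b ≤ T) :
    IsRegularOn x a b where
  ac i := (hx.ac i).mono (by
    rw [uIcc_of_le hab, uIcc_of_le (hL.trans (hab.trans hT))]; exact Icc_subset_Icc hL hT)
  hasDerivAt := by
    filter_upwards [hx.hasDerivAt] with t ht h using ht (Icc_subset_Icc hL hT h)
  sq_integrable := hx.sq_integrable.mono_set (Icc_subset_Icc hL hT)

theorem trans {M : ℝ} (hLM : L ≤ M) (hMT : M ≤ T) (h₁ : IsRegularOn x L M)
    (h₂ : IsRegularOn x M T) : IsRegularOn x L T where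
  ac i := AbsolutelyContinuousOnInterval.trans hLM hMT (h₁.ac i) (h₂.ac i)
  hasDerivAt := by
    filter_upwards [h₁.hasDerivAt, h₂.hasDerivAt] with t ht₁ ht₂ h
    rcases le_total t M with h' | h'
    · exact ht₁ ⟨h.1, h'⟩
    · exact ht₂ ⟨h', h.2⟩
  sq_integrable := by
    rw [← Icc_union_Icc_eq_Icc hLM hMT]
    exact h₁.sq_integrable.union h₂.sq_integrable

theorem continuousOn (hx : IsRegularOn x L T) (hLT : L ≤ T) : ContinuousOn x (Icc L T) := by
  refine continuousOn_pi.2 fun i => ?_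
  rw [← uIcc_of_le hLT]
  exact (hx.ac i).continuousOn

theorem integrableOn_quad (hx : IsRegularOn x L T) (M : Matrix (Fin n) (Fin n) ℝ) :
    IntegrableOn (fun t => quad M (deriv x t)) (Icc L T) := by
  obtain ⟨c, -, hc⟩ := exists_quad_le M
  refine (hx.sq_integrable.const_mul c).mono'
    ((continuous_quad M).measurable.comp (measurable_deriv x)).aestronglyMeasurable ?_
  exact Eventually.of_forall fun t => hc _

theorem intervalIntegrable_quad (hx : IsRegularOn x L T) (M : Matrix (Fin n) (Fin n) ℝ)
    (hL : L ≤ a) (hab : a ≤ b) (hT : b ≤ T) :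
    IntervalIntegrable (fun t => quad M (deriv x t)) volume a b := by
  rw [intervalIntegrable_iff_integrableOn_Icc_of_le hab]
  exact (hx.integrableOn_quad M).mono_set (Icc_subset_Icc hL hT)

theorem intervalIntegrable_exp_quad (hx : IsRegularOn x L T) (M : Matrix (Fin n) (Fin n) ℝ)
    (hL : L ≤ a) (hab : a ≤ b) (hT : b ≤ T) (c : ℝ) :
    IntervalIntegrable (fun t => Real.exp (c * t) * quad M (deriv x t)) volume a b :=
  (hx.intervalIntegrable_quad M hL hab hT).continuousOn_mul (by fun_prop)

theorem deriv_apply_ae (hx : IsRegularOn x L T) (i : Fin n) :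
    ∀ᵐ t : ℝ, t ∈ Icc L T → deriv (fun s => x s i) t = deriv x t i := by
  filter_upwards [hx.hasDerivAt] with t ht h
  exact (hasDerivAt_pi.1 (ht h) i).deriv

theorem intervalIntegrable_apply (hx : IsRegularOn x L T) (hLT : L ≤ T) (i : Fin n) :
    IntervalIntegrable (fun t => deriv x t i) volume L T := by
  refine (hx.ac i).intervalIntegrable_deriv.congr_ae ?_
  rw [EventuallyEq, ae_restrict_iff' measurableSet_uIoc, uIoc_of_le hLT]
  filter_upwards [hx.deriv_apply_ae i] with t ht h using ht (Ioc_subset_Icc_self h)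

theorem integral_apply (hx : IsRegularOn x L T) (hLT : L ≤ T) (i : Fin n) :
    ∫ t in L..T, deriv x t i = x T i - x L i := by
  rw [← (hx.ac i).integral_deriv_eq_sub]
  refine intervalIntegral.integral_congr_ae ?_
  rw [uIoc_of_le hLT]
  filter_upwards [hx.deriv_apply_ae i] with t ht h using (ht (Ioc_subset_Icc_self h)).symm

theorem integral_dotProduct (hx : IsRegularOn x L T) (hLT : L ≤ T) (v : Fin n → ℝ) :
    IntervalIntegrable (fun t => v ⬝ᵥ deriv x t) volume L T ∧
      ∫ t in L..T, v ⬝ᵥ deriv x t = v ⬝ᵥ (x T - x L) := by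
  have h : ∀ i ∈ (Finset.univ : Finset (Fin n)),
      IntervalIntegrable (fun t => v i * deriv x t i) volume L T :=
    fun i _ => (hx.intervalIntegrable_apply hLT i).const_mul (v i)
  simp only [dotProduct]
  constructor
  · simpa only [Finset.sum_fn] using IntervalIntegrable.sum _ h
  · rw [intervalIntegral.integral_finsetSum h]
    simp [intervalIntegral.integral_const_mul, hx.integral_apply hLT]

/-- Jensen's inequality for quadratic forms. -/
theorem quad_sub_le (hx : IsRegularOn x L T) {M : Matrix (Fin n) (Fin n) ℝ}
    (hM : M.PosSemidef) (hL : L ≤ a) (hab : a ≤ b) (hT : b ≤ T) :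
    quad M (x b - x a) ≤ (b - a) * ∫ t in a..b, quad M (deriv x t) := by
  rcases hab.eq_or_lt with rfl | hlt
  · simp [quad_zero]
  have hx' := hx.mono hL hab hT
  set y := x b - x a
  have hsymm : Mᵀ = M := by
    have := hM.1
    rwa [Matrix.IsHermitian, conjTranspose_eq_transpose_of_trivial] at this
  -- Expanding the form at `(b - a) ẋ - y`, a multiple of the deviation of `ẋ` from its mean;
  -- nonnegativity of its integral is Jensen's inequality up to a factor `b - a`.
  have hexp : ∀ t, quad M ((b - a) • deriv x t - y) = (b - a) ^ 2 * quad M (deriv x t)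
      - 2 * (b - a) * ((M *ᵥ y) ⬝ᵥ deriv x t) + quad M y := by
    intro t
    have h1 := dotProduct_mulVec_symm hsymm y (deriv x t)
    simp only [quad, mulVec_sub, mulVec_smul, dotProduct_sub, sub_dotProduct, smul_dotProduct,
      dotProduct_smul, smul_eq_mul, h1, dotProduct_comm (M *ᵥ y)]
    ring
  obtain ⟨hi, he⟩ := hx'.integral_dotProduct hab (M *ᵥ y)
  have hq := hx.intervalIntegrable_quad M hL hab hT
  have h0 : 0 ≤ ∫ t in a..b, quad M ((b - a) • deriv x t - y) :=
    intervalIntegral.integral_nonneg hab fun t _ => quad_nonneg hM _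
  simp only [hexp] at h0
  rw [intervalIntegral.integral_add ((hq.const_mul _).sub (hi.const_mul _))
      intervalIntegrable_const, intervalIntegral.integral_sub (hq.const_mul _) (hi.const_mul _),
    intervalIntegral.integral_const_mul, intervalIntegral.integral_const_mul, he,
    intervalIntegral.integral_const, smul_eq_mul, dotProduct_comm] at h0
  change 0 ≤ _ - 2 * (b - a) * quad M y + (b - a) * quad M y at h0
  have h2 : 0 < b - a := by linarith
  have h3 : 0 ≤ (b - a) * ((b - a) * (∫ t in a..b, quad M (deriv x t)) - quad M y) := by
    linarith
  have := nonneg_of_mul_nonneg_right h3 h2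
  linarith

/-- Jensen's inequality with exponential weight. -/
theorem exp_mul_quad_sub_le (hx : IsRegularOn x L T) {M : Matrix (Fin n) (Fin n) ℝ}
    (hM : M.PosSemidef) (hL : L ≤ a) (hab : a ≤ b) (hT : b ≤ T) {c : ℝ} (hc : 0 ≤ c) :
    Real.exp (c * a) * quad M (x b - x a) ≤
      (b - a) * ∫ t in a..b, Real.exp (c * t) * quad M (deriv x t) := by
  have h := hx.quad_sub_le hM hL hab hT
  have hq := hx.intervalIntegrable_quad M hL hab hT
  -- For `c ≥ 0` the weight is smallest at the left endpoint, so the factor `e^{ca}` can be taken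
  -- inside the integral and enlarged.
  calc _ ≤ Real.exp (c * a) * ((b - a) * ∫ t in a..b, quad M (deriv x t)) := by gcongr
    _ = (b - a) * ∫ t in a..b, Real.exp (c * a) * quad M (deriv x t) := by
      rw [intervalIntegral.integral_const_mul]; ring
    _ ≤ _ := by
      refine mul_le_mul_of_nonneg_left ?_ (by linarith)
      refine intervalIntegral.integral_mono_on hab (hq.const_mul _)
        (hx.intervalIntegrable_exp_quad M hL hab hT c) fun t ht => ?_
      have := quad_nonneg hM (deriv x t)
      have := ht.1
      gcongr

end IsRegularOn

theorem hasDerivAt_quad {n : ℕ} {M : Matrix (Fin n) (Fin n) ℝ} (hM : Mᵀ = M)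
    {x : ℝ → Fin n → ℝ} {x' : Fin n → ℝ} {t : ℝ} (hx : HasDerivAt x x' t) :
    HasDerivAt (fun s => quad M (x s)) (2 * (x t ⬝ᵥ (M *ᵥ x'))) t := by
  have h : HasDerivAt (fun s => ∑ i, ∑ j, x s i * (M i j * x s j))
      (∑ i, ∑ j, (x' i * (M i j * x t j) + x t i * (M i j * x' j))) t := by
    refine HasDerivAt.fun_sum fun i _ => HasDerivAt.fun_sum fun j _ => ?_
    exact (hasDerivAt_pi.1 hx i).mul ((hasDerivAt_pi.1 hx j).const_mul (M i j))
  convert h using 1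
  · ext s
    simp [quad, dotProduct, mulVec, Finset.mul_sum]
  · have h2 : x' ⬝ᵥ (M *ᵥ x t) = x t ⬝ᵥ (M *ᵥ x') := dotProduct_mulVec_symm hM _ _
    simp only [Finset.sum_add_distrib]
    rw [two_mul]
    nth_rw 1 [← h2]
    simp [dotProduct, mulVec, Finset.mul_sum]

theorem IsRegularOn.acDeriv_quad {n : ℕ} {M : Matrix (Fin n) (Fin n) ℝ} (hM : Mᵀ = M)
    {x : ℝ → Fin n → ℝ} {a b : ℝ} (hx : IsRegularOn x a b) :
    ACDeriv (fun t => quad M (x t)) (fun t => 2 * (x t ⬝ᵥ (M *ᵥ deriv x t))) a b := by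
  constructor
  · have : (fun t => quad M (x t)) = fun t => ∑ i, ∑ j, x t i * (M i j * x t j) := by
      ext t; simp [quad, dotProduct, mulVec, Finset.mul_sum]
    rw [this]
    have hc : ∀ i, ACDeriv (fun t => x t i) (fun t => deriv (fun t => x t i) t) a b := fun i =>
      ⟨hx.ac i, by
        filter_upwards [hx.hasDerivAt] with t ht h
        exact (hasDerivAt_pi.1 (ht h) i).differentiableAt.hasDerivAt⟩
    exact (ACDeriv.sum _ fun i _ => ACDeriv.sum _ fun j _ => (hc i).mul ((hc j).const_mul _)).ac
  · filter_upwards [hx.hasDerivAt] with t ht h using hasDerivAt_quad hM (ht h)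

/-! ### Inequalities between sampling and updating instants -/

namespace Sampling
variable {ηm τM : ℝ} (S : Sampling ηm τM)

theorem t_sub_η (k : ℕ) : S.t k - S.η k = S.s k := by simp [Sampling.t]

theorem monotone_t : Monotone S.t := S.t_mono

theorem t_le_succ (k : ℕ) : S.t k ≤ S.t (k + 1) := S.monotone_t k.le_succ

theorem s_le_t_sub (k : ℕ) : S.s k ≤ S.t k - ηm := by
  have := S.le_delay k
  simp only [Sampling.t]; linarith

theorem t_succ_sub_le (k : ℕ) : S.t (k + 1) - τM ≤ S.s k := by
  have := S.span_le k
  simp only [Sampling.t]; linarith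

theorem t_succ_le_add (k : ℕ) : S.t (k + 1) ≤ S.t k + (τM - ηm) := by
  have h1 := S.t_succ_sub_le k
  have h2 := S.s_le_t_sub k
  linarith

theorem s_nonneg (k : ℕ) : 0 ≤ S.s k := by
  rw [← S.s_zero]; exact S.s_strictMono.monotone (Nat.zero_le k)

/-- Every integral in `V` thus starts inside `[t_0 - τM, ∞)`, where the trajectory is regular. The
reason is `t_0 ≤ t_1 ≤ s_0 + τM` and `s_0 = 0 ≤ s_k`. -/
theorem t_zero_sub_le_s (k : ℕ) : S.t 0 - τM ≤ S.s k := by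
  have h1 := S.t_succ_sub_le 0
  have h2 := S.t_le_succ 0
  have h3 := S.s_zero
  have h4 := S.s_nonneg k
  linarith

theorem t_nonneg (hηm : 0 ≤ ηm) (k : ℕ) : 0 ≤ S.t k := by
  have h1 := S.s_le_t_sub k
  have h2 := S.s_nonneg k
  linarith

theorem exists_lt_t (hηm : 0 ≤ ηm) (T : ℝ) : ∃ k, T < S.t k := by
  obtain ⟨k, hk⟩ := (S.s_tendsto.eventually_gt_atTop T).exists
  exact ⟨k, hk.trans_le (by linarith [S.s_le_t_sub k])⟩

theorem t_le_add (k m : ℕ) : S.t (k + m) ≤ S.t k + m * (τM - ηm) := by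
  induction m with
  | zero => simp
  | succ m ih =>
    have := S.t_succ_le_add (k + m)
    rw [← add_assoc]; push_cast; linarith

end Sampling

/-! ### Regularity of solutions -/

theorem MemW.isRegularOn {n : ℕ} {x : ℝ → Fin n → ℝ} {τM t₀ : ℝ} (hτ : 0 ≤ τM)
    (h : MemW τM (segment x t₀)) : IsRegularOn x (t₀ - τM) t₀ := by
  have hderiv : ∀ θ, deriv (segment x t₀) θ = deriv x (t₀ + θ) := fun θ =>
    deriv_comp_const_add x t₀ θ
  have hac : ∀ i, AbsolutelyContinuousOnInterval (fun t => x t i) (t₀ - τM) t₀ := by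
    intro i
    have h1 := AbsolutelyContinuousOnInterval.apply h.1 i
    -- Absolute continuity is carried through the translation by writing the component as a constant
    -- plus a shifted indefinite integral.
    have h2 := (ACDeriv.integral (a := t₀ - τM) (b := t₀) (c := t₀)
      h1.intervalIntegrable_deriv (by linarith) (by linarith) (by linarith)).ac
    have hc : AbsolutelyContinuousOnInterval (fun _ : ℝ => x (t₀ - τM) i) (t₀ - τM) t₀ :=
      (ACDeriv.const _).ac
    refine AbsolutelyContinuousOnInterval.congr (hc.add h2) fun t ht => ?_
    rw [uIcc_of_le (by linarith)] at ht
    have hsub : uIcc (-τM) (t - t₀) ⊆ uIcc (-τM) 0 := by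
      rw [uIcc_of_le (by linarith [ht.1]), uIcc_of_le (by linarith)]
      exact Icc_subset_Icc_right (by linarith [ht.2])
    simp only [Pi.add_apply]
    rw [(h1.mono hsub).integral_deriv_eq_sub]
    simp [segment, sub_eq_add_neg]
  refine ⟨hac, AbsolutelyContinuousOnInterval.ae_hasDerivAt_pi (by linarith) hac, ?_⟩
  have h3 := h.2
  rw [← intervalIntegrable_iff_integrableOn_Icc_of_le (by linarith)] at h3 ⊢
  have h4 := h3.comp_sub_right t₀
  simp only [hderiv] at h4
  convert h4 using 1
  · ext t; rw [add_sub_cancel]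
  · ring
  · ring

section
variable {n q N : ℕ} {p : Fin N → ℕ}

theorem IsSolution.isRegularOn {sys : HybridSystem n q N p} {ηm τM : ℝ} (hηm : 0 ≤ ηm)
    (hτM : ηm < τM) {S : Sampling ηm τM} {istar : ℕ → Fin N} {ω : ℝ → Fin q → ℝ} {Δ : ℝ}
    {x : ℝ → Fin n → ℝ} {e : ℕ → ∀ i : Fin N, Fin (p i) → ℝ}
    (hω : IsDisturbance ω Δ) (h : IsSolution sys S istar ω x e) {T : ℝ} (hT : S.t 0 ≤ T) :
    IsRegularOn x (S.t 0 - τM) T := by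
  refine (MemW.isRegularOn (by linarith) h.initial).trans (by linarith) hT ?_
  have hac : ∀ i, AbsolutelyContinuousOnInterval (fun t => x t i) (S.t 0) T := fun i =>
    AbsolutelyContinuousOnInterval.apply (h.absCont T hT) i
  refine ⟨hac, AbsolutelyContinuousOnInterval.ae_hasDerivAt_pi hT hac, ?_⟩
  -- Between two updates `ẋ` is a continuous function of `(x, ω)`, which stays in a product of two
  -- compact balls, so `|ẋ|²` is essentially bounded there.
  have hpiece : ∀ k, IntegrableOn (fun t => eNorm (deriv x t) ^ 2)
      (Icc (S.t k) (S.t (k + 1))) := by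
    intro k
    have h0k := S.monotone_t (Nat.zero_le k)
    have hk := S.t_le_succ k
    obtain ⟨C, hC⟩ := (h.absCont (S.t (k + 1)) (h0k.trans hk)).exists_bound
    set v : Fin n → ℝ := sys.A₁ *ᵥ x (S.t k - S.η k)
    set v' : Fin n → ℝ := ∑ i ∈ Finset.univ.erase (istar k), sys.B i *ᵥ e k i
    have hcont : Continuous fun u : (Fin n → ℝ) × (Fin q → ℝ) =>
        eNorm (sys.A *ᵥ u.1 + v + v' + sys.D *ᵥ u.2) ^ 2 :=
      (continuous_eNorm.comp (by fun_prop)).pow 2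
    obtain ⟨K, hK⟩ := ((isCompact_closedBall (0 : Fin n → ℝ) C).prod
      (isCompact_closedBall (0 : Fin q → ℝ) Δ)).exists_bound_of_continuousOn hcont.continuousOn
    refine Measure.integrableOn_of_bounded (M := K) (by simp)
      ((continuous_eNorm.measurable.comp (measurable_deriv x)).pow_const 2).aestronglyMeasurable ?_
    rw [ae_restrict_iff' measurableSet_Icc]
    filter_upwards [h.flow k, hω.2.2, Measure.ae_ne volume (S.t (k + 1))] with t h1 h2 h3 ht
    rw [(h1 ⟨ht.1, lt_of_le_of_ne ht.2 h3⟩).deriv]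
    refine hK (x t, ω t) ⟨?_, ?_⟩
    · rw [mem_closedBall_zero_iff]
      exact hC t (by rw [uIcc_of_le (h0k.trans hk)]; exact ⟨h0k.trans ht.1, ht.2⟩)
    · rw [mem_closedBall_zero_iff]
      have h4 := h2 ((S.t_nonneg hηm k).trans ht.1)
      exact (le_of_sq_le_sq (norm_sq_le_eNorm_sq (ω t)) (eNorm_nonneg _)).trans h4
  have hall : ∀ k, IntegrableOn (fun t => eNorm (deriv x t) ^ 2) (Icc (S.t 0) (S.t k)) := by
    intro k
    induction k with
    | zero => simp
    | succ k ih =>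
      rw [← Icc_union_Icc_eq_Icc (S.monotone_t (Nat.zero_le k)) (S.t_le_succ k)]
      exact ih.union (hpiece k)
  -- Since `t_k → ∞`, finitely many such pieces cover `[t_0, T]`.
  obtain ⟨k, hk⟩ := S.exists_lt_t hηm T
  exact (hall k).mono_set (Icc_subset_Icc_right hk.le)

/-! ### The functional multiplied by the exponential weight -/

/-- Multiplying by `e^{ct}` frees the integrand of `t`, so that only the limits of integration
depend on time. -/
theorem exp_mul_integral (c t a b : ℝ) (f : ℝ → ℝ) :
    Real.exp (c * t) * ∫ s in a..b, Real.exp (c * (s - t)) * f s =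
      ∫ s in a..b, Real.exp (c * s) * f s := by
  rw [← intervalIntegral.integral_const_mul]
  refine intervalIntegral.integral_congr fun s _ => ?_
  rw [← mul_assoc, ← Real.exp_add]
  congr 2; ring

/-- With `Γ(r) = ∫_L^r g` the inner integral is `Γ(t) - Γ(t + θ)`. The double integral becomes a
combination of integrals with fixed lower limit `L`, which `ACDeriv.integral` can differentiate. -/
theorem integral_integral_shift {g : ℝ → ℝ} {L T t θ₁ θ₂ : ℝ}
    (hg : IntervalIntegrable g volume L T) (hL : L ≤ t + θ₁) (hθ : θ₁ ≤ θ₂) (hθ₂ : θ₂ ≤ 0)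
    (hT : t ≤ T) :
    ∫ θ in θ₁..θ₂, ∫ s in (t + θ)..t, g s = (θ₂ - θ₁) * (∫ s in L..t, g s)
      - ((∫ r in L..(t + θ₂), ∫ s in L..r, g s) - ∫ r in L..(t + θ₁), ∫ s in L..r, g s) := by
  have hLT : L ≤ T := by linarith
  have hsub : ∀ {a b}, L ≤ a → a ≤ b → b ≤ T → IntervalIntegrable g volume a b :=
    fun ha hab hb => hg.mono_set (by
      rw [uIcc_of_le hab, uIcc_of_le hLT]; exact Icc_subset_Icc ha hb)
  have hΓ : ContinuousOn (fun r => ∫ s in L..r, g s) (Icc L T) := by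
    rw [← uIcc_of_le hLT]
    exact (hg.absolutelyContinuousOnInterval_intervalIntegral left_mem_uIcc).continuousOn
  have hΓi : ∀ {a b}, L ≤ a → a ≤ b → b ≤ T →
      IntervalIntegrable (fun r => ∫ s in L..r, g s) volume a b := fun ha hab hb =>
    (hΓ.mono (by rw [uIcc_of_le hab]; exact Icc_subset_Icc ha hb)).intervalIntegrable
  have h1 : ∫ θ in θ₁..θ₂, ∫ s in (t + θ)..t, g s =
      ∫ θ in θ₁..θ₂, ((∫ s in L..t, g s) - ∫ s in L..(t + θ), g s) := by
    refine intervalIntegral.integral_congr fun θ hθ' => ?_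
    rw [uIcc_of_le hθ] at hθ'
    rw [intervalIntegral.integral_interval_sub_left (hsub le_rfl (by linarith) hT)
      (hsub le_rfl (by linarith [hθ'.1]) (by linarith [hθ'.2]))]
  have h2 : IntervalIntegrable (fun θ => ∫ s in L..(t + θ), g s) volume θ₁ θ₂ := by
    have := (hΓi (a := t + θ₁) (b := t + θ₂) hL (by linarith) (by linarith)).comp_add_left t
    simpa using this
  rw [h1, intervalIntegral.integral_sub intervalIntegrable_const h2,
    intervalIntegral.integral_const, smul_eq_mul,
    intervalIntegral.integral_comp_add_left (fun r => ∫ s in L..r, g s),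
    intervalIntegral.integral_interval_sub_left (hΓi le_rfl (by linarith) (by linarith))
      (hΓi le_rfl hL (by linarith))]

/-- `∫_L^t e^{cs} ẋᵀ M ẋ ds`. -/
def kinetic (M : Matrix (Fin n) (Fin n) ℝ) (c : ℝ) (x : ℝ → Fin n → ℝ) (L t : ℝ) : ℝ :=
  ∫ s in L..t, Real.exp (c * s) * quad M (deriv x s)

/-- `∫_L^t e^{cs} xᵀ M x ds`. -/
def potential (M : Matrix (Fin n) (Fin n) ℝ) (c : ℝ) (x : ℝ → Fin n → ℝ) (L t : ℝ) : ℝ :=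
  ∫ s in L..t, Real.exp (c * s) * quad M (x s)

/-- `C_iᵀ G_i C_i`. -/
def outputWeight (sys : HybridSystem n q N p) (d : Decision n p) (ηm τM α : ℝ) (i : Fin N) :
    Matrix (Fin n) (Fin n) ℝ :=
  (sys.C i)ᵀ * d.G ηm τM α i * sys.C i

theorem quad_outputWeight (sys : HybridSystem n q N p) (d : Decision n p) (ηm τM α : ℝ)
    (i : Fin N) (v : Fin n → ℝ) :
    quad (outputWeight sys d ηm τM α i) v = quad (d.G ηm τM α i) (sys.C i *ᵥ v) :=
  dotProduct_transpose_mul_mul _ _ _ _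

theorem quad_G (d : Decision n p) (ηm τM α : ℝ) (i : Fin N) (v : Fin (p i) → ℝ) :
    quad (d.G ηm τM α i) v = ((N : ℝ) - 1) *
      Real.exp (2 * α * (τM + ((N : ℝ) - 2) * (τM - ηm))) * quad (d.Q i) v :=
  quad_smul_left _ _ _

theorem outputWeight_posSemidef {sys : HybridSystem n q N p} {d : Decision n p} {ηm τM α : ℝ}
    (hN : 2 ≤ N) (hQ : ∀ i, (d.Q i).PosDef) (i : Fin N) :
    (outputWeight sys d ηm τM α i).PosSemidef := by
  have hN' : (2 : ℝ) ≤ N := by exact_mod_cast hN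
  have hG : (d.G ηm τM α i).PosSemidef :=
    (hQ i).posSemidef.smul (mul_nonneg (by linarith) (Real.exp_pos _).le)
  have := hG.conjTranspose_mul_mul_same (sys.C i)
  rwa [conjTranspose_eq_transpose_of_trivial] at this

/-- `V = Ṽ + V_G` with `V_G` starting at an arbitrary time `a`. -/
def functional (sys : HybridSystem n q N p) (d : Decision n p) (ηm τM α : ℝ)
    (x : ℝ → Fin n → ℝ) (a t : ℝ) : ℝ :=
  Vtilde d ηm τM α x t + VG sys d ηm τM α x a t

/-- The functional multiplied by `e^{2αt}`, in terms of integrals with fixed lower limit `L`. -/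
def weighted (sys : HybridSystem n q N p) (d : Decision n p) (ηm τM α : ℝ)
    (x : ℝ → Fin n → ℝ) (L a t : ℝ) : ℝ :=
  Real.exp (2 * α * t) * quad d.P (x t)
    + (potential d.S₀ (2 * α) x L t - potential d.S₀ (2 * α) x L (t - ηm))
    + (potential d.S₁ (2 * α) x L (t - ηm) - potential d.S₁ (2 * α) x L (t - τM))
    + ηm * (ηm * kinetic d.R₀ (2 * α) x L t
      - ((∫ r in L..t, kinetic d.R₀ (2 * α) x L r)
        - ∫ r in L..(t - ηm), kinetic d.R₀ (2 * α) x L r))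
    + (τM - ηm) * ((τM - ηm) * kinetic d.R₁ (2 * α) x L t
      - ((∫ r in L..(t - ηm), kinetic d.R₁ (2 * α) x L r)
        - ∫ r in L..(t - τM), kinetic d.R₁ (2 * α) x L r))
    + ∑ i, (τM - ηm) * (kinetic (outputWeight sys d ηm τM α i) (2 * α) x L t
        - kinetic (outputWeight sys d ηm τM α i) (2 * α) x L a)

theorem exp_mul_functional {sys : HybridSystem n q N p} {d : Decision n p} {ηm τM α : ℝ}
    (hηm : 0 ≤ ηm) (hτM : ηm < τM) {x : ℝ → Fin n → ℝ} {L T a t : ℝ} (hx : IsRegularOn x L T)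
    (hL : L ≤ t - τM) (hT : t ≤ T) (hLa : L ≤ a) (hat : a ≤ t) :
    Real.exp (2 * α * t) * functional sys d ηm τM α x a t
      = weighted sys d ηm τM α x L a t := by
  have hLT : L ≤ T := by linarith
  have hkin : ∀ M, IntervalIntegrable
      (fun s => Real.exp (2 * α * s) * quad M (deriv x s)) volume L T := fun M =>
    hx.intervalIntegrable_exp_quad M le_rfl hLT le_rfl _
  have hkin' : ∀ M {u v}, L ≤ u → u ≤ v → v ≤ T → IntervalIntegrable
      (fun s => Real.exp (2 * α * s) * quad M (deriv x s)) volume u v := fun M _ _ hu huv hv =>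
    hx.intervalIntegrable_exp_quad M hu huv hv _
  have hpot : ∀ M {u v}, L ≤ u → u ≤ v → v ≤ T → IntervalIntegrable
      (fun s => Real.exp (2 * α * s) * quad M (x s)) volume u v := by
    intro M u v hu huv hv
    refine ContinuousOn.intervalIntegrable ?_
    rw [uIcc_of_le huv]
    refine ContinuousOn.mul (by fun_prop) ?_
    exact (continuous_quad M).comp_continuousOn
      ((hx.continuousOn hLT).mono (Icc_subset_Icc hu hv))
  have h1 : Real.exp (2 * α * t) * (∫ s in (t - ηm)..t,
      Real.exp (2 * α * (s - t)) * quad d.S₀ (x s))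
      = potential d.S₀ (2 * α) x L t - potential d.S₀ (2 * α) x L (t - ηm) := by
    rw [exp_mul_integral, potential, potential, intervalIntegral.integral_interval_sub_left
      (hpot _ le_rfl (by linarith) hT) (hpot _ le_rfl (by linarith) (by linarith))]
  have h2 : Real.exp (2 * α * t) * (∫ s in (t - τM)..(t - ηm),
      Real.exp (2 * α * (s - t)) * quad d.S₁ (x s))
      = potential d.S₁ (2 * α) x L (t - ηm) - potential d.S₁ (2 * α) x L (t - τM) := by
    rw [exp_mul_integral, potential, potential, intervalIntegral.integral_interval_sub_left
      (hpot _ le_rfl (by linarith) (by linarith)) (hpot _ le_rfl (by linarith) (by linarith))]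
  have h3 : Real.exp (2 * α * t) * (∫ θ in (-ηm)..0, ∫ s in (t + θ)..t,
        Real.exp (2 * α * (s - t)) * quad d.R₀ (deriv x s))
      = ηm * kinetic d.R₀ (2 * α) x L t - ((∫ r in L..t, kinetic d.R₀ (2 * α) x L r)
        - ∫ r in L..(t - ηm), kinetic d.R₀ (2 * α) x L r) := by
    rw [← intervalIntegral.integral_const_mul]
    simp only [exp_mul_integral]
    rw [integral_integral_shift (hkin _) (by linarith) (by linarith) le_rfl hT]
    simp only [kinetic, add_zero, zero_add, neg_neg, sub_eq_add_neg]
  have h4 : Real.exp (2 * α * t) * (∫ θ in (-τM)..(-ηm), ∫ s in (t + θ)..t,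
        Real.exp (2 * α * (s - t)) * quad d.R₁ (deriv x s))
      = (τM - ηm) * kinetic d.R₁ (2 * α) x L t
        - ((∫ r in L..(t - ηm), kinetic d.R₁ (2 * α) x L r)
        - ∫ r in L..(t - τM), kinetic d.R₁ (2 * α) x L r) := by
    rw [← intervalIntegral.integral_const_mul]
    simp only [exp_mul_integral]
    rw [integral_integral_shift (hkin _) (by linarith) (by linarith) (by linarith) hT]
    simp only [kinetic, ← sub_eq_add_neg, sub_neg_eq_add]
    rw [neg_add_eq_sub]
  have h5 : ∀ i, Real.exp (2 * α * t) * (∫ s in a..t,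
      Real.exp (2 * α * (s - t)) * quad (d.G ηm τM α i) (sys.C i *ᵥ deriv x s))
      = kinetic (outputWeight sys d ηm τM α i) (2 * α) x L t
        - kinetic (outputWeight sys d ηm τM α i) (2 * α) x L a := by
    intro i
    simp only [← quad_outputWeight]
    rw [exp_mul_integral, kinetic, kinetic, intervalIntegral.integral_interval_sub_left
      (hkin' _ le_rfl (by linarith) hT) (hkin' _ le_rfl (by linarith) (by linarith))]
  simp only [functional, Vtilde, VG, weighted, ← h1, ← h2, ← h3, ← h4, ← h5]
  simp only [mul_add, Finset.mul_sum]
  congr 1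
  · ring
  · refine Finset.sum_congr rfl fun i _ => ?_
    ring

end

/-! ### The derivative estimate and decay between updates -/

section
variable {n q N : ℕ} {p : Fin N → ℕ}

/-- The almost everywhere derivative of `weighted`. -/
def weightedDeriv (sys : HybridSystem n q N p) (d : Decision n p) (ηm τM α : ℝ)
    (x : ℝ → Fin n → ℝ) (L t : ℝ) : ℝ :=
  (2 * α * Real.exp (2 * α * t) * quad d.P (x t)
      + Real.exp (2 * α * t) * (2 * (x t ⬝ᵥ (d.P *ᵥ deriv x t))))
    + (Real.exp (2 * α * t) * quad d.S₀ (x t)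
      - Real.exp (2 * α * (t - ηm)) * quad d.S₀ (x (t - ηm)))
    + (Real.exp (2 * α * (t - ηm)) * quad d.S₁ (x (t - ηm))
      - Real.exp (2 * α * (t - τM)) * quad d.S₁ (x (t - τM)))
    + ηm * (ηm * (Real.exp (2 * α * t) * quad d.R₀ (deriv x t))
      - (kinetic d.R₀ (2 * α) x L t - kinetic d.R₀ (2 * α) x L (t - ηm)))
    + (τM - ηm) * ((τM - ηm) * (Real.exp (2 * α * t) * quad d.R₁ (deriv x t))
      - (kinetic d.R₁ (2 * α) x L (t - ηm) - kinetic d.R₁ (2 * α) x L (t - τM)))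
    + ∑ i, (τM - ηm) *
        (Real.exp (2 * α * t) * quad (outputWeight sys d ηm τM α i) (deriv x t) - 0)

theorem acDeriv_weighted {sys : HybridSystem n q N p} {d : Decision n p} {ηm τM α : ℝ}
    (hηm : 0 ≤ ηm) (hτM : ηm < τM) (hP : d.Pᵀ = d.P) {x : ℝ → Fin n → ℝ} {L T a t₁ t₂ : ℝ}
    (hx : IsRegularOn x L T) (hL : L ≤ t₁ - τM) (h12 : t₁ ≤ t₂) (hT : t₂ ≤ T) :
    ACDeriv (weighted sys d ηm τM α x L a) (weightedDeriv sys d ηm τM α x L) t₁ t₂ := by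
  have hLT : L ≤ T := by linarith
  have hkin : ∀ M, IntervalIntegrable
      (fun s => Real.exp (2 * α * s) * quad M (deriv x s)) volume L T := fun M =>
    hx.intervalIntegrable_exp_quad M le_rfl hLT le_rfl _
  have hpot : ∀ M, IntervalIntegrable
      (fun s => Real.exp (2 * α * s) * quad M (x s)) volume L T := by
    intro M
    refine ContinuousOn.intervalIntegrable ?_
    rw [uIcc_of_le hLT]
    exact ContinuousOn.mul (by fun_prop)
      ((continuous_quad M).comp_continuousOn (hx.continuousOn hLT))
  have hkk : ∀ M, IntervalIntegrable (fun r => kinetic M (2 * α) x L r) volume L T := fun M =>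
    ((hkin M).absolutelyContinuousOnInterval_intervalIntegral
      left_mem_uIcc).continuousOn.intervalIntegrable
  have I : ∀ {g : ℝ → ℝ}, IntervalIntegrable g volume L T → ∀ c, 0 ≤ c → c ≤ τM →
      ACDeriv (fun t => ∫ s in L..(t - c), g s) (fun t => g (t - c)) t₁ t₂ :=
    fun hg c hc hc' => ACDeriv.integral hg (by linarith) h12 (by linarith)
  have I₀ : ∀ {g : ℝ → ℝ}, IntervalIntegrable g volume L T →
      ACDeriv (fun t => ∫ s in L..t, g s) g t₁ t₂ := by
    intro g hg
    simpa using I hg 0 le_rfl (by linarith)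
  have hq := (hx.mono (a := t₁) (b := t₂) (by linarith) h12 hT).acDeriv_quad hP
  exact ((((((ACDeriv.exp (2 * α)).mul hq).add
    ((I₀ (hpot _)).sub (I (hpot _) ηm hηm hτM.le))).add
    ((I (hpot _) ηm hηm hτM.le).sub (I (hpot _) τM (by linarith) le_rfl))).add
    ((((I₀ (hkin _)).const_mul ηm).sub
      ((I₀ (hkk _)).sub (I (hkk _) ηm hηm hτM.le))).const_mul ηm)).add
    ((((I₀ (hkin _)).const_mul (τM - ηm)).sub
      ((I (hkk _) ηm hηm hτM.le).sub (I (hkk _) τM (by linarith) le_rfl))).const_mul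
        (τM - ηm))).add
    -- The starting time `a` enters only through a constant; its derivative is the `0` in
    -- `weightedDeriv`, which therefore does not depend on `a`.
    (ACDeriv.sum _ fun i _ => (((I₀ (hkin _)).sub (ACDeriv.const _)).const_mul (τM - ηm)))

theorem quad_psi (d : Decision n p) (ηm τM α : ℝ) (j : Fin N) (v : Fin (p j) → ℝ) :
    quad (psi d ηm τM α j) v =
      (2 * α - 1 / (τM - ηm) * (1 / ((N : ℝ) - 1))) * quad (d.Q j) v := by
  simp only [psi, Decision.U, quad_add_left, quad_smul_left]
  ring

/-- The derivative estimate supplied by the LMIs. -/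
theorem weightedDeriv_le {sys : HybridSystem n q N p} {d : Decision n p} {ηm τM α : ℝ}
    (hηm : 0 ≤ ηm) (hτM : ηm < τM) (hα : 0 ≤ α) (hd : SatisfiesLMIs sys d ηm τM α)
    {x : ℝ → Fin n → ℝ} {L T t σ : ℝ} (hx : IsRegularOn x L T) (hL : L ≤ t - τM) (hT : t ≤ T)
    (hσ₁ : t - τM ≤ σ) (hσ₂ : σ ≤ t - ηm) (i : Fin N) (e : ∀ j : Fin N, Fin (p j) → ℝ)
    (w : Fin q → ℝ) (hy : deriv x t = sys.A *ᵥ x t + sys.A₁ *ᵥ x σ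
      + (∑ j ∈ Finset.univ.erase i, sys.B j *ᵥ e j) + sys.D *ᵥ w) :
    weightedDeriv sys d ηm τM α x L t ≤ Real.exp (2 * α * t) *
      (d.b * eNorm w ^ 2 - (2 * α - 1 / (τM - ηm) * (1 / ((N : ℝ) - 1))) *
        ∑ j ∈ Finset.univ.erase i, quad (d.Q j) (e j)) := by
  have hR₀ := hd.R₀_pos.posSemidef
  have hR₁ := hd.R₁_pos.posSemidef
  have hsplit : ∀ M u v, L ≤ u → u ≤ v → v ≤ T → kinetic M (2 * α) x L v
      - kinetic M (2 * α) x L u = ∫ s in u..v, Real.exp (2 * α * s) * quad M (deriv x s) := by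
    intro M u v hu huv hv
    rw [kinetic, kinetic, intervalIntegral.integral_interval_sub_left
      (hx.intervalIntegrable_exp_quad M le_rfl (hu.trans huv) hv _)
      (hx.intervalIntegrable_exp_quad M le_rfl hu (huv.trans hv) _)]
  have hnn : ∀ {M : Matrix (Fin n) (Fin n) ℝ} {u v : ℝ}, M.PosSemidef → u ≤ v →
      0 ≤ ∫ s in u..v, Real.exp (2 * α * s) * quad M (deriv x s) := fun hM huv =>
    intervalIntegral.integral_nonneg huv fun s _ =>
      mul_nonneg (Real.exp_pos _).le (quad_nonneg hM _)
  have hE : ∀ r, Real.exp (2 * α * (t - r)) = Real.exp (2 * α * t) * Real.exp (-2 * α * r) := by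
    intro r; rw [← Real.exp_add]; congr 1; ring
  have J₀ := hx.exp_mul_quad_sub_le hR₀ (a := t - ηm) (b := t) (by linarith) (by linarith) hT
    (c := 2 * α) (by positivity)
  rw [sub_sub_cancel, ← hsplit _ _ _ (by linarith) (by linarith) hT, hE] at J₀
  -- `ε` is the smallest weight on `[t - τM, t - ηm]`. Jensen on the two parts of this interval cut
  -- at `σ`, divided by `ε`, gives the hypotheses of `reciprocally_convex`; the two lengths add up
  -- to `τM - ηm`.
  set ε := Real.exp (2 * α * (t - τM)) with hε
  have hε0 : 0 < ε := Real.exp_pos _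
  have J₁ := hx.exp_mul_quad_sub_le hR₁ (a := σ) (b := t - ηm) (by linarith) hσ₂ (by linarith)
    (c := 2 * α) (by positivity)
  have J₂ := hx.exp_mul_quad_sub_le hR₁ (a := t - τM) (b := σ) (by linarith) hσ₁ (by linarith)
    (c := 2 * α) (by positivity)
  have hI₁ := hnn (u := σ) (v := t - ηm) hR₁ hσ₂
  have hI₂ := hnn (u := t - τM) (v := σ) hR₁ hσ₁
  have hadd := intervalIntegral.integral_add_adjacent_intervals
    (hx.intervalIntegrable_exp_quad d.R₁ (a := t - τM) (b := σ) (by linarith) hσ₁ (by linarith)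
      (2 * α))
    (hx.intervalIntegrable_exp_quad d.R₁ (a := σ) (b := t - ηm) (by linarith) hσ₂ (by linarith)
      (2 * α))
  have hsum := hsplit d.R₁ (t - τM) (t - ηm) (by linarith) (by linarith) (by linarith)
  set I₁ := ∫ s in σ..(t - ηm), Real.exp (2 * α * s) * quad d.R₁ (deriv x s)
  set I₂ := ∫ s in (t - τM)..σ, Real.exp (2 * α * s) * quad d.R₁ (deriv x s)
  have hεσ : ε ≤ Real.exp (2 * α * σ) := Real.exp_le_exp.2 (by gcongr)
  have J₁' : quad d.R₁ (x (t - ηm) - x σ) ≤ (t - ηm - σ) * (I₁ / ε) := by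
    rw [← mul_div_assoc, le_div_iff₀ hε0, mul_comm]
    exact (mul_le_mul_of_nonneg_right hεσ (quad_nonneg hR₁ _)).trans J₁
  have J₂' : quad d.R₁ (x σ - x (t - τM)) ≤ (σ - (t - τM)) * (I₂ / ε) := by
    rw [← mul_div_assoc, le_div_iff₀ hε0, mul_comm]
    exact J₂
  have hrc := reciprocally_convex hd.phi_nonneg (by linarith) (by linarith)
    (div_nonneg hI₁ hε0.le) (div_nonneg hI₂ hε0.le) (quad_nonneg hR₁) J₁' J₂'
  have hrc' := mul_le_mul_of_nonneg_left hrc hε0.le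
  have hrc2 : ε * ((t - ηm - σ + (σ - (t - τM))) * (I₁ / ε + I₂ / ε)) =
      (τM - ηm) * (kinetic d.R₁ (2 * α) x L (t - ηm) - kinetic d.R₁ (2 * α) x L (t - τM)) := by
    rw [hsum, ← hadd]; field_simp; ring
  rw [hrc2, hε, hE] at hrc'
  have hlmi := mul_le_mul_of_nonneg_left
    (lmi_scalar hd i (x t) (x (t - ηm)) (x σ) (x (t - τM)) e w hy) (Real.exp_pos (2 * α * t)).le
  rw [mul_zero] at hlmi
  simp only [quad_psi, ← Finset.mul_sum, ← quad_outputWeight, ← eNorm_sq] at hlmi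
  simp only [weightedDeriv, hE, ← Finset.mul_sum, sub_zero]
  linarith

/-- Decay of the functional between two updating instants, for a disturbance that is bounded by
`Δ` up to time `t`. -/
theorem functional_step {sys : HybridSystem n q N p} {d : Decision n p} {ηm τM α : ℝ}
    (hN : 2 ≤ N) (hηm : 0 ≤ ηm) (hτM : ηm < τM) (hα : 0 < α) (hd : SatisfiesLMIs sys d ηm τM α)
    {S : Sampling ηm τM} {istar : ℕ → Fin N} {ω : ℝ → Fin q → ℝ}
    {x : ℝ → Fin n → ℝ} {e : ℕ → ∀ i : Fin N, Fin (p i) → ℝ}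
    (hsol : IsSolution sys S istar ω x e)
    (hx : ∀ T, S.t 0 ≤ T → IsRegularOn x (S.t 0 - τM) T) {k : ℕ} {a t Δ : ℝ}
    (ht : t ∈ Icc (S.t k) (S.t (k + 1))) (ha : S.t 0 - τM ≤ a) (hak : a ≤ S.t k)
    (hω : ∀ᵐ s : ℝ, s ∈ Icc (S.t 0) t → eNorm (ω s) ≤ Δ) :
    functional sys d ηm τM α x a t - d.b / (2 * α) * Δ ^ 2 ≤
      Real.exp (-2 * α * (t - S.t k)) * (functional sys d ηm τM α x a (S.t k)
        - d.b / (2 * α) * Δ ^ 2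
        + (∑ j ∈ Finset.univ.erase (istar k), quad (d.Q j) (e k j)) / ((N : ℝ) - 1)) := by
  have hN' : (1 : ℝ) ≤ (N : ℝ) - 1 := by
    have : (2 : ℝ) ≤ N := by exact_mod_cast hN
    linarith
  have hN0 : (0 : ℝ) < (N : ℝ) - 1 := by linarith
  have hh : 0 < τM - ηm := by linarith
  have h0k := S.monotone_t (Nat.zero_le k)
  set Q := ∑ j ∈ Finset.univ.erase (istar k), quad (d.Q j) (e k j) with hQdef
  have hQ0 : 0 ≤ Q := Finset.sum_nonneg fun j _ => quad_nonneg (hd.Q_pos j).posSemidef _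
  -- The derivative estimate reads `V' + 2αV ≤ κ` with `κ` constant on the interval, so `e^{2αt} (V
  -- - κ / (2α))` does not increase.
  set κ := d.b * Δ ^ 2 - (2 * α - 1 / (τM - ηm) * (1 / ((N : ℝ) - 1))) * Q with hκ
  have hreg := hx t (h0k.trans ht.1)
  have hW := acDeriv_weighted (sys := sys) (α := α) (a := a) hηm hτM
    (transpose_of_posDef hd.P_pos) hreg (by linarith : S.t 0 - τM ≤ S.t k - τM) ht.1 le_rfl
  have hF := hW.sub ((ACDeriv.exp (2 * α)).const_mul (κ / (2 * α)))
  have hle := hF.le_of_nonpos ht.1 (by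
    filter_upwards [hsol.flow k, hω, Measure.ae_ne volume (S.t (k + 1))] with s h1 h2 h3 hs
    have hs' : s ∈ Ico (S.t k) (S.t (k + 1)) := ⟨hs.1, lt_of_le_of_ne (hs.2.trans ht.2) h3⟩
    have hy := (h1 hs').deriv
    rw [S.t_sub_η] at hy
    have hb := weightedDeriv_le hηm hτM hα.le hd hreg (by linarith [hs.1]) hs.2
      (by linarith [S.t_succ_sub_le k, hs'.2]) (by linarith [S.s_le_t_sub k, hs.1])
      (istar k) (e k) (ω s) hy
    have hω' : eNorm (ω s) ^ 2 ≤ Δ ^ 2 :=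
      pow_le_pow_left₀ (eNorm_nonneg _) (h2 ⟨h0k.trans hs.1, hs.2⟩) 2
    have hb' : d.b * eNorm (ω s) ^ 2 - (2 * α - 1 / (τM - ηm) * (1 / ((N : ℝ) - 1))) * Q ≤ κ := by
      rw [hκ]; gcongr; exact hd.b_pos.le
    have hb2 := hb.trans (mul_le_mul_of_nonneg_left hb' (Real.exp_pos (2 * α * s)).le)
    have hb3 : κ / (2 * α) * (2 * α * Real.exp (2 * α * s)) = Real.exp (2 * α * s) * κ := by
      field_simp
    rw [hb3]
    linarith)
  rw [← exp_mul_functional hηm hτM hreg (by linarith [ht.1]) le_rfl ha (hak.trans ht.1),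
    ← exp_mul_functional hηm hτM hreg (by linarith) ht.1 ha hak] at hle
  set V₁ := functional sys d ηm τM α x a t
  set V₀ := functional sys d ηm τM α x a (S.t k)
  set r := Real.exp (-2 * α * (t - S.t k)) with hr
  have hEr : Real.exp (2 * α * S.t k) = Real.exp (2 * α * t) * r := by
    rw [hr, ← Real.exp_add]; congr 1; ring
  have hle' : V₁ - κ / (2 * α) ≤ r * (V₀ - κ / (2 * α)) := by
    refine le_of_mul_le_mul_left ?_ (Real.exp_pos (2 * α * t))
    rw [hEr] at hle
    linarith
  -- `1 - e^{-s} ≤ s`, together with the bound `τM - ηm` on the length of the interval; this cancels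
  -- the factor `1 / (2α(τM - ηm))` in front of `u`.
  have hr1 : 1 - r ≤ 2 * α * (τM - ηm) := by
    have h1 := Real.add_one_le_exp (-2 * α * (t - S.t k))
    have h2 : t - S.t k ≤ τM - ηm := by linarith [ht.2, S.t_succ_le_add k]
    have h3 : 2 * α * (t - S.t k) ≤ 2 * α * (τM - ηm) := by gcongr
    linarith
  have hr2 : r ≤ 1 := Real.exp_le_one_iff.2 (by nlinarith [ht.1])
  -- What remains besides `r (V₀ - β)` and `β` is `(1 - r)(u / (2α(τM - ηm)) - Q)`. It is at most `u
  -- - (1 - r) u = r u`, because `u ≤ Q` when `N - 1 ≥ 1`.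
  have hκ' : κ / (2 * α) = d.b / (2 * α) * Δ ^ 2 - Q
      + (Q / ((N : ℝ) - 1)) / (2 * α * (τM - ηm)) := by
    rw [hκ]; field_simp; ring
  set u := Q / ((N : ℝ) - 1) with hu
  have hu0 : 0 ≤ u := div_nonneg hQ0 hN0.le
  have huQ : u ≤ Q := div_le_self hQ0 hN'
  have h5 : (1 - r) * (u / (2 * α * (τM - ηm))) ≤ u := by
    rw [← mul_div_assoc, div_le_iff₀ (by positivity), mul_comm]
    gcongr
  have h6 : (1 - r) * u ≤ (1 - r) * Q := mul_le_mul_of_nonneg_left huQ (by linarith)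
  rw [hκ'] at hle'
  linarith

end

/-! ### Release of `V_G` at jumps and bounds on the errors -/

section
variable {n q N : ℕ} {p : Fin N → ℕ}

theorem quad_add_le {n : ℕ} {M : Matrix (Fin n) (Fin n) ℝ} (hM : M.PosSemidef)
    (u v : Fin n → ℝ) {r : ℝ} (hr : 0 < r) :
    quad M (u + v) ≤ (1 + 1 / r) * quad M u + (1 + r) * quad M v := by
  have hsymm : Mᵀ = M := by
    have := hM.1
    rwa [Matrix.IsHermitian, conjTranspose_eq_transpose_of_trivial] at this
  have h0 := quad_nonneg hM (u - r • v)
  have h1 := dotProduct_mulVec_symm hsymm u v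
  simp only [quad, mulVec_sub, mulVec_smul, mulVec_add, dotProduct_sub, sub_dotProduct,
    smul_dotProduct, dotProduct_smul, smul_eq_mul, dotProduct_add, add_dotProduct, h1] at h0 ⊢
  have h2 : 2 * (v ⬝ᵥ (M *ᵥ u)) ≤ 1 / r * (u ⬝ᵥ (M *ᵥ u)) + r * (v ⬝ᵥ (M *ᵥ v)) := by
    have : 2 * (v ⬝ᵥ (M *ᵥ u)) = 1 / r * (2 * r * (v ⬝ᵥ (M *ᵥ u))) := by field_simp
    rw [this]
    have h3 : r * (v ⬝ᵥ (M *ᵥ v)) = 1 / r * (r * (r * (v ⬝ᵥ (M *ᵥ v)))) := by field_simp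
    rw [h3, ← mul_add]
    refine mul_le_mul_of_nonneg_left ?_ (by positivity)
    linarith
  linarith

/-- Cauchy-Schwarz by induction: with parameter `r = m` in `quad_add_le` both coefficients become `m
+ 1`. -/
theorem quad_sum_range_le {n : ℕ} {M : Matrix (Fin n) (Fin n) ℝ} (hM : M.PosSemidef)
    (v : ℕ → Fin n → ℝ) (m : ℕ) :
    quad M (∑ l ∈ Finset.range m, v l) ≤ m * ∑ l ∈ Finset.range m, quad M (v l) := by
  induction m with
  | zero => simp [quad_zero]
  | succ m ih =>
    rw [Finset.sum_range_succ, Finset.sum_range_succ]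
    rcases Nat.eq_zero_or_pos m with rfl | hm
    · simp
    have hm' : (0 : ℝ) < m := by exact_mod_cast hm
    refine (quad_add_le hM _ _ hm').trans ?_
    calc _ ≤ (1 + 1 / (m : ℝ)) * (m * ∑ l ∈ Finset.range m, quad M (v l))
          + (1 + m) * quad M (v m) := by gcongr
      _ = _ := by push_cast; field_simp; ring

/-- `∑_i |√Q_i C_i (u - v)|²`. -/
def outputGap (sys : HybridSystem n q N p) (d : Decision n p) (u v : Fin n → ℝ) : ℝ :=
  ∑ i, quad (d.Q i) (sys.C i *ᵥ (u - v))

theorem outputGap_nonneg {sys : HybridSystem n q N p} {d : Decision n p}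
    (hQ : ∀ i, (d.Q i).PosDef) (u v : Fin n → ℝ) : 0 ≤ outputGap sys d u v :=
  Finset.sum_nonneg fun i _ => quad_nonneg (hQ i).posSemidef _

theorem quad_le_outputGap {sys : HybridSystem n q N p} {d : Decision n p}
    (hQ : ∀ i, (d.Q i).PosDef) (i : Fin N) (u v : Fin n → ℝ) :
    quad (d.Q i) (sys.C i *ᵥ (u - v)) ≤ outputGap sys d u v :=
  Finset.single_le_sum (f := fun i => quad (d.Q i) (sys.C i *ᵥ (u - v)))
    (fun i _ => quad_nonneg (hQ i).posSemidef _) (Finset.mem_univ i)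

theorem exp_mul_VG (sys : HybridSystem n q N p) (d : Decision n p) (ηm τM α : ℝ)
    (x : ℝ → Fin n → ℝ) (a t : ℝ) :
    Real.exp (2 * α * t) * VG sys d ηm τM α x a t = ∑ i, (τM - ηm) *
      ∫ s in a..t, Real.exp (2 * α * s) * quad (outputWeight sys d ηm τM α i) (deriv x s) := by
  rw [VG, Finset.mul_sum]
  refine Finset.sum_congr rfl fun i _ => ?_
  rw [mul_left_comm, exp_mul_integral]
  simp only [quad_outputWeight]

theorem VG_nonneg {sys : HybridSystem n q N p} {d : Decision n p} {ηm τM α : ℝ} (hN : 2 ≤ N)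
    (hτM : ηm < τM) (hQ : ∀ i, (d.Q i).PosDef) {x : ℝ → Fin n → ℝ} {a t : ℝ} (hat : a ≤ t) :
    0 ≤ VG sys d ηm τM α x a t := by
  refine Finset.sum_nonneg fun i _ => mul_nonneg (by linarith)
    (intervalIntegral.integral_nonneg hat fun s _ => mul_nonneg (Real.exp_pos _).le ?_)
  rw [← quad_outputWeight]
  exact quad_nonneg (outputWeight_posSemidef hN hQ i) _

/-- Moving the starting time of `V_G` from `u` to `v` releases a multiple of the output gap. -/
theorem VG_add_le {sys : HybridSystem n q N p} {d : Decision n p} {ηm τM α : ℝ} (hN : 2 ≤ N)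
    (hα : 0 ≤ α) (hQ : ∀ i, (d.Q i).PosDef) {x : ℝ → Fin n → ℝ} {L T u v t : ℝ}
    (hx : IsRegularOn x L T) (hu : L ≤ u) (huv : u ≤ v) (hvt : v ≤ t) (ht : t ≤ T)
    (hlen : v - u ≤ τM - ηm) :
    VG sys d ηm τM α x v t + ((N : ℝ) - 1) *
        Real.exp (2 * α * (τM + ((N : ℝ) - 2) * (τM - ηm) + u - t)) * outputGap sys d (x u) (x v)
      ≤ VG sys d ηm τM α x u t := by
  refine le_of_mul_le_mul_left ?_ (Real.exp_pos (2 * α * t))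
  rw [mul_add, exp_mul_VG, exp_mul_VG]
  have hE : Real.exp (2 * α * t) * (((N : ℝ) - 1) *
      Real.exp (2 * α * (τM + ((N : ℝ) - 2) * (τM - ηm) + u - t)) * outputGap sys d (x u) (x v))
      = ∑ i, Real.exp (2 * α * u) * quad (outputWeight sys d ηm τM α i) (x v - x u) := by
    rw [outputGap, Finset.mul_sum, Finset.mul_sum]
    refine Finset.sum_congr rfl fun i _ => ?_
    rw [quad_outputWeight, quad_G, ← neg_sub (x u), mulVec_neg, quad_neg]
    have : Real.exp (2 * α * t) *
        Real.exp (2 * α * (τM + ((N : ℝ) - 2) * (τM - ηm) + u - t)) =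
        Real.exp (2 * α * u) * Real.exp (2 * α * (τM + ((N : ℝ) - 2) * (τM - ηm))) := by
      rw [← Real.exp_add, ← Real.exp_add]; congr 1; ring
    linear_combination (((N : ℝ) - 1) * quad (d.Q i) (sys.C i *ᵥ (x u - x v))) * this
  rw [hE, ← Finset.sum_add_distrib]
  refine Finset.sum_le_sum fun i _ => ?_
  have hW := outputWeight_posSemidef (sys := sys) (ηm := ηm) (τM := τM) (α := α) hN hQ i
  rw [← intervalIntegral.integral_add_adjacent_intervals
    (hx.intervalIntegrable_exp_quad (outputWeight sys d ηm τM α i) hu huv (hvt.trans ht) (2 * α))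
    (hx.intervalIntegrable_exp_quad (outputWeight sys d ηm τM α i) (hu.trans huv) hvt ht (2 * α)),
    mul_add]
  -- Jensen on the released piece `[u, v]` leaves the weight `e^{2αu}` at its left end, and the
  -- factor `τM - ηm` in `V_G` is at least `v - u`.
  have h1 := hx.exp_mul_quad_sub_le hW hu huv (hvt.trans ht) (c := 2 * α) (by positivity)
  have h2 := mul_le_mul_of_nonneg_right hlen (intervalIntegral.integral_nonneg (μ := volume) huv
    fun s _ => mul_nonneg (Real.exp_pos (2 * α * s)).le (quad_nonneg hW (deriv x s)))
  linarith

theorem VG_antitone {sys : HybridSystem n q N p} {d : Decision n p} {ηm τM α : ℝ} (hN : 2 ≤ N)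
    (hτM : ηm < τM) (hQ : ∀ i, (d.Q i).PosDef) {x : ℝ → Fin n → ℝ} {L T u v t : ℝ}
    (hx : IsRegularOn x L T) (hu : L ≤ u) (huv : u ≤ v) (hvt : v ≤ t) (ht : t ≤ T) :
    VG sys d ηm τM α x v t ≤ VG sys d ηm τM α x u t := by
  refine le_of_mul_le_mul_left ?_ (Real.exp_pos (2 * α * t))
  rw [exp_mul_VG, exp_mul_VG]
  refine Finset.sum_le_sum fun i _ => ?_
  have hW := outputWeight_posSemidef (sys := sys) (ηm := ηm) (τM := τM) (α := α) hN hQ i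
  rw [← intervalIntegral.integral_add_adjacent_intervals
    (hx.intervalIntegrable_exp_quad (outputWeight sys d ηm τM α i) hu huv (hvt.trans ht) (2 * α))
    (hx.intervalIntegrable_exp_quad (outputWeight sys d ηm τM α i) (hu.trans huv) hvt ht (2 * α))]
  refine mul_le_mul_of_nonneg_left (le_add_of_nonneg_left ?_) (by linarith)
  exact intervalIntegral.integral_nonneg huv fun s _ =>
    mul_nonneg (Real.exp_pos _).le (quad_nonneg hW _)

theorem Sampling.s_succ_sub_le {ηm τM : ℝ} (S : Sampling ηm τM) (k : ℕ) :
    S.s (k + 1) - S.s k ≤ τM - ηm := by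
  have := S.s_le_t_sub (k + 1)
  have := S.t_succ_sub_le k
  linarith

theorem Sampling.s_le_succ {ηm τM : ℝ} (S : Sampling ηm τM) (k : ℕ) : S.s k ≤ S.s (k + 1) :=
  S.s_strictMono.monotone k.le_succ

theorem Sampling.s_le_t {ηm τM : ℝ} (hηm : 0 ≤ ηm) (S : Sampling ηm τM) (k : ℕ) :
    S.s k ≤ S.t k := by
  have := S.s_le_t_sub k
  linarith

/-- The total output gap between the samples `k` and `k + 1`. -/
def sampleGap (sys : HybridSystem n q N p) (d : Decision n p) {ηm τM : ℝ} (S : Sampling ηm τM)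
    (x : ℝ → Fin n → ℝ) (k : ℕ) : ℝ :=
  outputGap sys d (x (S.s k)) (x (S.s (k + 1)))

/-- Change of the functional when the starting time passes from `s_k` to `s_{k+1}`. -/
theorem functional_jump {sys : HybridSystem n q N p} {d : Decision n p} {ηm τM α : ℝ} (hN : 2 ≤ N)
    (hηm : 0 ≤ ηm) (hα : 0 ≤ α) (hQ : ∀ i, (d.Q i).PosDef)
    {S : Sampling ηm τM} {x : ℝ → Fin n → ℝ} (k j : ℕ) (hkj : k + 1 ≤ j)
    (hx : ∀ T, S.t 0 ≤ T → IsRegularOn x (S.t 0 - τM) T) :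
    functional sys d ηm τM α x (S.s (k + 1)) (S.t j) + ((N : ℝ) - 1) *
        Real.exp (2 * α * (((N : ℝ) - 2) - ((j : ℝ) - (k + 1))) * (τM - ηm)) *
        sampleGap sys d S x k
      ≤ functional sys d ηm τM α x (S.s k) (S.t j) := by
  have hN' : (2 : ℝ) ≤ N := by exact_mod_cast hN
  have h1 := VG_add_le (α := α) (sys := sys) hN hα hQ
    (hx _ (S.monotone_t (Nat.zero_le j))) (S.t_zero_sub_le_s k)
    (S.s_le_succ k) ((S.s_le_t hηm (k + 1)).trans (S.monotone_t hkj)) le_rfl (S.s_succ_sub_le k)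
  -- Compares exponents: `t_{k+1} - s_k ≤ τM`, and each of the `j - (k + 1)` later intervals has
  -- length at most `τM - ηm`. The exponent built into `G` is chosen to survive `N - 2` such
  -- intervals.
  have h2 : Real.exp (2 * α * (((N : ℝ) - 2) - ((j : ℝ) - (k + 1))) * (τM - ηm)) ≤
      Real.exp (2 * α * (τM + ((N : ℝ) - 2) * (τM - ηm) + S.s k - S.t j)) := by
    rw [Real.exp_le_exp, mul_assoc]
    gcongr
    obtain ⟨m, rfl⟩ := Nat.exists_eq_add_of_le hkj
    have h3 := S.t_succ_sub_le k
    have h4 := S.t_le_add (k + 1) m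
    push_cast
    linarith
  have h3 : ((N : ℝ) - 1) *
        Real.exp (2 * α * (((N : ℝ) - 2) - ((j : ℝ) - (k + 1))) * (τM - ηm)) *
        sampleGap sys d S x k ≤ ((N : ℝ) - 1) *
        Real.exp (2 * α * (τM + ((N : ℝ) - 2) * (τM - ηm) + S.s k - S.t j)) *
        outputGap sys d (x (S.s k)) (x (S.s (k + 1))) := by
    refine mul_le_mul_of_nonneg_right (mul_le_mul_of_nonneg_left h2 (by linarith))
      (outputGap_nonneg hQ _ _)
  unfold functional
  linarith

theorem IsSolution.error_succ_active {sys : HybridSystem n q N p} {ηm τM : ℝ}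
    {S : Sampling ηm τM} {istar : ℕ → Fin N} {ω : ℝ → Fin q → ℝ} {x : ℝ → Fin n → ℝ}
    {e : ℕ → ∀ i : Fin N, Fin (p i) → ℝ} (h : IsSolution sys S istar ω x e) (k : ℕ) :
    e (k + 1) (istar k) = sys.C (istar k) *ᵥ (x (S.s k) - x (S.s (k + 1))) := by
  rw [h.reset_active, S.t_sub_η, S.t_sub_η]

theorem IsSolution.error_succ_inactive {sys : HybridSystem n q N p} {ηm τM : ℝ}
    {S : Sampling ηm τM} {istar : ℕ → Fin N} {ω : ℝ → Fin q → ℝ} {x : ℝ → Fin n → ℝ}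
    {e : ℕ → ∀ i : Fin N, Fin (p i) → ℝ} (h : IsSolution sys S istar ω x e) {k : ℕ} {i : Fin N}
    (hi : istar k ≠ i) :
    e (k + 1) i = e k i + sys.C i *ᵥ (x (S.s k) - x (S.s (k + 1))) := by
  rw [h.reset_inactive k i hi.symm, S.t_sub_η, S.t_sub_η]

/-- An active node forgets its previous error, so until it is active again its error only
accumulates the output differences since that reset. -/
theorem IsSolution.error_eq_sum {sys : HybridSystem n q N p} {ηm τM : ℝ}
    {S : Sampling ηm τM} {istar : ℕ → Fin N} {ω : ℝ → Fin q → ℝ} {x : ℝ → Fin n → ℝ}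
    {e : ℕ → ∀ i : Fin N, Fin (p i) → ℝ} (h : IsSolution sys S istar ω x e) (k m : ℕ)
    (hm : ∀ l, k < l → l < k + (m + 1) → istar l ≠ istar k) :
    e (k + (m + 1)) (istar k) = ∑ l ∈ Finset.range (m + 1),
      sys.C (istar k) *ᵥ (x (S.s (k + l)) - x (S.s (k + l + 1))) := by
  induction m with
  | zero => simpa using h.error_succ_active k
  | succ m ih =>
    rw [Finset.sum_range_succ, ← ih fun l hl hl' => hm l hl (by omega), ← add_assoc]
    exact h.error_succ_inactive (hm _ (by omega) (by omega))

/-- Distinct nodes among the first `N` indices exhaust `Fin N`, so `j = istar a` for some `a < N`.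
The shift `m` is chosen so that `k - m ≡ a` modulo `N`; `k ≥ N - 1` keeps the subtraction genuine.
-/
theorem RR.exists_eq {istar : ℕ → Fin N} {e : ℕ → ∀ i : Fin N, Fin (p i) → ℝ}
    (h : RR p istar e) {k : ℕ} (hk : N - 1 ≤ k) (j : Fin N) : ∃ m < N, istar (k - m) = j := by
  have hinj : Function.Injective fun a : Fin N => istar a := by
    intro a b hab
    by_contra hne
    rcases lt_or_gt_of_ne hne with hlt | hlt
    · exact h.2 a b hlt (by omega) hab
    · exact h.2 b a hlt (by omega) hab.symm
  obtain ⟨a, ha⟩ := (Finite.injective_iff_surjective.1 hinj) j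
  have hper : ∀ w : ℕ, istar (a + N * w) = istar a := by
    intro w
    induction w with
    | zero => simp
    | succ w ih => rw [← ih, h.1 (a + N * w), Nat.mul_succ, add_assoc]
  have hN : 0 < N := j.pos
  have ha' := a.isLt
  have hmod : (k + N - a) % N < N := Nat.mod_lt _ hN
  refine ⟨(k + N - a) % N, hmod, ?_⟩
  have hdiv := Nat.div_add_mod (k + N - a) N
  generalize (k + N - a) / N = z at hdiv
  have hz : 1 ≤ z := by
    by_contra hz
    have : z = 0 := by omega
    rw [this] at hdiv
    omega
  obtain ⟨w, hw⟩ := Nat.exists_eq_add_of_le hz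
  have h2 : k - (k + N - a) % N = a + N * w := by
    rw [hw, Nat.mul_add, Nat.mul_one] at hdiv
    omega
  rw [h2, hper]
  exact ha

/-- Under Round-Robin the error of an inactive node is controlled by the last `N - 1` samples. -/
theorem IsSolution.quad_error_le {sys : HybridSystem n q N p} {ηm τM : ℝ}
    {S : Sampling ηm τM} {istar : ℕ → Fin N} {ω : ℝ → Fin q → ℝ} {x : ℝ → Fin n → ℝ}
    {e : ℕ → ∀ i : Fin N, Fin (p i) → ℝ} (h : IsSolution sys S istar ω x e)
    (hrr : RR p istar e) {d : Decision n p} (hQ : ∀ i, (d.Q i).PosDef) {k : ℕ} (hk : N - 1 ≤ k)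
    {j : Fin N} (hj : j ≠ istar k) :
    quad (d.Q j) (e k j) ≤ ((N : ℝ) - 1) * ∑ r ∈ Finset.Ico 1 N,
      quad (d.Q j) (sys.C j *ᵥ (x (S.s (k - r)) - x (S.s (k - r + 1)))) := by
  classical
  -- `k - m` is the last time node `j` was active, so no reset of `j` lies between it and `k`; `m ≠
  -- 0` because `j` is inactive at `k`.
  obtain ⟨m, hmN, hmj, hmin⟩ : ∃ m < N, istar (k - m) = j ∧ ∀ r < m, istar (k - r) ≠ j := by
    have hex := RR.exists_eq hrr hk j
    obtain ⟨hmN, hmj⟩ := Nat.find_spec hex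
    exact ⟨_, hmN, hmj, fun r hr hr' => Nat.find_min hex hr ⟨hr.trans hmN, hr'⟩⟩
  have hm0 : m ≠ 0 := by
    intro h0
    rw [h0, Nat.sub_zero] at hmj
    exact hj hmj.symm
  obtain ⟨m', hm'⟩ := Nat.exists_eq_succ_of_ne_zero hm0
  subst hmj
  have hsum := h.error_eq_sum (k - m) m' (fun l hl hl' => by
    have := hmin (k - l) (by omega)
    rwa [show k - (k - l) = l by omega] at this)
  rw [show k - m + (m' + 1) = k by omega] at hsum
  rw [hsum]
  refine (quad_sum_range_le (hQ _).posSemidef _ _).trans ?_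
  have hq : ∀ l, 0 ≤ quad (d.Q (istar (k - m)))
      (sys.C (istar (k - m)) *ᵥ (x (S.s l) - x (S.s (l + 1)))) := fun l =>
    quad_nonneg (hQ _).posSemidef _
  have hcast : ((m' + 1 : ℕ) : ℝ) ≤ (N : ℝ) - 1 := by
    have : m' + 1 + 1 ≤ N := by omega
    have : ((m' + 1 + 1 : ℕ) : ℝ) ≤ N := by exact_mod_cast this
    push_cast at this ⊢
    linarith
  refine mul_le_mul hcast ?_ (Finset.sum_nonneg fun l _ => hq _) ((Nat.cast_nonneg _).trans hcast)
  have hre : ∑ l ∈ Finset.range (m' + 1), quad (d.Q (istar (k - m)))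
      (sys.C (istar (k - m)) *ᵥ (x (S.s (k - m + l)) - x (S.s (k - m + l + 1))))
      = ∑ r ∈ Finset.Ico 1 (m' + 2), quad (d.Q (istar (k - m)))
      (sys.C (istar (k - m)) *ᵥ (x (S.s (k - r)) - x (S.s (k - r + 1)))) := by
    rw [Finset.sum_Ico_eq_sum_range, ← Finset.sum_range_reflect]
    refine Finset.sum_congr (by congr 1) fun l hl => ?_
    rw [Finset.mem_range] at hl
    rw [show k - m + (m' + 1 - 1 - l) = k - (1 + l) by omega]
  rw [hre]
  exact Finset.sum_le_sum_of_subset_of_nonneg (Finset.Ico_subset_Ico_right (by omega))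
    fun r _ _ => hq _

theorem IsSolution.sum_quad_error_le {sys : HybridSystem n q N p} {ηm τM : ℝ} (hN : 2 ≤ N)
    {S : Sampling ηm τM} {istar : ℕ → Fin N} {ω : ℝ → Fin q → ℝ} {x : ℝ → Fin n → ℝ}
    {e : ℕ → ∀ i : Fin N, Fin (p i) → ℝ} (h : IsSolution sys S istar ω x e)
    (hrr : RR p istar e) {d : Decision n p} (hQ : ∀ i, (d.Q i).PosDef) {k : ℕ}
    (hk : N - 1 ≤ k) :
    (∑ j ∈ Finset.univ.erase (istar k), quad (d.Q j) (e k j)) / ((N : ℝ) - 1) ≤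
      ∑ r ∈ Finset.Ico 1 N, sampleGap sys d S x (k - r) := by
  have hN' : (2 : ℝ) ≤ N := by exact_mod_cast hN
  rw [div_le_iff₀ (by linarith), mul_comm]
  unfold sampleGap outputGap
  rw [Finset.sum_comm, Finset.mul_sum]
  refine (Finset.sum_le_sum fun j hj => h.quad_error_le hrr hQ hk
    (Finset.ne_of_mem_erase hj)).trans ?_
  refine Finset.sum_le_sum_of_subset_of_nonneg (Finset.erase_subset _ _) fun j _ _ => ?_
  exact mul_nonneg (by linarith) (Finset.sum_nonneg fun r _ => quad_nonneg (hQ j).posSemidef _)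

end

/-! ### Decay across updating instants -/

section
variable {n q N : ℕ} {p : Fin N → ℕ}

theorem exp_decay_iterate {W t : ℕ → ℝ} {c β : ℝ} {k₀ k : ℕ} (hk : k₀ ≤ k)
    (h : ∀ j, k₀ ≤ j → j < k → W (j + 1) - β ≤ Real.exp (c * (t (j + 1) - t j)) * (W j - β)) :
    W k - β ≤ Real.exp (c * (t k - t k₀)) * (W k₀ - β) := by
  induction k, hk using Nat.le_induction with
  | base => simp
  | succ k hk ih =>
    refine (h k hk k.lt_succ_self).trans ?_
    refine (mul_le_mul_of_nonneg_left (ih fun j hj hj' => h j hj (hj'.trans k.lt_succ_self))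
      (Real.exp_pos _).le).trans (le_of_eq ?_)
    rw [← mul_assoc, ← Real.exp_add]
    congr 2; ring

theorem exp_decay_final {V₁ V₂ V₀ t t₁ t₀ α β : ℝ} (hβ : 0 ≤ β)
    (h : V₁ - β ≤ Real.exp (-2 * α * (t - t₁)) * (V₂ - β))
    (h' : V₂ - β ≤ Real.exp (-2 * α * (t₁ - t₀)) * (V₀ - β)) :
    V₁ ≤ Real.exp (-2 * α * (t - t₀)) * V₀ + β := by
  have h1 := h.trans (mul_le_mul_of_nonneg_left h' (Real.exp_pos _).le)
  rw [← mul_assoc, ← Real.exp_add] at h1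
  have : -2 * α * (t - t₁) + -2 * α * (t₁ - t₀) = -2 * α * (t - t₀) := by ring
  rw [this] at h1
  have h2 := mul_nonneg (Real.exp_pos (-2 * α * (t - t₀))).le hβ
  linarith

/-- The bound for two nodes, for protocols under which the errors of the inactive nodes never
exceed the error of the node that has just been reset. -/
theorem functional_le_of_two {sys : HybridSystem n q N p} {d : Decision n p} {ηm τM α : ℝ}
    (hN : N = 2) (hηm : 0 ≤ ηm) (hτM : ηm < τM) (hα : 0 < α)
    (hd : SatisfiesLMIs sys d ηm τM α) {S : Sampling ηm τM} {istar : ℕ → Fin N}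
    {ω : ℝ → Fin q → ℝ} {x : ℝ → Fin n → ℝ} {e : ℕ → ∀ i : Fin N, Fin (p i) → ℝ}
    (hsol : IsSolution sys S istar ω x e)
    (hx : ∀ T, S.t 0 ≤ T → IsRegularOn x (S.t 0 - τM) T)
    (hprot : ∀ k, ∑ j ∈ Finset.univ.erase (istar (k + 1)), quad (d.Q j) (e (k + 1) j) ≤
      quad (d.Q (istar k)) (e (k + 1) (istar k))) {k : ℕ} {t Δ : ℝ}
    (ht : t ∈ Icc (S.t k) (S.t (k + 1)))
    (hω : ∀ᵐ s : ℝ, s ∈ Icc (S.t 0) t → eNorm (ω s) ≤ Δ) :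
    functional sys d ηm τM α x (S.s k) t ≤ Real.exp (-2 * α * (t - S.t 0)) *
      (functional sys d ηm τM α x (S.s 0) (S.t 0) + ∑ i, quad (d.Q i) (e 0 i))
        + d.b / (2 * α) * Δ ^ 2 := by
  have hN2 : 2 ≤ N := hN.ge
  have hN1 : (N : ℝ) - 1 = 1 := by rw [hN]; norm_num
  have hQn : ∀ k j, 0 ≤ quad (d.Q j) (e k j) := fun k j =>
    quad_nonneg (hd.Q_pos j).posSemidef _
  set β := d.b / (2 * α) * Δ ^ 2 with hβdef
  have hβ : 0 ≤ β := mul_nonneg (div_nonneg hd.b_pos.le (by positivity)) (sq_nonneg _)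
  -- For `N = 2` the surplus in `functional_step` is exactly the sum of inactive errors, which is
  -- therefore added to `V`.
  set W : ℕ → ℝ := fun k => functional sys d ηm τM α x (S.s k) (S.t k)
    + ∑ j ∈ Finset.univ.erase (istar k), quad (d.Q j) (e k j) with hW
  have step : ∀ j r, r ∈ Icc (S.t j) (S.t (j + 1)) → r ≤ t →
      functional sys d ηm τM α x (S.s j) r - β ≤
        Real.exp (-2 * α * (r - S.t j)) * (W j - β) := by
    intro j r hr hrt
    have := functional_step (k := j) (a := S.s j) hN2 hηm hτM hα hd hsol hx hr
      (S.t_zero_sub_le_s j) (S.s_le_t hηm j) (Δ := Δ) (by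
        filter_upwards [hω] with s hs hs' using hs ⟨hs'.1, hs'.2.trans hrt⟩)
    rw [hN1, div_one] at this
    rw [hW]
    convert this using 2
    ring
  have hiter := exp_decay_iterate (W := W) (t := S.t) (c := -2 * α) (β := β) (Nat.zero_le k)
    fun j _ hj => by
      have h1 := step j (S.t (j + 1)) ⟨S.t_le_succ j, le_rfl⟩ ((S.monotone_t hj).trans ht.1)
      -- With `N = 2` and the jump taken at `t_{j+1}`, the exponent vanishes and the released
      -- multiple of the gap is exactly one.
      have h2 := functional_jump (sys := sys) hN2 hηm hα.le hd.Q_pos j (j + 1) le_rfl hx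
      have h3 : quad (d.Q (istar j)) (e (j + 1) (istar j)) ≤ sampleGap sys d S x j := by
        rw [hsol.error_succ_active]
        exact quad_le_outputGap hd.Q_pos _ _ _
      have h4 : (N : ℝ) - 2 = 0 := by linarith
      rw [hN1, h4] at h2
      push_cast at h2
      simp only [sub_self, mul_zero, zero_mul, Real.exp_zero, one_mul] at h2
      have h5 := hprot j
      change functional sys d ηm τM α x (S.s (j + 1)) (S.t (j + 1)) + _ - β ≤ _
      linarith
  have hW0 : W 0 ≤ functional sys d ηm τM α x (S.s 0) (S.t 0) + ∑ i, quad (d.Q i) (e 0 i) := by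
    rw [hW]
    exact add_le_add le_rfl (Finset.sum_le_sum_of_subset_of_nonneg (Finset.erase_subset _ _)
      fun j _ _ => hQn 0 j)
  refine (exp_decay_final hβ (step k t ht le_rfl) hiter).trans ?_
  gcongr

theorem RR.sum_erase_le {d : Decision n p} (hN : N = 2) {istar : ℕ → Fin N}
    {e : ℕ → ∀ i : Fin N, Fin (p i) → ℝ} (h : RR p istar e) (k : ℕ) :
    ∑ j ∈ Finset.univ.erase (istar (k + 1)), quad (d.Q j) (e (k + 1) j) ≤
      quad (d.Q (istar k)) (e (k + 1) (istar k)) := by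
  subst hN
  have hne : istar (k + 1) ≠ istar k := by
    induction k with
    | zero => exact (h.2 0 1 one_pos (by simp)).symm
    | succ k ih => rw [← h.1 k]; exact ih.symm
  have : Finset.univ.erase (istar (k + 1)) = {istar k} := by
    ext j; simp; omega
  rw [this, Finset.sum_singleton]

/-- If the active node changes, the only inactive node is the one just reset. If it does not, the
node just reset is active, and TOD says that its error is the largest. -/
theorem TOD.sum_erase_le {d : Decision n p} (hN : N = 2) {istar : ℕ → Fin N}
    {e : ℕ → ∀ i : Fin N, Fin (p i) → ℝ} (h : TOD d.Q istar e) (k : ℕ) :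
    ∑ j ∈ Finset.univ.erase (istar (k + 1)), quad (d.Q j) (e (k + 1) j) ≤
      quad (d.Q (istar k)) (e (k + 1) (istar k)) := by
  subst hN
  obtain ⟨j, hj⟩ : ∃ j, Finset.univ.erase (istar (k + 1)) = {j} := by
    rw [← Finset.card_eq_one]; simp
  rw [hj, Finset.sum_singleton]
  by_cases hk : istar k = istar (k + 1)
  · rw [hk]; exact h (k + 1) j
  · have : istar k ∈ Finset.univ.erase (istar (k + 1)) := by simp [hk]
    rw [hj, Finset.mem_singleton] at this
    rw [this]

/-- The Round-Robin bound from `t_{N-1}` on; `V_G` starts at `s_k`, and at `s_0` while `k < N`. -/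
theorem functional_le_of_roundRobin {sys : HybridSystem n q N p} {d : Decision n p}
    {ηm τM α : ℝ} (hN : 2 ≤ N) (hηm : 0 ≤ ηm) (hτM : ηm < τM) (hα : 0 < α)
    (hd : SatisfiesLMIs sys d ηm τM α) {S : Sampling ηm τM} {istar : ℕ → Fin N}
    {ω : ℝ → Fin q → ℝ} {x : ℝ → Fin n → ℝ} {e : ℕ → ∀ i : Fin N, Fin (p i) → ℝ}
    (hsol : IsSolution sys S istar ω x e)
    (hx : ∀ T, S.t 0 ≤ T → IsRegularOn x (S.t 0 - τM) T) (hrr : RR p istar e)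
    {k : ℕ} (hk : N - 1 ≤ k) {t Δ : ℝ} (ht : t ∈ Icc (S.t k) (S.t (k + 1)))
    (hω : ∀ᵐ s : ℝ, s ∈ Icc (S.t 0) t → eNorm (ω s) ≤ Δ) :
    functional sys d ηm τM α x (if N ≤ k then S.s k else S.s 0) t ≤
      Real.exp (-2 * α * (t - S.t (N - 1))) *
        (functional sys d ηm τM α x (S.s 0) (S.t (N - 1)) + ∑ i, quad (d.Q i) (e (N - 1) i))
        + d.b / (2 * α) * Δ ^ 2 := by
  have hN' : (2 : ℝ) ≤ N := by exact_mod_cast hN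
  have hh : 0 < τM - ηm := by linarith
  have hQn : ∀ k j, 0 ≤ quad (d.Q j) (e k j) := fun k j =>
    quad_nonneg (hd.Q_pos j).posSemidef _
  have hDn : ∀ k, 0 ≤ sampleGap sys d S x k := fun k => outputGap_nonneg hd.Q_pos _ _
  set β := d.b / (2 * α) * Δ ^ 2 with hβdef
  have hβ : 0 ≤ β := mul_nonneg (div_nonneg hd.b_pos.le (by positivity)) (sq_nonneg _)
  set a : ℕ → ℝ := fun k => if N ≤ k then S.s k else S.s 0 with ha
  have ha1 : ∀ k, S.t 0 - τM ≤ a k := by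
    intro k; simp only [ha]; split_ifs <;> exact S.t_zero_sub_le_s _
  have ha2 : ∀ k, a k ≤ S.t k := by
    intro k; simp only [ha]; split_ifs
    · exact S.s_le_t hηm k
    · exact (S.s_strictMono.monotone (Nat.zero_le k)).trans (S.s_le_t hηm k)
  set u : ℕ → ℝ := fun k =>
    (∑ j ∈ Finset.univ.erase (istar k), quad (d.Q j) (e k j)) / ((N : ℝ) - 1) with hu
  have step : ∀ j r, r ∈ Icc (S.t j) (S.t (j + 1)) → r ≤ t →
      functional sys d ηm τM α x (a j) r - β ≤
        Real.exp (-2 * α * (r - S.t j)) *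
          (functional sys d ηm τM α x (a j) (S.t j) - β + u j) := by
    intro j r hr hrt
    exact functional_step (k := j) (a := a j) hN hηm hτM hα hd hsol hx hr
      (ha1 j) (ha2 j) (Δ := Δ) (by
        filter_upwards [hω] with s hs hs' using hs ⟨hs'.1, hs'.2.trans hrt⟩)
  -- Weight of a gap of age `r`. `c 1` is the amount released at a jump, `c N = 0` lets the oldest
  -- gap disappear, and `c (r + 1) ≤ e^{-2αh} (c r - 1)` with `h = τM - ηm` means that ageing pays
  -- one unit of each gap, which covers `u`, as well as the decay.
  set c : ℕ → ℝ := fun r => ((N : ℝ) - r) *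
    Real.exp (2 * α * ((N : ℝ) - 1 - r) * (τM - ηm)) with hc
  have hcle : ∀ r ∈ Finset.Ico 1 N, 1 ≤ c r := by
    intro r hr
    rw [Finset.mem_Ico] at hr
    have h1 : (r : ℝ) + 1 ≤ N := by exact_mod_cast hr.2
    have h2 : 1 ≤ Real.exp (2 * α * ((N : ℝ) - 1 - r) * (τM - ηm)) :=
      Real.one_le_exp (mul_nonneg (mul_nonneg (by linarith) (by linarith)) hh.le)
    exact one_le_mul_of_one_le_of_one_le (by linarith) h2
  have hcdec : ∀ j, ∀ r ∈ Finset.Ico 1 N,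
      c (r + 1) ≤ Real.exp (-2 * α * (S.t (j + 1) - S.t j)) * (c r - 1) := by
    intro j r hr
    have hcr := hcle r hr
    rw [Finset.mem_Ico] at hr
    have h1 : (r : ℝ) + 1 ≤ N := by exact_mod_cast hr.2
    have h3 : Real.exp (-(2 * α * (τM - ηm))) ≤ Real.exp (-2 * α * (S.t (j + 1) - S.t j)) := by
      rw [Real.exp_le_exp]
      have := S.t_succ_le_add j
      nlinarith
    refine le_trans ?_ (mul_le_mul_of_nonneg_right h3 (by linarith))
    have h2 : 1 ≤ Real.exp (2 * α * ((N : ℝ) - 1 - r) * (τM - ηm)) :=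
      Real.one_le_exp (mul_nonneg (mul_nonneg (by linarith) (by linarith)) hh.le)
    have h4 : c (r + 1) = Real.exp (-(2 * α * (τM - ηm))) *
        (((N : ℝ) - 1 - r) * Real.exp (2 * α * ((N : ℝ) - 1 - r) * (τM - ηm))) := by
      have h5 : Real.exp (2 * α * ((N : ℝ) - 1 - (r + 1)) * (τM - ηm)) =
          Real.exp (-(2 * α * (τM - ηm))) * Real.exp (2 * α * ((N : ℝ) - 1 - r) * (τM - ηm)) := by
        rw [← Real.exp_add]; congr 1; ring
      simp only [hc]
      push_cast
      rw [h5]; ring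
    rw [h4]
    refine mul_le_mul_of_nonneg_left ?_ (Real.exp_pos _).le
    simp only [hc]
    linarith
  -- At `k = N - 1` nothing of `V_G` has yet been released, so the surplus `u` itself is carried
  -- instead of weighted gaps.
  set W : ℕ → ℝ := fun k => if N ≤ k then functional sys d ηm τM α x (a k) (S.t k)
      + ∑ r ∈ Finset.Ico 1 N, c r * sampleGap sys d S x (k - r)
    else functional sys d ηm τM α x (a k) (S.t k) + u k with hW
  have hW' : ∀ j, N - 1 ≤ j → functional sys d ηm τM α x (a j) (S.t j) + u j ≤ W j := by
    intro j hj
    simp only [hW]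
    split_ifs with hNj
    · gcongr
      refine (hsol.sum_quad_error_le hN hrr hd.Q_pos hj).trans (Finset.sum_le_sum fun r hr => ?_)
      exact le_mul_of_one_le_left (hDn _) (hcle r hr)
    · exact le_rfl
  have hiter := exp_decay_iterate (W := W) (t := S.t) (c := -2 * α) (β := β) hk
    fun j hj hjk => by
      have h1 := step j (S.t (j + 1)) ⟨S.t_le_succ j, le_rfl⟩ ((S.monotone_t hjk).trans ht.1)
      set ε := Real.exp (-2 * α * (S.t (j + 1) - S.t j)) with hε
      have hε0 : 0 < ε := Real.exp_pos _
      have hNj1 : N ≤ j + 1 := by omega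
      by_cases hNj : N ≤ j
      · have h2 := functional_jump (sys := sys) hN hηm hα.le hd.Q_pos j (j + 1) le_rfl hx
        have hWj : W j = functional sys d ηm τM α x (S.s j) (S.t j)
          + ∑ r ∈ Finset.Ico 1 N, c r * sampleGap sys d S x (j - r) := by
            simp only [hW, ha, if_pos hNj]
        have hWj1 : W (j + 1) = functional sys d ηm τM α x (S.s (j + 1)) (S.t (j + 1))
          + ∑ r ∈ Finset.Ico 1 N, c r * sampleGap sys d S x (j + 1 - r) := by
            simp only [hW, ha, if_pos hNj1]
        have haj : a j = S.s j := by simp only [ha, if_pos hNj]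
        rw [haj] at h1
        have hc1 : c 1 = ((N : ℝ) - 1) *
            Real.exp (2 * α * (((N : ℝ) - 2) - (((j + 1 : ℕ) : ℝ) - (j + 1))) * (τM - ηm)) := by
          simp only [hc]; push_cast; congr 2; ring
        rw [← hc1] at h2
        -- At the jump every recorded gap ages by one, the new gap enters with weight `c 1`, and the
        -- gap reaching age `N` has weight zero.
        have hshift : ∑ r ∈ Finset.Ico 1 N, c r * sampleGap sys d S x (j + 1 - r) ≤
            c 1 * sampleGap sys d S x j
              + ∑ r ∈ Finset.Ico 1 N, c (r + 1) * sampleGap sys d S x (j - r) := by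
          have h5 : ∑ r ∈ Finset.Ico 1 N, c (r + 1) * sampleGap sys d S x (j - r) =
              ∑ r ∈ Finset.Ico 2 (N + 1), c r * sampleGap sys d S x (j + 1 - r) := by
            rw [← Finset.sum_Ico_add' (fun r => c r * sampleGap sys d S x (j + 1 - r)) 1 N 1]
            refine Finset.sum_congr rfl fun r _ => ?_
            rw [Nat.add_sub_add_right]
          rw [h5, Finset.sum_eq_sum_Ico_succ_bot (by omega), Nat.add_sub_cancel,
            Finset.sum_Ico_succ_top (by omega)]
          have hcN : c N = 0 := by simp [hc]
          rw [hcN, zero_mul, add_zero]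
        have hsum : ∑ r ∈ Finset.Ico 1 N, c (r + 1) * sampleGap sys d S x (j - r) ≤
            ε * (∑ r ∈ Finset.Ico 1 N, c r * sampleGap sys d S x (j - r) - u j) := by
          have h6 := hsol.sum_quad_error_le (sys := sys) hN hrr hd.Q_pos hj
          calc _ ≤ ∑ r ∈ Finset.Ico 1 N, ε * (c r - 1) * sampleGap sys d S x (j - r) :=
                Finset.sum_le_sum fun r hr =>
                  mul_le_mul_of_nonneg_right (hcdec j r hr) (hDn _)
            _ = ε * (∑ r ∈ Finset.Ico 1 N, c r * sampleGap sys d S x (j - r)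
                - ∑ r ∈ Finset.Ico 1 N, sampleGap sys d S x (j - r)) := by
              rw [← Finset.sum_sub_distrib, Finset.mul_sum]
              exact Finset.sum_congr rfl fun r _ => by ring
            _ ≤ _ := by gcongr
        rw [hWj, hWj1]
        linarith
      · have hjN : j + 1 = N := by omega
        have haj : a j = S.s 0 := by simp only [ha, if_neg hNj]
        have hWj : W j = functional sys d ηm τM α x (S.s 0) (S.t j) + u j := by
            simp only [hW, ha, if_neg hNj]
        have hWj1 : W (j + 1) = functional sys d ηm τM α x (S.s N) (S.t N)
          + ∑ r ∈ Finset.Ico 1 N, c r * sampleGap sys d S x (N - r) := by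
            simp only [hW, ha, hjN, if_pos (le_refl N)]
        rw [haj] at h1
        -- The first jump moves the start of `V_G` from `s_0` to `s_N` at once. Going backwards from
        -- `s_N`, each sampling interval releases at least `c r` times its gap at time `t_N`.
        have hpay : ∀ m, m ≤ N - 1 → functional sys d ηm τM α x (S.s N) (S.t N)
            + ∑ r ∈ Finset.Ico 1 (m + 1), c r * sampleGap sys d S x (N - r) ≤
            functional sys d ηm τM α x (S.s (N - m)) (S.t N) := by
          intro m
          induction m with
          | zero => intro _; simp
          | succ m ih =>
            intro hm
            have ih' := ih (by omega)
            have h2 := functional_jump (sys := sys) hN hηm hα.le hd.Q_pos (N - (m + 1)) N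
              (by omega) hx
            rw [show N - (m + 1) + 1 = N - m by omega] at h2
            rw [Finset.sum_Ico_succ_top (by omega)]
            have hcm : c (m + 1) ≤ ((N : ℝ) - 1) * Real.exp (2 * α * (((N : ℝ) - 2) -
                ((N : ℝ) - (((N - (m + 1) : ℕ) : ℝ) + 1))) * (τM - ηm)) := by
              simp only [hc]
              rw [Nat.cast_sub (by omega : m + 1 ≤ N)]
              push_cast
              have hm0 := (Nat.cast_nonneg m : (0 : ℝ) ≤ m)
              refine mul_le_mul (by linarith) (le_of_eq ?_) (Real.exp_pos _).le (by linarith)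
              congr 1; ring
            have := mul_le_mul_of_nonneg_right hcm (hDn (N - (m + 1)))
            linarith
        have hpay1 := hpay (N - 1) le_rfl
        rw [show N - 1 + 1 = N by omega, show N - (N - 1) = 1 by omega] at hpay1
        -- Only the gaps of ages `1, …, N - 1` are needed, so the release over `[s_0, s_1]` is
        -- discarded.
        have hmono : functional sys d ηm τM α x (S.s 1) (S.t N) ≤
            functional sys d ηm τM α x (S.s 0) (S.t N) := by
          unfold functional
          gcongr
          exact VG_antitone hN hτM hd.Q_pos (hx _ (S.monotone_t (Nat.zero_le N)))
            (S.t_zero_sub_le_s 0) (S.s_le_succ 0)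
            ((S.s_le_t hηm 1).trans (S.monotone_t (by omega))) le_rfl
        rw [hWj, hWj1]
        rw [hε, hjN] at h1 ⊢
        linarith
  have hfin := step k t ht le_rfl
  have hfin' : functional sys d ηm τM α x (a k) t - β ≤
      Real.exp (-2 * α * (t - S.t k)) * (W k - β) := by
    refine hfin.trans (mul_le_mul_of_nonneg_left ?_ (Real.exp_pos _).le)
    linarith [hW' k hk]
  refine (exp_decay_final hβ hfin' hiter).trans ?_
  have hWN : W (N - 1) ≤ functional sys d ηm τM α x (S.s 0) (S.t (N - 1))
      + ∑ i, quad (d.Q i) (e (N - 1) i) := by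
    have : ¬ N ≤ N - 1 := by omega
    simp only [hW, ha, if_neg this]
    gcongr
    simp only [hu]
    refine (div_le_self (Finset.sum_nonneg fun j _ => hQn _ j) (by linarith)).trans ?_
    exact Finset.sum_le_sum_of_subset_of_nonneg (Finset.erase_subset _ _) fun j _ _ => hQn _ j
  gcongr

end

/-! ### From the functional to input-to-state stability -/

section
variable {n q N : ℕ} {p : Fin N → ℕ}

theorem Sampling.exists_mem_Icc {ηm τM : ℝ} (S : Sampling ηm τM) (hηm : 0 ≤ ηm) {k₀ : ℕ} {t : ℝ}
    (ht : S.t k₀ ≤ t) : ∃ k, k₀ ≤ k ∧ t ∈ Icc (S.t k) (S.t (k + 1)) := by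
  classical
  have hex := S.exists_lt_t hηm t
  have hlt : k₀ < Nat.find hex := by
    by_contra hle
    exact absurd (Nat.find_spec hex) (not_lt.2 ((S.monotone_t (not_lt.1 hle)).trans ht))
  obtain ⟨k, hk⟩ := Nat.exists_eq_succ_of_ne_zero (by omega : Nat.find hex ≠ 0)
  have h1 := Nat.find_spec hex
  have h2 := Nat.find_min hex (m := k) (by omega)
  rw [hk] at h1
  exact ⟨k, by omega, not_lt.1 h2, h1.le⟩

/-- The bound `Δ` makes the essential supremum finite; otherwise `toReal` would send it to `0`. -/
theorem ae_le_essSupNorm {ω : ℝ → Fin q → ℝ} {Δ a b : ℝ} (ha : 0 ≤ a)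
    (hω : IsDisturbance ω Δ) :
    ∀ᵐ s : ℝ, s ∈ Icc a b → eNorm (ω s) ≤ essSupNorm ω a b := by
  have hbound : ∀ᵐ s ∂(volume.restrict (Icc a b)), ‖eNorm (ω s)‖ ≤ Δ := by
    rw [ae_restrict_iff' measurableSet_Icc]
    filter_upwards [hω.2.2] with s hs h
    rw [Real.norm_of_nonneg (eNorm_nonneg _)]
    exact hs (ha.trans h.1)
  have hfin := eLpNormEssSup_lt_top_of_ae_bound hbound
  rw [← ae_restrict_iff' measurableSet_Icc]
  filter_upwards [enorm_ae_le_eLpNormEssSup (fun s => eNorm (ω s)) (volume.restrict (Icc a b))]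
    with s hs
  rw [essSupNorm, eLpNorm_exponent_top, ← Real.norm_of_nonneg (eNorm_nonneg (ω s)),
    ← toReal_enorm]
  exact ENNReal.toReal_mono hfin.ne hs

theorem quad_le_functional {sys : HybridSystem n q N p} {d : Decision n p} {ηm τM α : ℝ}
    (hN : 2 ≤ N) (hηm : 0 ≤ ηm) (hτM : ηm < τM) (hd : SatisfiesLMIs sys d ηm τM α)
    {x : ℝ → Fin n → ℝ} {a t : ℝ} (hat : a ≤ t) :
    quad d.P (x t) ≤ functional sys d ηm τM α x a t := by
  have hVG := VG_nonneg (sys := sys) (α := α) (x := x) hN hτM hd.Q_pos hat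
  have hI : ∀ {M : Matrix (Fin n) (Fin n) ℝ}, M.PosDef → ∀ (f : ℝ → Fin n → ℝ) {u v : ℝ},
      u ≤ v → 0 ≤ ∫ s in u..v, Real.exp (2 * α * (s - t)) * quad M (f s) :=
    fun hM f _ _ huv => intervalIntegral.integral_nonneg huv fun s _ =>
      mul_nonneg (Real.exp_pos _).le (quad_nonneg hM.posSemidef _)
  have h1 := hI hd.S₀_pos x (show t - ηm ≤ t by linarith)
  have h2 := hI hd.S₁_pos x (show t - τM ≤ t - ηm by linarith)
  have h3 : 0 ≤ ∫ θ in (-ηm)..0, ∫ s in (t + θ)..t,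
        Real.exp (2 * α * (s - t)) * quad d.R₀ (deriv x s) :=
    intervalIntegral.integral_nonneg (by linarith) fun θ hθ =>
      hI hd.R₀_pos _ (by linarith [hθ.2])
  have h4 : 0 ≤ ∫ θ in (-τM)..(-ηm), ∫ s in (t + θ)..t,
        Real.exp (2 * α * (s - t)) * quad d.R₁ (deriv x s) :=
    intervalIntegral.integral_nonneg (by linarith) fun θ hθ =>
      hI hd.R₁_pos _ (by linarith [hθ.2])
  have h3' := mul_nonneg hηm h3
  have h4' := mul_nonneg (by linarith : 0 ≤ τM - ηm) h4
  unfold functional Vtilde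
  linarith

theorem functional_nonneg {sys : HybridSystem n q N p} {d : Decision n p} {ηm τM α : ℝ}
    (hN : 2 ≤ N) (hηm : 0 ≤ ηm) (hτM : ηm < τM) (hd : SatisfiesLMIs sys d ηm τM α)
    {x : ℝ → Fin n → ℝ} {a t : ℝ} (hat : a ≤ t) :
    0 ≤ functional sys d ηm τM α x a t :=
  (quad_nonneg hd.P_pos.posSemidef _).trans (quad_le_functional hN hηm hτM hd hat)

/-- At the initial time the functional is bounded by the `W`-norm of the initial segment. -/
theorem exists_functional_le (sys : HybridSystem n q N p) (d : Decision n p) {ηm τM α : ℝ}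
    (hηm : 0 ≤ ηm) (hτM : ηm < τM) (hα : 0 ≤ α) :
    ∃ K > 0, ∀ (x : ℝ → Fin n → ℝ) (t₀ a : ℝ), MemW τM (segment x t₀) → t₀ - τM ≤ a → a ≤ t₀ →
      functional sys d ηm τM α x a t₀ ≤ K * normW τM (segment x t₀) ^ 2 := by
  choose c hc hcq using fun M : Matrix (Fin n) (Fin n) ℝ => exists_quad_le M
  have hh : 0 < τM - ηm := by linarith
  refine ⟨c d.P + c d.S₀ * ηm + c d.S₁ * (τM - ηm) + ηm * (c d.R₀ * ηm)
    + (τM - ηm) * (c d.R₁ * (τM - ηm))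
    + ∑ i, (τM - ηm) * c (outputWeight sys d ηm τM α i), ?_, fun x t₀ a hW ha hat => ?_⟩
  · have h1 := hc d.P
    have h2 := hc d.S₀
    have h3 := hc d.S₁
    have h4 := hc d.R₀
    have h5 := hc d.R₁
    have h6 : 0 ≤ ∑ i, (τM - ηm) * c (outputWeight sys d ηm τM α i) :=
      Finset.sum_nonneg fun i _ => mul_nonneg hh.le (hc _).le
    positivity
  have hreg := hW.isRegularOn (by linarith)
  set m := sSup ((fun θ => eNorm (segment x t₀ θ)) '' Icc (-τM) 0) with hm
  set I := ∫ θ in (-τM)..0, eNorm (deriv (segment x t₀) θ) ^ 2 with hI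
  have hnorm : normW τM (segment x t₀) = m + Real.sqrt I := rfl
  set Z := normW τM (segment x t₀) ^ 2 with hZ
  have hIn : 0 ≤ I := intervalIntegral.integral_nonneg (by linarith) fun _ _ => sq_nonneg _
  -- Needed because the real `sSup` in `normW` bounds its set only when the set is bounded; here
  -- continuity on a compact interval gives this.
  have hbdd : BddAbove ((fun θ => eNorm (segment x t₀ θ)) '' Icc (-τM) 0) := by
    have h1 := hW.1.continuousOn
    rw [uIcc_of_le (by linarith)] at h1
    exact (isCompact_Icc.image_of_continuousOn (continuous_eNorm.comp_continuousOn h1)).bddAbove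
  have hxm : ∀ s, t₀ - τM ≤ s → s ≤ t₀ → eNorm (x s) ≤ m := fun s hs hs' =>
    le_csSup hbdd ⟨s - t₀, ⟨by linarith, by linarith⟩, by simp [segment]⟩
  have hm0 : 0 ≤ m := (eNorm_nonneg _).trans (hxm t₀ (by linarith) le_rfl)
  have hmZ : m ^ 2 ≤ Z := by
    rw [hZ, hnorm]
    have := Real.sqrt_nonneg I
    gcongr
    linarith
  have hIZ : I ≤ Z := by
    rw [hZ, hnorm, ← Real.sq_sqrt hIn]
    have := Real.sqrt_nonneg I
    rw [Real.sqrt_sq this]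
    gcongr
    linarith
  have hxZ : ∀ M s, t₀ - τM ≤ s → s ≤ t₀ → |quad M (x s)| ≤ c M * Z := by
    intro M s hs hs'
    refine (hcq M _).trans (mul_le_mul_of_nonneg_left (le_trans ?_ hmZ) (hc M).le)
    exact pow_le_pow_left₀ (eNorm_nonneg _) (hxm s hs hs') 2
  have hexp : ∀ s, s ≤ t₀ → Real.exp (2 * α * (s - t₀)) ≤ 1 := fun s hs =>
    Real.exp_le_one_iff.2 (mul_nonpos_of_nonneg_of_nonpos (by positivity) (by linarith))
  have hpot : ∀ M u v, t₀ - τM ≤ u → u ≤ v → v ≤ t₀ →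
      ∫ s in u..v, Real.exp (2 * α * (s - t₀)) * quad M (x s) ≤ c M * (v - u) * Z := by
    intro M u v hu huv hv
    have := intervalIntegral.norm_integral_le_of_norm_le_const (a := u) (b := v) (C := c M * Z)
      (f := fun s => Real.exp (2 * α * (s - t₀)) * quad M (x s)) fun s hs => by
        rw [uIoc_of_le huv] at hs
        rw [norm_mul, Real.norm_of_nonneg (Real.exp_pos _).le]
        exact (mul_le_of_le_one_left (norm_nonneg _) (hexp s (hs.2.trans hv))).trans
          (hxZ M s (hu.trans hs.1.le) (hs.2.trans hv))
    rw [abs_of_nonneg (sub_nonneg.2 huv)] at this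
    exact (le_abs_self _).trans (this.trans (le_of_eq (by ring)))
  have hIx : ∫ s in (t₀ - τM)..t₀, eNorm (deriv x s) ^ 2 = I := by
    have hderiv : ∀ θ, deriv (segment x t₀) θ = deriv x (t₀ + θ) := fun θ =>
      deriv_comp_const_add x t₀ θ
    simp only [hI, hderiv]
    rw [intervalIntegral.integral_comp_add_left (fun s => eNorm (deriv x s) ^ 2)]
    simp [sub_eq_add_neg]
  have hsq : ∀ u, t₀ - τM ≤ u → u ≤ t₀ →
      IntervalIntegrable (fun s => eNorm (deriv x s) ^ 2) volume u t₀ := by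
    intro u hu hu'
    rw [intervalIntegrable_iff_integrableOn_Icc_of_le hu']
    exact hreg.sq_integrable.mono_set (Icc_subset_Icc_left hu)
  have hkin : ∀ M u, t₀ - τM ≤ u → u ≤ t₀ →
      |∫ s in u..t₀, Real.exp (2 * α * (s - t₀)) * quad M (deriv x s)| ≤ c M * Z := by
    intro M u hu hu'
    have h1 : |∫ s in u..t₀, Real.exp (2 * α * (s - t₀)) * quad M (deriv x s)| ≤
        ∫ s in u..t₀, c M * eNorm (deriv x s) ^ 2 := by
      rw [← Real.norm_eq_abs]
      refine intervalIntegral.norm_integral_le_of_norm_le hu' ?_ ((hsq u hu hu').const_mul _)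
      filter_upwards with s hs
      rw [norm_mul, Real.norm_of_nonneg (Real.exp_pos _).le]
      exact (mul_le_of_le_one_left (norm_nonneg _) (hexp s hs.2)).trans (hcq M _)
    refine h1.trans ?_
    rw [intervalIntegral.integral_const_mul]
    refine mul_le_mul_of_nonneg_left (le_trans ?_ hIZ) (hc M).le
    rw [← hIx]
    refine intervalIntegral.integral_mono_interval hu hu' le_rfl ?_ (hsq _ le_rfl (by linarith))
    exact Eventually.of_forall fun s => sq_nonneg _
  have hdbl : ∀ M θ₁ θ₂, -τM ≤ θ₁ → θ₁ ≤ θ₂ → θ₂ ≤ 0 →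
      ∫ θ in θ₁..θ₂, ∫ s in (t₀ + θ)..t₀, Real.exp (2 * α * (s - t₀)) * quad M (deriv x s) ≤
        c M * (θ₂ - θ₁) * Z := by
    intro M θ₁ θ₂ h₁ h₁₂ h₂
    have := intervalIntegral.norm_integral_le_of_norm_le_const (a := θ₁) (b := θ₂)
      (C := c M * Z) (f := fun θ => ∫ s in (t₀ + θ)..t₀,
        Real.exp (2 * α * (s - t₀)) * quad M (deriv x s)) fun θ hθ => by
        rw [uIoc_of_le h₁₂] at hθ
        exact hkin M _ (by linarith [hθ.1]) (by linarith [hθ.2])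
    rw [abs_of_nonneg (sub_nonneg.2 h₁₂)] at this
    exact (le_abs_self _).trans (this.trans (le_of_eq (by ring)))
  have e1 := (le_abs_self _).trans (hxZ d.P t₀ (by linarith) le_rfl)
  have e2 := hpot d.S₀ (t₀ - ηm) t₀ (by linarith) (by linarith) le_rfl
  have e3 := hpot d.S₁ (t₀ - τM) (t₀ - ηm) le_rfl (by linarith) (by linarith)
  have e4 := mul_le_mul_of_nonneg_left (hdbl d.R₀ (-ηm) 0 (by linarith) (by linarith) le_rfl) hηm
  have e5 := mul_le_mul_of_nonneg_left
    (hdbl d.R₁ (-τM) (-ηm) le_rfl (by linarith) (by linarith)) hh.le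
  have e6 : VG sys d ηm τM α x a t₀ ≤
      (∑ i, (τM - ηm) * c (outputWeight sys d ηm τM α i)) * Z := by
    rw [VG, Finset.sum_mul]
    refine Finset.sum_le_sum fun i _ => ?_
    rw [mul_assoc]
    refine mul_le_mul_of_nonneg_left ?_ hh.le
    simp only [← quad_outputWeight]
    exact (le_abs_self _).trans (hkin _ a ha hat)
  rw [sub_sub_cancel] at e2
  rw [sub_sub_sub_cancel_left] at e3
  rw [zero_sub, neg_neg] at e4
  rw [neg_sub_neg] at e5
  unfold functional Vtilde
  linarith

theorem exists_sum_quad_le (d : Decision n p) :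
    ∃ K > 0, ∀ e : ∀ i : Fin N, Fin (p i) → ℝ,
      ∑ i, quad (d.Q i) (e i) ≤ K * ∑ i, eNorm (e i) ^ 2 := by
  choose c hc hcq using fun i => exists_quad_le (d.Q i)
  have hs : 0 ≤ ∑ i, c i := Finset.sum_nonneg fun i _ => (hc i).le
  refine ⟨∑ i, c i + 1, by linarith, fun e => ?_⟩
  rw [Finset.mul_sum]
  refine Finset.sum_le_sum fun i _ => (le_abs_self _).trans ((hcq i _).trans ?_)
  refine mul_le_mul_of_nonneg_right ?_ (sq_nonneg _)
  have := Finset.single_le_sum (f := c) (fun i _ => (hc i).le) (Finset.mem_univ i)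
  linarith

/-- Growth of the functional and the errors from one updating instant to the next, with `V_G`
starting at `s_0`. -/
theorem functional_growth {sys : HybridSystem n q N p} {d : Decision n p}
    {ηm τM α : ℝ} (hN : 2 ≤ N) (hηm : 0 ≤ ηm) (hτM : ηm < τM) (hα : 0 < α)
    (hd : SatisfiesLMIs sys d ηm τM α) {S : Sampling ηm τM} {istar : ℕ → Fin N}
    {ω : ℝ → Fin q → ℝ} {x : ℝ → Fin n → ℝ} {e : ℕ → ∀ i : Fin N, Fin (p i) → ℝ}
    (hsol : IsSolution sys S istar ω x e)
    (hx : ∀ T, S.t 0 ≤ T → IsRegularOn x (S.t 0 - τM) T) {k : ℕ} {Δ : ℝ}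
    (hω : ∀ᵐ s : ℝ, s ∈ Icc (S.t 0) (S.t k) → eNorm (ω s) ≤ Δ) :
    functional sys d ηm τM α x (S.s 0) (S.t k) + ∑ i, quad (d.Q i) (e k i)
        + d.b / (2 * α) * Δ ^ 2 ≤
      5 ^ k * (functional sys d ηm τM α x (S.s 0) (S.t 0) + ∑ i, quad (d.Q i) (e 0 i)
        + d.b / (2 * α) * Δ ^ 2) := by
  have hN' : (2 : ℝ) ≤ N := by exact_mod_cast hN
  have hh : 0 < τM - ηm := by linarith
  have hQn : ∀ k j, 0 ≤ quad (d.Q j) (e k j) := fun k j =>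
    quad_nonneg (hd.Q_pos j).posSemidef _
  have hsk : ∀ k, S.s 0 ≤ S.t k := fun k =>
    (S.s_strictMono.monotone (Nat.zero_le k)).trans (S.s_le_t hηm k)
  set β := d.b / (2 * α) * Δ ^ 2 with hβdef
  have hβ : 0 ≤ β := mul_nonneg (div_nonneg hd.b_pos.le (by positivity)) (sq_nonneg _)
  induction k with
  | zero => simp
  | succ k ih =>
    have ih' := ih (by
      filter_upwards [hω] with s hs hs' using hs ⟨hs'.1, hs'.2.trans (S.t_le_succ k)⟩)
    have hstep := functional_step (k := k) (a := S.s 0) hN hηm hτM hα hd hsol hx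
      ⟨S.t_le_succ k, le_rfl⟩ (S.t_zero_sub_le_s 0) (hsk k) hω
    rw [← hβdef] at hstep
    set u := (∑ j ∈ Finset.univ.erase (istar k), quad (d.Q j) (e k j)) / ((N : ℝ) - 1) with hu
    set r := Real.exp (-2 * α * (S.t (k + 1) - S.t k)) with hr
    have hr0 : 0 < r := Real.exp_pos _
    have hr1 : r ≤ 1 := Real.exp_le_one_iff.2 (by nlinarith [S.t_le_succ k])
    have hE0 : 0 ≤ ∑ j ∈ Finset.univ.erase (istar k), quad (d.Q j) (e k j) :=
      Finset.sum_nonneg fun j _ => hQn k j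
    have hu0 : 0 ≤ u := div_nonneg hE0 (by linarith)
    have huE : u ≤ ∑ i, quad (d.Q i) (e k i) :=
      (div_le_self hE0 (by linarith)).trans
        (Finset.sum_le_sum_of_subset_of_nonneg (Finset.erase_subset _ _) fun j _ _ => hQn k j)
    have hV0 := functional_nonneg (x := x) hN hηm hτM hd (hsk k)
    have hV1 : functional sys d ηm τM α x (S.s 0) (S.t (k + 1)) ≤
        functional sys d ηm τM α x (S.s 0) (S.t k) + ∑ i, quad (d.Q i) (e k i) + β := by
      have h1 : r * (functional sys d ηm τM α x (S.s 0) (S.t k) + u) ≤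
          functional sys d ηm τM α x (S.s 0) (S.t k) + u :=
        mul_le_of_le_one_left (by linarith) hr1
      have h2 := mul_nonneg hr0.le hβ
      linarith
    have hgap : sampleGap sys d S x k ≤ functional sys d ηm τM α x (S.s 0) (S.t (k + 1)) := by
      have h1 := functional_jump (sys := sys) hN hηm hα.le hd.Q_pos k (k + 1) le_rfl hx
      have h2 : functional sys d ηm τM α x (S.s k) (S.t (k + 1)) ≤
          functional sys d ηm τM α x (S.s 0) (S.t (k + 1)) := by
        unfold functional
        gcongr
        exact VG_antitone hN hτM hd.Q_pos (hx _ (S.monotone_t (Nat.zero_le _)))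
          (S.t_zero_sub_le_s 0) (S.s_strictMono.monotone (Nat.zero_le k))
          ((S.s_le_t hηm k).trans (S.t_le_succ k)) le_rfl
      have h3 := functional_nonneg (x := x) hN hηm hτM hd (S.s_le_t hηm (k + 1))
      have h4 : 1 ≤ ((N : ℝ) - 1) *
          Real.exp (2 * α * (((N : ℝ) - 2) - (((k + 1 : ℕ) : ℝ) - (k + 1))) * (τM - ηm)) := by
        refine one_le_mul_of_one_le_of_one_le (by linarith) (Real.one_le_exp ?_)
        push_cast
        exact mul_nonneg (mul_nonneg (by positivity) (by linarith)) hh.le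
      have h5 : 0 ≤ sampleGap sys d S x k := outputGap_nonneg hd.Q_pos _ _
      have h6 := mul_le_mul_of_nonneg_right h4 h5
      linarith
    have herr : ∑ i, quad (d.Q i) (e (k + 1) i) ≤
        2 * ∑ i, quad (d.Q i) (e k i) + 2 * sampleGap sys d S x k := by
      rw [sampleGap, outputGap, Finset.mul_sum, Finset.mul_sum, ← Finset.sum_add_distrib]
      refine Finset.sum_le_sum fun i _ => ?_
      have hp := (hd.Q_pos i).posSemidef
      have h1 := quad_nonneg hp (sys.C i *ᵥ (x (S.s k) - x (S.s (k + 1))))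
      by_cases hi : istar k = i
      · subst hi
        rw [hsol.error_succ_active]
        linarith [hQn k (istar k)]
      · rw [hsol.error_succ_inactive hi]
        have := quad_add_le hp (e k i) (sys.C i *ᵥ (x (S.s k) - x (S.s (k + 1)))) one_pos
        linarith
    have hE : 0 ≤ ∑ i, quad (d.Q i) (e k i) := Finset.sum_nonneg fun j _ => hQn k j
    -- With `V`, `E` the old functional and error sum, the new functional is at most `V + E + β` and
    -- dominates the gap, and the new error sum is at most `2E` plus twice the gap. The new total is
    -- at most `3V + 5E + 4β`, hence the factor `5`.
    rw [pow_succ]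
    linarith

/-- `x`-ISS follows from exponential decay of the functional up to the contribution of `ω`. -/
theorem isXISSFrom_of_functional_le {sys : HybridSystem n q N p} {d : Decision n p}
    {ηm τM α : ℝ} (hN : 2 ≤ N) (hηm : 0 ≤ ηm) (hτM : ηm < τM) (hα : 0 < α)
    (hd : SatisfiesLMIs sys d ηm τM α) {prot : Protocol p} {k₀ : ℕ}
    (hbound : ∀ (S : Sampling ηm τM) (istar : ℕ → Fin N) (ω : ℝ → Fin q → ℝ)
      (x : ℝ → Fin n → ℝ) (e : ℕ → ∀ i : Fin N, Fin (p i) → ℝ),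
      IsSolution sys S istar ω x e → prot istar e →
      (∀ T, S.t 0 ≤ T → IsRegularOn x (S.t 0 - τM) T) →
      ∀ k, k₀ ≤ k → ∀ t ∈ Icc (S.t k) (S.t (k + 1)), ∀ Δ : ℝ,
      (∀ᵐ s : ℝ, s ∈ Icc (S.t 0) t → eNorm (ω s) ≤ Δ) →
      ∃ a ≤ t, functional sys d ηm τM α x a t ≤ Real.exp (-2 * α * (t - S.t k₀)) *
        (functional sys d ηm τM α x (S.s 0) (S.t k₀) + ∑ i, quad (d.Q i) (e k₀ i))
        + d.b / (2 * α) * Δ ^ 2) :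
    IsXISSFrom sys ηm τM prot k₀ := by
  obtain ⟨l, hl, hlP⟩ := exists_le_quad hd.P_pos
  obtain ⟨K, hK, hKV⟩ := exists_functional_le sys d hηm hτM hα.le
  obtain ⟨K', hK', hKQ⟩ := exists_sum_quad_le d
  have hb := hd.b_pos
  -- The factor `5 ^ k₀` accounts for growth up to `t_{k₀}`, the exponential for measuring decay
  -- from `t_0` instead of `t_{k₀}` (at most `k₀ (τM - ηm)` later), and `1 / l` for passing from
  -- `quad P` to `|x|²`.
  refine ⟨Real.exp (2 * α * (k₀ * (τM - ηm))) * 5 ^ k₀ * (K + K') / l, by positivity, 2 * α,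
    by positivity, (5 ^ k₀ + 1) * (d.b / (2 * α)) / l, by positivity, ?_⟩
  intro S istar ω Δ x e hω hsol hprot t ht
  have hx : ∀ T, S.t 0 ≤ T → IsRegularOn x (S.t 0 - τM) T := fun T hT =>
    hsol.isRegularOn hηm hτM hω hT
  obtain ⟨k, hk, htk⟩ := S.exists_mem_Icc hηm ht
  -- The bounds use `ω` only up to time `t`, so `Δ` may be replaced by the essential supremum over
  -- `[t_0, t]`.
  set Δ' := essSupNorm ω (S.t 0) t
  have hω' : ∀ᵐ s : ℝ, s ∈ Icc (S.t 0) t → eNorm (ω s) ≤ Δ' :=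
    ae_le_essSupNorm (S.t_nonneg hηm 0) hω
  obtain ⟨a, hat, hV⟩ := hbound S istar ω x e hsol hprot hx k hk t htk Δ' hω'
  have hgrow := functional_growth hN hηm hτM hα hd hsol hx (k := k₀) (Δ := Δ') (by
    filter_upwards [hω'] with s hs hs' using hs ⟨hs'.1, hs'.2.trans ht⟩)
  have hlow := (hlP (x t)).trans (quad_le_functional (x := x) hN hηm hτM hd hat)
  have hV0 := hKV x (S.t 0) (S.s 0) hsol.initial (S.t_zero_sub_le_s 0) (S.s_le_t hηm 0)
  have hQ0 := hKQ (e 0)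
  set β := d.b / (2 * α) * Δ' ^ 2 with hβdef
  have hβ : 0 ≤ β := mul_nonneg (div_nonneg hb.le (by positivity)) (sq_nonneg _)
  set Z := normW τM (segment x (S.t 0)) ^ 2
  set E := ∑ i, eNorm (e 0 i) ^ 2
  have hZ : 0 ≤ Z := sq_nonneg _
  have hE : 0 ≤ E := Finset.sum_nonneg fun i _ => sq_nonneg _
  set Y₀ := functional sys d ηm τM α x (S.s 0) (S.t 0) + ∑ i, quad (d.Q i) (e 0 i)
  set Y := functional sys d ηm τM α x (S.s 0) (S.t k₀) + ∑ i, quad (d.Q i) (e k₀ i)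
  have hY₀ : Y₀ ≤ (K + K') * (Z + E) := by
    have h1 := mul_nonneg hK.le hE
    have h2 := mul_nonneg hK'.le hZ
    change functional sys d ηm τM α x (S.s 0) (S.t 0) + ∑ i, quad (d.Q i) (e 0 i) ≤ _
    linarith
  have hY : Y ≤ 5 ^ k₀ * ((K + K') * (Z + E)) + 5 ^ k₀ * β := by
    have h1 : (5 : ℝ) ^ k₀ * (Y₀ + β) ≤ 5 ^ k₀ * ((K + K') * (Z + E) + β) := by gcongr
    linarith
  set r := Real.exp (-2 * α * (t - S.t k₀)) with hr
  have hr1 : r ≤ 1 := Real.exp_le_one_iff.2 (by nlinarith)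
  have hr2 : r ≤ Real.exp (-(2 * α) * (t - S.t 0)) * Real.exp (2 * α * (k₀ * (τM - ηm))) := by
    rw [hr, ← Real.exp_add, Real.exp_le_exp]
    have h1 := S.t_le_add 0 k₀
    rw [zero_add] at h1
    have h2 := mul_le_mul_of_nonneg_left h1 (by positivity : 0 ≤ 2 * α)
    linarith
  have h5 : (0 : ℝ) < 5 ^ k₀ := by positivity
  have hfin : l * eNorm (x t) ^ 2 ≤ Real.exp (-(2 * α) * (t - S.t 0)) *
      Real.exp (2 * α * (k₀ * (τM - ηm))) * (5 ^ k₀ * ((K + K') * (Z + E)))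
      + (5 ^ k₀ + 1) * β := by
    calc l * eNorm (x t) ^ 2 ≤ r * Y + β := hlow.trans hV
      _ ≤ r * (5 ^ k₀ * ((K + K') * (Z + E)) + 5 ^ k₀ * β) + β := by gcongr
      _ = r * (5 ^ k₀ * ((K + K') * (Z + E))) + r * (5 ^ k₀ * β) + β := by ring
      _ ≤ Real.exp (-(2 * α) * (t - S.t 0)) *
          Real.exp (2 * α * (k₀ * (τM - ηm))) * (5 ^ k₀ * ((K + K') * (Z + E)))
          + 1 * (5 ^ k₀ * β) + β := by gcongr
      _ = _ := by ring
  rw [mul_comm, ← le_div_iff₀ hl] at hfin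
  refine hfin.trans (le_of_eq ?_)
  rw [hβdef]
  field_simp

/-- The conclusions hold whenever the LMIs hold with a positive decay rate. -/
theorem SatisfiesLMIs.conclusion {sys : HybridSystem n q N p} {d : Decision n p}
    {ηm τM α : ℝ} (hN : 2 ≤ N) (hηm : 0 ≤ ηm) (hτM : ηm < τM) (hα : 0 < α)
    (hd : SatisfiesLMIs sys d ηm τM α) : Conclusion sys d ηm τM α := by
  have hdist : ∀ {S : Sampling ηm τM} {ω : ℝ → Fin q → ℝ} {Δ t : ℝ}, IsDisturbance ω Δ →
      ∀ᵐ s : ℝ, s ∈ Icc (S.t 0) t → eNorm (ω s) ≤ Δ := by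
    intro S ω Δ t hω
    filter_upwards [hω.2.2] with s hs hs' using hs ((S.t_nonneg hηm 0).trans hs'.1)
  have two : ∀ prot : Protocol p, N = 2 → (∀ istar e, prot istar e →
      ∀ k, ∑ j ∈ Finset.univ.erase (istar (k + 1)), quad (d.Q j) (e (k + 1) j) ≤
        quad (d.Q (istar k)) (e (k + 1) (istar k))) →
      BoundFromStart sys d ηm τM α prot ∧ IsXISSFrom sys ηm τM prot 0 := by
    intro prot hN2 hprot
    refine ⟨fun S istar ω Δ x e hω hsol hpr k t ht => ?_,
      isXISSFrom_of_functional_le hN hηm hτM hα hd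
        fun S istar ω x e hsol hpr hx k _ t ht Δ hω => ?_⟩
    · exact functional_le_of_two hN2 hηm hτM hα hd hsol
        (fun T hT => hsol.isRegularOn hηm hτM hω hT) (hprot istar e hpr)
        (Ico_subset_Icc_self ht) (hdist hω)
    · exact ⟨S.s k, (S.s_le_t hηm k).trans ht.1,
        functional_le_of_two hN2 hηm hτM hα hd hsol hx (hprot istar e hpr) ht hω⟩
  refine ⟨fun _ => ⟨fun S istar ω Δ x e hω hsol hrr k hk t ht => ?_,
    isXISSFrom_of_functional_le hN hηm hτM hα hd
      fun S istar ω x e hsol hrr hx k hk t ht Δ hω => ⟨_, ?_,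
        functional_le_of_roundRobin hN hηm hτM hα hd hsol hx hrr hk ht hω⟩⟩,
    fun hN2 => ⟨two _ hN2 fun _ _ h => TOD.sum_erase_le hN2 h,
      two _ hN2 fun _ _ h => RR.sum_erase_le hN2 h⟩⟩
  · have h := functional_le_of_roundRobin hN hηm hτM hα hd hsol
      (fun T hT => hsol.isRegularOn hηm hτM hω hT) hrr hk (Ico_subset_Icc_self ht) (hdist hω)
    have hN1 : ¬ N ≤ N - 1 := by omega
    unfold VRR
    rw [if_neg hN1]
    exact h
  · split_ifs
    · exact (S.s_le_t hηm k).trans ht.1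
    · exact ((S.s_strictMono.monotone (Nat.zero_le k)).trans (S.s_le_t hηm k)).trans ht.1

end

end RoundRobin

end

theorem theorem2 {n q N : ℕ} {p : Fin N → ℕ} (hN : 2 ≤ N)
    (sys : RoundRobin.HybridSystem n q N p) (ηm τM : ℝ) (hηm : 0 ≤ ηm) (hτM : ηm < τM) :
    (∀ α : ℝ, 0 < α → ∀ d : RoundRobin.Decision n p,
      RoundRobin.SatisfiesLMIs sys d ηm τM α → RoundRobin.Conclusion sys d ηm τM α) ∧
    (∀ d : RoundRobin.Decision n p, RoundRobin.SatisfiesLMIs sys d ηm τM 0 →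
      ∃ αbar : ℝ, 0 < αbar ∧ ∀ α₀ : ℝ, 0 < α₀ → α₀ ≤ αbar →
        RoundRobin.Conclusion sys d ηm τM α₀) := by
  refine ⟨fun α hα d hd => hd.conclusion hN hηm hτM hα, fun d hd => ?_⟩
  obtain ⟨αbar, hpos, h⟩ := hd.exists_pos
  exact ⟨αbar, hpos, fun α₀ h₀ h₁ => (h α₀ h₀ h₁).conclusion hN hηm hτM h₀⟩
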